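/- Let $\rho:\mathbb R\to[0,\infty)$ be an even probability density with $\int x^2\rho(x)\,dx=1$, with $\int \rho(x)^{1+\epsilon}\,dx<\infty$ for some $\epsilon>0$, and whose Fourier transform $\hat\rho(f)=\int e^{2\pi i f x}\rho(x)\,dx$ is analytic in a neighborhood of $0$. For each $n\ge 1$ let $X_1,\dots,X_n$ be i.i.d. with density $\rho$, and for $\sigma\in\{-1,+1\}^n$ define the energy $$E(\sigma)=\frac1{\sqrt n}\Bigl|\sum_{i=1}^n\sigma_iX_i\Bigr| .$$ The configurations $\sigma$ and $-\sigma$ represent the same partition, so that there are $2^{n-1}$ distinct partitions; for $a\le b$ let $Z_n(a,b)$ be the number of distinct partitions $\{\sigma,-\sigma\}$ with $E(\sigma)\in[a,b]$. Let $g_n$ be the density of $E(\sigma)$ on $[0,\infty)$ (it does not depend on $\sigma$, and for all large $n$ it is taken in its version that is continuous on $[0,\infty)$). Let $(\alpha_n)$ be a sequence of positive real numbers with $\alpha_n=o(n^{1/4})$, and set $\xi_n=\dfrac{1}{2^{n-1}g_n(\alpha_n)}$. Let $m\ge1$, let $[c_1,d_1],\dots,[c_m,d_m]$ be intervals with $0\le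 c_\ell<d_\ell$ that are non-overlapping (i.e. have pairwise disjoint interiors), and let $k_1,\dots,k_m$ be positive integers. Put $a_n^\ell=\alpha_n+c_\ell\xi_n$, $b_n^\ell=\alpha_n+d_\ell\xi_n$ and $\gamma_\ell=d_\ell-c_\ell$. Then $$\lim_{n\to\infty}\mathbb E\Bigl[\prod_{\ell=1}^m\bigl(Z_n(a_n^\ell,b_n^\ell)\bigr)_{k_\ell}\Bigr]=\prod_{\ell=1}^m\gamma_\ell^{k_\ell},$$ where $(Z)_k=Z(Z-1)\cdots(Z-k+1)$. -/

import Mathlib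

namespace NumberPartition

open MeasureTheory Set

noncomputable section

/-- Spin configurations `σ ∈ {-1, +1}ⁿ`. -/
abbrev Config (n : ℕ) : Type := Fin n → ℤˣ

/-- The energy `E(σ) = n^{-1/2} |∑ i, σ i * X i|` of `σ` for the weights `X`. -/
def energy {n : ℕ} (X : Fin n → ℝ) (σ : Config n) : ℝ :=
  1 / Real.sqrt n * |∑ i, ((σ i : ℤ) : ℝ) * X i|

/-- `σ` and `-σ` describe the same partition. -/
def partitionSetoid (n : ℕ) : Setoid (Config n) where
  r σ τ := σ = τ ∨ σ = -τ
  iseqv :=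
    { refl := fun _ => Or.inl rfl
      symm := by
        rintro σ τ (h | h)
        · exact Or.inl h.symm
        · exact Or.inr (by rw [h, neg_neg])
      trans := by
        rintro σ τ υ (rfl | rfl) (rfl | rfl)
        · exact Or.inl rfl
        · exact Or.inr rfl
        · exact Or.inr rfl
        · exact Or.inl (neg_neg _) }

/-- The distinct partitions (there are `2 ^ (n - 1)` of them for `n ≥ 1`). -/
def Partition (n : ℕ) : Type := Quotient (partitionSetoid n)

theorem energy_neg {n : ℕ} (X : Fin n → ℝ) (σ : Config n) : energy X (-σ) = energy X σ := by
  simp [energy, Finset.sum_neg_distrib, abs_neg]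

/-- The energy of a partition. -/
def partitionEnergy {n : ℕ} (X : Fin n → ℝ) : Partition n → ℝ :=
  Quotient.lift (energy X) (by
    rintro σ τ (rfl | rfl)
    · rfl
    · exact energy_neg X τ)

/-- `Z_n(a, b)`: the number of points of the energy spectrum (one point for each distinct
partition) in `[a, b]`. -/
def Z {n : ℕ} (X : Fin n → ℝ) (a b : ℝ) : ℕ :=
  Nat.card {p : Partition n // partitionEnergy X p ∈ Icc a b}

/-- The joint law of `n` independent weights with common density `ρ`. -/
def weightLaw (ρ : ℝ → ℝ) (n : ℕ) : Measure (Fin n → ℝ) :=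
  Measure.pi fun _ => volume.withDensity fun x => ENNReal.ofReal (ρ x)

/-- The assumptions on the density `ρ` of the weights. -/
structure Admissible (ρ : ℝ → ℝ) : Prop where
  measurable : Measurable ρ
  nonneg : ∀ x, 0 ≤ ρ x
  integrable : Integrable ρ
  integral_eq_one : ∫ x, ρ x = 1
  even : ∀ x, ρ (-x) = ρ x
  integrable_sq : Integrable fun x => x ^ 2 * ρ x
  second_moment : ∫ x, x ^ 2 * ρ x = 1
  integrable_rpow : ∃ ε : ℝ, 0 < ε ∧ Integrable fun x => |ρ x| ^ (1 + ε)
  fourier_analytic : AnalyticAt ℝ (FourierTransform.fourier fun x : ℝ => (ρ x : ℂ)) 0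

/-- `g` is the density on `[0, ∞)` of the energy of every configuration, in its version that is
continuous on `[0, ∞)`. Such a `g` is determined uniquely on `[0, ∞)`. -/
structure IsContinuousEnergyDensity (ρ : ℝ → ℝ) (n : ℕ) (g : ℝ → ℝ) : Prop where
  nonneg : ∀ y, 0 ≤ g y
  continuousOn : ContinuousOn g (Ici 0)
  law : ∀ σ : Config n, (weightLaw ρ n).map (fun X => energy X σ) =
    (volume.restrict (Ici 0)).withDensity fun y => ENNReal.ofReal (g y)

open Classical in
/-- `g_n`: the density of the energy of a configuration. The continuous version is taken whenever
there is one (for an admissible `ρ` this is the case for all large `n`); otherwise it is a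
Radon-Nikodym derivative of the law of the energy. -/
def energyDensity (ρ : ℝ → ℝ) (n : ℕ) : ℝ → ℝ :=
  if h : ∃ g, IsContinuousEnergyDensity ρ n g then h.choose
  else fun y => (((weightLaw ρ n).map fun X => energy X (1 : Config n)).rnDeriv volume y).toReal

/-- The scaling factor `ξ_n = 1 / (2 ^ (n - 1) * g_n(α_n))`. -/
def scaling (ρ : ℝ → ℝ) (α : ℕ → ℝ) (n : ℕ) : ℝ :=
  1 / (2 ^ (n - 1) * energyDensity ρ n (α n))

end

end NumberPartition

open MeasureTheory Set Filter
open scoped FourierTransform SchwartzMap ENNReal Topology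

/-! Since `α n > 0`, a partition with energy in a window `[α + c ξ, α + d ξ]` has exactly one
representative `σ` whose normalized signed sum is positive, so `Z` counts configurations whose
signed sum lies in the window. A product of falling factorials of such counts is a sum over sign
arrays `s` with `K = ∑ k_l` rows, distinct within each block. Its expectation is the sum over these
arrays of the probability that all row sums hit their windows. Equal rows in different blocks would
force a signed sum to hit one point, an event of probability zero, so only arrays with distinct rows
matter (`tendsto_sum_injective`).

The transform of the vector of row sums factorizes over the columns of `s`, which are vectors in
`{±1}^K`. An array is typical when every column type has frequency at least `δ` and the overlaps of
distinct rows are at most `overlapThreshold`. For such arrays an exponential tilt by `α` followed by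
Fourier inversion gives a local limit theorem (`tendsto_measureReal_boxEvent`): the probability is
asymptotic to `∏ (d_j - c_j) * (ξ e^{-α²/2} / √(2π))^K`, uniformly over typical arrays. Evenness of
`ρ` kills the cubic term of the Taylor expansion, so the error is of order `α⁴/n`; this is where `α
= o(n^{1/4})` enters. The same theorem with one row gives `g_n(α) ~ 2 e^{-α²/2} / √(2π)`, hence `2^n
ξ e^{-α²/2} → √(2π)` (`Admissible.scalingRegime`). As nearly all of the `2^{nK}` arrays are typical,
they contribute `∏ (d_j - c_j)` in the limit (`tendsto_sum_typical`).

The other arrays contribute nothing. For balanced arrays with a large overlap, the probability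
exceeds the typical order by at most a factor `exp(α² (meanSqColSum - K) / 2)` up to a constant, and
Cauchy-Schwarz plays its exponential moments against the rarity of large overlaps
(`tendsto_sum_overlap_gt`).

For unbalanced arrays (`exists_tendsto_sum_unbalanced`), let `T` be the set of column types
occurring at least `M` times and `r` the rank of the rows restricted to `T`. Then `|T| ≤ 2^r`, there
are roughly `|T|^n` such arrays, and the probability is `O((ξ√n)^r)` with `ξ√n` equal to `2^{-n}` up
to subexponential factors. This suffices if `|T| < 2^r`. If `|T| = 2^r` and `r < K`, a further row
agrees up to sign with a basis row on all frequent columns, and the remaining columns supply an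
extra factor `(ξ√n)^β`. If `r = K`, all types are frequent, and unbalanced arrays of this kind are
exponentially rare. -/

/-! ### Fourier transforms of functions in L¹ ∩ L^{1+ε} -/

theorem continuous_fourier_of_integrable {g : ℝ → ℂ} (hg : Integrable g) : Continuous (𝓕 g) :=
  VectorFourier.fourierIntegral_continuous Real.continuous_fourierChar (by fun_prop) hg

/-- Both transforms define the same tempered distribution: against a test function, the Fourier
operator can be moved onto the test function in either definition. This makes Plancherel available
for the transform given by the integral. -/
theorem fourier_toLp_two_ae_eq {g : ℝ → ℂ} (hg : Integrable g) (hg2 : MemLp g 2) :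
    (𝓕 (hg2.toLp g) : Lp ℂ 2 (volume : Measure ℝ)) =ᵐ[volume] 𝓕 g := by
  refine ae_eq_of_integral_contDiff_smul_eq ((Lp.memLp _).locallyIntegrable (by norm_num))
    (continuous_fourier_of_integrable hg).locallyIntegrable fun φ hφ hφc => ?_
  have hφc' : HasCompactSupport fun x => (φ x : ℂ) := hφc.comp_left (g := ((↑) : ℝ → ℂ)) (by simp)
  have hφ' : ContDiff ℝ ((⊤ : ℕ∞) : WithTop ℕ∞) fun x => (φ x : ℂ) :=
    Complex.ofRealCLM.contDiff.comp hφ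
  let ψ : 𝓢(ℝ, ℂ) := hφc'.toSchwartzMap hφ'
  have h1 := DFunLike.congr_fun (Lp.fourier_toTemperedDistribution_eq (hg2.toLp g)) ψ
  rw [TemperedDistribution.fourier_apply, Lp.toTemperedDistribution_apply,
    Lp.toTemperedDistribution_apply] at h1
  have h2 : ∫ x, (𝓕 ψ) x • g x = ∫ x, ψ x • 𝓕 g x := by
    have := VectorFourier.integral_fourierIntegral_smul_eq_flip (μ := volume) (ν := volume)
      (L := innerₗ ℝ) (e := Real.fourierChar) (f := ψ) (g := g) Real.continuous_fourierChar
      (by fun_prop) ψ.integrable hg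
    simpa using! this
  have h3 : ∫ x, (𝓕 ψ) x • (hg2.toLp g : ℝ → ℂ) x = ∫ x, (𝓕 ψ) x • g x := by
    refine integral_congr_ae ?_
    filter_upwards [hg2.coeFn_toLp] with x hx
    rw [hx]
  have h4 := h1.symm.trans (h3.trans h2)
  simpa [ψ] using! h4

theorem eLpNorm_two_fourier_eq {g : ℝ → ℂ} (hg : Integrable g) (hg2 : MemLp g 2) :
    eLpNorm (𝓕 g) 2 volume = eLpNorm g 2 volume := by
  rw [← eLpNorm_congr_ae (fourier_toLp_two_ae_eq hg hg2)]
  have h := Lp.norm_fourier_eq (hg2.toLp g)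
  rw [Lp.norm_def, Lp.norm_toLp] at h
  exact (ENNReal.toReal_eq_toReal_iff' (Lp.eLpNorm_ne_top _) hg2.eLpNorm_ne_top).1 h

theorem norm_fourier_le_integral {g : ℝ → ℝ} (hg0 : ∀ x, 0 ≤ g x) (u : ℝ) :
    ‖𝓕 (fun x => (g x : ℂ)) u‖ ≤ ∫ x, g x := by
  refine (VectorFourier.norm_fourierIntegral_le_integral_norm _ _ _ _ _).trans (le_of_eq ?_)
  exact integral_congr_ae (Eventually.of_forall fun x => by simp [abs_of_nonneg (hg0 x)])

/-- The distribution function of the Fourier transform of a function in `L¹ ∩ L^{1+ε}`. -/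
theorem volume_lt_norm_fourier_le {ε A B : ℝ} (hε : 0 < ε) (hB : 0 < B) {g : ℝ → ℝ}
    (hm : Measurable g) (hg0 : ∀ x, 0 ≤ g x) (hg : Integrable g) (hA : ∫ x, g x ≤ A)
    (hgε : Integrable fun x => g x ^ (1 + ε)) (hgB : ∫ x, g x ^ (1 + ε) ≤ B) {s : ℝ} (hs : 0 < s) :
    volume {u | s < ‖𝓕 (fun x => (g x : ℂ)) u‖} ≤
      ENNReal.ofReal (4 * A * (2 * B) ^ (1 / ε) * s ^ (-(2 + 1 / ε))) := by
  -- The truncation height is chosen so that the part of `g` above `T` has L¹ norm at most `T^{-ε} B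
  -- = s/2`. A frequency with `|ĝ| > s` then has `|ĝ₁| ≥ s/2` for the bounded part, whose squared L²
  -- norm is at most `T A`; Plancherel and Chebyshev finish.
  set T : ℝ := (2 * B / s) ^ (1 / ε) with hT
  have hT0 : 0 < T := by positivity
  have hTε : T ^ ε = 2 * B / s := by
    rw [hT, ← Real.rpow_mul (by positivity)]; simp [hε.ne']
  set g1 : ℝ → ℝ := {x | g x ≤ T}.indicator g with hg1
  set g2 : ℝ → ℝ := {x | g x ≤ T}ᶜ.indicator g with hg2
  have hmT : MeasurableSet {x | g x ≤ T} := measurableSet_le hm measurable_const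
  have hi1 : Integrable g1 := hg.indicator hmT
  have hi2 : Integrable g2 := hg.indicator hmT.compl
  have h10 : ∀ x, 0 ≤ g1 x := fun x => indicator_nonneg (fun x _ => hg0 x) x
  have h20 : ∀ x, 0 ≤ g2 x := fun x => indicator_nonneg (fun x _ => hg0 x) x
  have h2le : ∫ x, g2 x ≤ s / 2 := by
    have : ∀ x, g2 x ≤ T ^ (-ε) * g x ^ (1 + ε) := by
      intro x
      by_cases hx : g x ≤ T
      · rw [hg2, indicator_of_notMem (by simpa using hx)]
        have := hg0 x
        positivity
      · rw [hg2, indicator_of_mem (by simpa using hx)]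
        push Not at hx
        have hgx : 0 < g x := hT0.trans hx
        rw [Real.rpow_add hgx, Real.rpow_one, Real.rpow_neg hT0.le]
        have := Real.rpow_le_rpow hT0.le hx.le hε.le
        have h3 : 0 < T ^ ε := by positivity
        rw [← div_eq_inv_mul, le_div_iff₀ h3]
        gcongr
    calc ∫ x, g2 x ≤ ∫ x, T ^ (-ε) * g x ^ (1 + ε) := integral_mono hi2 (hgε.const_mul _) this
      _ ≤ T ^ (-ε) * B := by rw [integral_const_mul]; gcongr
      _ = s / 2 := by rw [Real.rpow_neg hT0.le, hTε]; field_simp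
  have hsplit : ∀ u, 𝓕 (fun x => (g x : ℂ)) u =
      𝓕 (fun x => (g1 x : ℂ)) u + 𝓕 (fun x => (g2 x : ℂ)) u := by
    intro u
    simp only [Real.fourier_eq]
    rw [← integral_add]
    · congr 1; ext x
      rw [← smul_add, ← Complex.ofReal_add]
      congr 2
      exact (congrFun (indicator_self_add_compl {x | g x ≤ T} g) x).symm
    · exact (Real.fourierIntegral_convergent_iff (μ := volume) u).2 (hi1.ofReal (𝕜 := ℂ))
    · exact (Real.fourierIntegral_convergent_iff (μ := volume) u).2 (hi2.ofReal (𝕜 := ℂ))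
  have hsub : {u | s < ‖𝓕 (fun x => (g x : ℂ)) u‖} ⊆
      {u | ENNReal.ofReal (s / 2) ≤ ‖𝓕 (fun x => (g1 x : ℂ)) u‖ₑ} := by
    intro u hu
    simp only [mem_ofPred_eq] at hu ⊢
    rw [hsplit] at hu
    have h3 := norm_add_le (𝓕 (fun x => (g1 x : ℂ)) u) (𝓕 (fun x => (g2 x : ℂ)) u)
    have h4 := (norm_fourier_le_integral h20 u).trans h2le
    rw [← ofReal_norm]
    exact ENNReal.ofReal_le_ofReal (by linarith)
  have hbd : ∀ x, ‖(g1 x : ℂ)‖ ^ 2 ≤ T * g x := by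
    intro x
    by_cases hx : g x ≤ T
    · rw [hg1, indicator_of_mem (by simpa using hx)]
      have := hg0 x
      rw [Complex.norm_real, Real.norm_eq_abs, sq_abs]
      nlinarith
    · rw [hg1, indicator_of_notMem (by simpa using hx)]
      have := hg0 x
      simp; positivity
  have hmeas1 : AEStronglyMeasurable (fun x => (g1 x : ℂ)) :=
    (Complex.measurable_ofReal.comp (hm.indicator hmT)).aestronglyMeasurable
  have hint2 : Integrable fun x => ‖(g1 x : ℂ)‖ ^ 2 :=
    Integrable.mono' (hg.const_mul T) (hmeas1.norm.pow 2)
      (Eventually.of_forall fun x => by simpa using hbd x)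
  have hL2 : MemLp (fun x => (g1 x : ℂ)) 2 :=
    (memLp_two_iff_integrable_sq_norm hmeas1).2 hint2
  have hle : eLpNorm (fun x => (g1 x : ℂ)) 2 volume ^ 2 ≤ ENNReal.ofReal (T * A) := by
    rw [hL2.eLpNorm_eq_integral_rpow_norm (by norm_num) (by norm_num)]
    have h0 : 0 ≤ ∫ x, ‖(g1 x : ℂ)‖ ^ 2 := integral_nonneg fun x => by positivity
    rw [← ENNReal.ofReal_pow (by positivity)]
    refine ENNReal.ofReal_le_ofReal ?_
    simp only [ENNReal.toReal_ofNat, Real.rpow_ofNat]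
    rw [← Real.rpow_natCast, ← Real.rpow_mul h0]
    norm_num
    calc ∫ x, g1 x ^ 2 ≤ ∫ x, T * g x :=
          integral_mono (by simpa using hint2) (hg.const_mul T) (fun x => by simpa using hbd x)
      _ ≤ T * A := by rw [integral_const_mul]; gcongr
  have hcheb := mul_meas_ge_le_pow_eLpNorm' (volume : Measure ℝ) (p := 2) (by norm_num) (by norm_num)
    (continuous_fourier_of_integrable (hi1.ofReal (𝕜 := ℂ))).aestronglyMeasurable
    (ENNReal.ofReal (s / 2))
  rw [eLpNorm_two_fourier_eq (hi1.ofReal (𝕜 := ℂ)) hL2] at hcheb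
  simp only [ENNReal.toReal_ofNat, ENNReal.rpow_ofNat] at hcheb
  have hcheb' := hcheb.trans hle
  rw [← ENNReal.ofReal_pow (by positivity), mul_comm] at hcheb'
  refine (measure_mono hsub).trans ?_
  refine ((ENNReal.le_div_iff_mul_le (Or.inl (by simp; positivity)) (Or.inl (by simp))).2 hcheb').trans ?_
  rw [← ENNReal.ofReal_div_of_pos (by positivity)]
  refine ENNReal.ofReal_le_ofReal (le_of_eq ?_)
  rw [hT, Real.div_rpow (by positivity) (by positivity), Real.rpow_neg hs.le, Real.rpow_add hs]
  norm_num
  field_simp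
  norm_num
  ring

/-- Layer-cake formula: levels above `A` are empty because `|ĝ| ≤ ∫ g`, and near zero `s^{M-1}`
times the tail bound is integrable exactly when `M > 2 + 1/ε`. The constant depends on `g` only
through `A` and `B`, which is needed for uniformity over tilted densities. -/
theorem exists_lintegral_norm_fourier_pow_le {ε A B : ℝ} (hε : 0 < ε) (hB : 0 < B) {M : ℕ}
    (hM : 2 + 1 / ε < M) : ∃ C : ℝ≥0∞, C ≠ ∞ ∧ ∀ g : ℝ → ℝ,
    Measurable g → (∀ x, 0 ≤ g x) → Integrable g → ∫ x, g x ≤ A →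
    (Integrable fun x => g x ^ (1 + ε)) → ∫ x, g x ^ (1 + ε) ≤ B →
    ∫⁻ u, ENNReal.ofReal (‖𝓕 (fun x => (g x : ℂ)) u‖ ^ M) ≤ C := by
  have hM0 : (0 : ℝ) < M := lt_trans (by positivity) hM
  set D := 4 * A * (2 * B) ^ (1 / ε) with hD
  have hintg : IntegrableOn (fun s : ℝ => D * s ^ ((M : ℝ) - 1 - (2 + 1 / ε))) (Ioo 0 A) := by
    by_cases hA : 0 ≤ A
    · have h1 : IntervalIntegrable (fun s : ℝ => s ^ ((M : ℝ) - 1 - (2 + 1 / ε))) volume 0 A :=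
        intervalIntegral.intervalIntegrable_rpow' (by linarith)
      exact (((intervalIntegrable_iff_integrableOn_Ioo_of_le hA).1 h1).const_mul D)
    · rw [Ioo_eq_empty (by push Not at hA; exact hA.not_gt)]; exact integrableOn_empty
  refine ⟨ENNReal.ofReal M * ∫⁻ s in Ioo 0 A, ENNReal.ofReal (D * s ^ ((M : ℝ) - 1 - (2 + 1 / ε))),
    ENNReal.mul_ne_top (by simp) hintg.lintegral_lt_top.ne, ?_⟩
  intro g hm hg0 hg hA hgε hgB
  have h1 := lintegral_rpow_eq_lintegral_meas_lt_mul (volume : Measure ℝ)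
    (f := fun u => ‖𝓕 (fun x => (g x : ℂ)) u‖) (Eventually.of_forall fun u => norm_nonneg _)
    (continuous_fourier_of_integrable (hg.ofReal (𝕜 := ℂ))).norm.measurable.aemeasurable hM0
  simp only [Real.rpow_natCast] at h1
  rw [h1]
  refine mul_le_mul_right ?_ _
  rw [← lintegral_indicator measurableSet_Ioi, ← lintegral_indicator measurableSet_Ioo]
  refine lintegral_mono fun s => ?_
  by_cases hs : 0 < s
  swap
  · simp [indicator, hs]
  rw [indicator_of_mem (mem_Ioi.2 hs)]
  by_cases hsA : s < A
  · rw [indicator_of_mem (mem_Ioo.2 ⟨hs, hsA⟩)]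
    refine (mul_le_mul_left (volume_lt_norm_fourier_le hε hB hm hg0 hg hA hgε hgB hs) _).trans ?_
    rw [← ENNReal.ofReal_mul' (by positivity), mul_assoc, ← Real.rpow_add hs]
    refine ENNReal.ofReal_le_ofReal (le_of_eq ?_)
    rw [hD]; congr 2; ring
  · have : {u | s < ‖𝓕 (fun x => (g x : ℂ)) u‖} = ∅ := by
      ext u
      have := norm_fourier_le_integral hg0 u
      simp only [mem_ofPred_eq, mem_empty_iff_false, iff_false, not_lt]
      linarith
    simp [this]

/-! ### Exponential moments from analyticity of the Fourier transform at 0 -/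

theorem exists_norm_second_difference_le {ψ : ℝ → ℂ} (h : AnalyticAt ℝ ψ 0) :
    ∃ C : ℝ, ∀ᶠ y in 𝓝 (0 : ℝ), ‖ψ y + ψ (-y) - 2 * ψ 0‖ ≤ C * y ^ 2 := by
  obtain ⟨p, hp⟩ := h
  have h1 := hp.isBigO_sub_partialSum_pow 2
  have htend : Tendsto (fun y : ℝ => -y) (𝓝 0) (𝓝 0) := by
    simpa using (continuous_neg (G := ℝ)).tendsto 0
  have h2 := h1.comp_tendsto htend
  obtain ⟨C, hC⟩ := (h1.add (h2.congr_right (g₂ := fun y => ‖y‖ ^ 2) (by simp))).bound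
  refine ⟨C, hC.mono fun y hy => ?_⟩
  have hp0 : ∀ v, p 0 v = ψ 0 := fun v => hp.coeff_zero v
  have hlin : p 1 (fun _ => -y) = - p 1 (fun _ => y) := by
    simp
  simp only [FormalMultilinearSeries.partialSum, Finset.sum_range_succ, Finset.sum_range_zero,
    zero_add, Function.comp, hp0, hlin] at hy
  simp only [norm_pow, Real.norm_eq_abs, sq_abs] at hy
  refine le_trans (le_of_eq ?_) hy
  congr 1
  ring

/-- Half-angle formula `1 - cos y = 2 sin²(y/2)` together with Jordan's inequality for the sine. -/
theorem sq_le_one_sub_cos {y : ℝ} (hy : |y| ≤ Real.pi) : 2 / Real.pi ^ 2 * y ^ 2 ≤ 1 - Real.cos y := by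
  have key : ∀ z : ℝ, 0 ≤ z → z ≤ Real.pi → 2 / Real.pi ^ 2 * z ^ 2 ≤ 1 - Real.cos z := by
    intro z hz hz'
    have h1 := Real.mul_le_sin (x := z / 2) (by linarith) (by linarith)
    have h2 : Real.cos z = 1 - 2 * Real.sin (z / 2) ^ 2 := by
      have := Real.cos_two_mul' (z / 2)
      have h3 := Real.sin_sq_add_cos_sq (z / 2)
      rw [show (2 : ℝ) * (z / 2) = z by ring] at this
      linarith
    have h4 : (2 / Real.pi * (z / 2)) ^ 2 ≤ Real.sin (z / 2) ^ 2 :=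
      pow_le_pow_left₀ (by positivity) h1 2
    rw [h2]
    have : (2 / Real.pi * (z / 2)) ^ 2 = z ^ 2 / Real.pi ^ 2 := by field_simp
    rw [this] at h4
    have h5 : 2 / Real.pi ^ 2 * z ^ 2 = 2 * (z ^ 2 / Real.pi ^ 2) := by ring
    linarith
  have := key |y| (abs_nonneg y) hy
  simpa using this

theorem fourier_second_difference {w : ℝ → ℝ} (hw : Integrable w) (y : ℝ) :
    𝓕 (fun x => (w x : ℂ)) y + 𝓕 (fun x => (w x : ℂ)) (-y) - 2 * 𝓕 (fun x => (w x : ℂ)) 0 =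
      ((-∫ x, (2 - 2 * Real.cos (2 * Real.pi * y * x)) * w x : ℝ) : ℂ) := by
  have hi : ∀ u : ℝ, Integrable fun v : ℝ =>
      Complex.exp (((-2 * Real.pi * v * u : ℝ) : ℂ) * Complex.I) • (w v : ℂ) := by
    intro u
    have := (Real.fourierIntegral_convergent_iff (μ := volume) u).2 (hw.ofReal (𝕜 := ℂ))
    refine this.congr (Eventually.of_forall fun x => ?_)
    simp only [Real.fourierChar_apply, Circle.smul_def, smul_eq_mul, RCLike.inner_apply,
      conj_trivial]
    congr 3
    push_cast; ring
  simp only [Real.fourier_real_eq_integral_exp_smul]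
  rw [← integral_const_mul, ← integral_add (hi _) (hi _),
    ← integral_sub (by exact (hi _).add (hi _)) ((hi _).const_mul 2), ← integral_neg, ← integral_complex_ofReal]
  congr 1
  ext x
  have : Complex.cos ((2 * Real.pi * y * x : ℝ) : ℂ) =
    (Complex.exp ((2 * Real.pi * y * x : ℝ) * Complex.I) +
      Complex.exp (-(2 * Real.pi * y * x : ℝ) * Complex.I)) / 2 := rfl
  push_cast at this ⊢
  rw [this]
  simp only [smul_eq_mul, mul_zero, zero_mul, Complex.exp_zero]
  rw [show (-2 * Real.pi * x * y * Complex.I : ℂ) = -(2 * Real.pi * y * x) * Complex.I by ring,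
    show (-2 * Real.pi * x * -y * Complex.I : ℂ) = (2 * Real.pi * y * x) * Complex.I by ring]
  ring

/-- The symmetric second difference of `ŵ` at `y = 1/i` is `-∫ (2 - 2 cos(2πx/i)) w`, and it is
`O(1/i²)`. On `|x| ≤ i/2` the kernel is at least `16 x²/i²`, so, `w` being nonnegative, the
truncated second moments are bounded by `C/16` uniformly in `i`. -/
theorem integrable_sq_mul_of_analyticAt_fourier {w : ℝ → ℝ} (hw0 : ∀ x, 0 ≤ w x)
    (hw : Integrable w) (h : AnalyticAt ℝ (𝓕 fun x => (w x : ℂ)) 0) :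
    Integrable fun x => x ^ 2 * w x := by
  obtain ⟨C, hC⟩ := exists_norm_second_difference_le h
  have hC' : ∀ᶠ i : ℝ in atTop, ‖𝓕 (fun x => (w x : ℂ)) (1 / i) + 𝓕 (fun x => (w x : ℂ)) (-(1 / i))
      - 2 * 𝓕 (fun x => (w x : ℂ)) 0‖ ≤ C * (1 / i) ^ 2 := by
    have ht : Tendsto (fun i : ℝ => 1 / i) atTop (𝓝 0) := by
      simpa using tendsto_inv_atTop_zero (𝕜 := ℝ)
    exact ht.eventually hC
  have hfin : ∀ i : ℝ, IntegrableOn (fun x => x ^ 2 * w x) (Ioc (-(i / 2)) (i / 2)) := by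
    intro i
    have : IntegrableOn (fun x => w x * x ^ 2) (Icc (-(i / 2)) (i / 2)) :=
      hw.integrableOn.mul_continuousOn (by fun_prop) isCompact_Icc
    exact (this.mono_set Ioc_subset_Icc_self).congr (Eventually.of_forall fun x => mul_comm _ _)
  refine integrable_of_intervalIntegral_norm_bounded (l := atTop) (a := fun i : ℝ => -(i / 2))
    (b := fun i : ℝ => i / 2) (C / 16) hfin
    (tendsto_neg_atTop_atBot.comp (tendsto_id.atTop_div_const (by norm_num)))
    (tendsto_id.atTop_div_const (by norm_num)) ?_
  · filter_upwards [hC', eventually_gt_atTop 0] with i hi hi0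
    rw [fourier_second_difference hw, Complex.norm_real, norm_neg, Real.norm_eq_abs] at hi
    have hI2 : Integrable fun x => (2 - 2 * Real.cos (2 * Real.pi * (1 / i) * x)) * w x := by
      refine hw.bdd_mul (c := 4) (by fun_prop) (Eventually.of_forall fun x => ?_)
      have h1 := Real.cos_le_one (2 * Real.pi * (1 / i) * x)
      have h2 := Real.neg_one_le_cos (2 * Real.pi * (1 / i) * x)
      rw [Real.norm_eq_abs, abs_le]; constructor <;> linarith
    have hnn : ∀ x, 0 ≤ (2 - 2 * Real.cos (2 * Real.pi * (1 / i) * x)) * w x := fun x =>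
      mul_nonneg (by linarith [Real.cos_le_one (2 * Real.pi * (1 / i) * x)]) (hw0 x)
    have h3 := (le_abs_self _).trans hi
    rw [intervalIntegral.integral_of_le (by linarith)]
    have hI3 : IntegrableOn (fun x => x ^ 2 * w x) (Ioc (-(i / 2)) (i / 2)) := hfin i
    have h4 : ∫ x in Ioc (-(i / 2)) (i / 2), ‖x ^ 2 * w x‖ ≤
        ∫ x in Ioc (-(i / 2)) (i / 2), i ^ 2 / 16 * ((2 - 2 * Real.cos (2 * Real.pi * (1 / i) * x)) * w x) := by
      refine setIntegral_mono_on hI3.norm (hI2.const_mul _).integrableOn measurableSet_Ioc ?_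
      intro x hx
      have h6 : |2 * Real.pi * (1 / i) * x| ≤ Real.pi := by
        have : |x| ≤ i / 2 := abs_le.2 ⟨hx.1.le, hx.2⟩
        rw [abs_mul, abs_of_pos (by positivity)]
        calc 2 * Real.pi * (1 / i) * |x| ≤ 2 * Real.pi * (1 / i) * (i / 2) := by gcongr
          _ = Real.pi := by field_simp
      have h7 := sq_le_one_sub_cos h6
      have h8 : x ^ 2 = i ^ 2 / 16 * (2 * (2 / Real.pi ^ 2 * (2 * Real.pi * (1 / i) * x) ^ 2)) := by
        field_simp; ring
      rw [Real.norm_of_nonneg (mul_nonneg (sq_nonneg x) (hw0 x)), ← mul_assoc]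
      refine mul_le_mul_of_nonneg_right ?_ (hw0 x)
      rw [h8]
      gcongr
      linarith
    refine h4.trans ?_
    rw [integral_const_mul]
    have h5 := setIntegral_le_integral (s := Ioc (-(i / 2)) (i / 2)) hI2 (Eventually.of_forall hnn)
    calc i ^ 2 / 16 * _ ≤ i ^ 2 / 16 * (C * (1 / i) ^ 2) := by gcongr; exact h5.trans h3
      _ = C / 16 := by field_simp

theorem integrable_pow_mul_of_integrable_even_pow {w : ℝ → ℝ} (hw : Integrable w) {k : ℕ}
    (hk : Integrable fun x => x ^ (2 * k) * w x) {n : ℕ} (hn : n ≤ 2 * k) :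
    Integrable fun x : ℝ => x ^ n * w x := by
  refine (hw.norm.add hk.norm).mono' (by have := hw.1; fun_prop) (Eventually.of_forall fun x => ?_)
  have h1 : |x| ^ n ≤ 1 + |x| ^ (2 * k) := by
    rcases le_total |x| 1 with h | h
    · have := pow_le_one₀ (n := n) (abs_nonneg x) h
      have := pow_nonneg (abs_nonneg x) (2 * k)
      linarith
    · have := pow_le_pow_right₀ h hn
      linarith
  simp only [norm_mul, norm_pow, Real.norm_eq_abs, Pi.add_apply]
  nlinarith [abs_nonneg (w x)]

theorem iteratedDeriv_even_fourier {w : ℝ → ℝ} (hw : Integrable w) {k : ℕ}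
    (hk : Integrable fun x => x ^ (2 * k) * w x) :
    iteratedDeriv (2 * k) (𝓕 fun x => (w x : ℂ)) =
      fun y => (-1) ^ k * (2 * Real.pi) ^ (2 * k) * 𝓕 (fun x => ((x ^ (2 * k) * w x : ℝ) : ℂ)) y := by
  have h := Real.iteratedDeriv_fourier (f := fun x => (w x : ℂ)) (N := (2 * k : ℕ)) (n := 2 * k)
    (fun n hn => by
      have := (integrable_pow_mul_of_integrable_even_pow hw hk (n := n) (by exact_mod_cast hn)).ofReal
        (𝕜 := ℂ)
      refine this.congr (Eventually.of_forall fun x => ?_)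
      simp [Complex.real_smul]) le_rfl
  rw [h]
  ext y
  simp only [Real.fourier_eq]
  rw [← integral_const_mul]
  congr 1; ext x
  simp only [Circle.smul_def, smul_eq_mul]
  have : (-2 * (Real.pi : ℂ) * Complex.I * x) ^ (2 * k) =
      (-1) ^ k * (2 * Real.pi) ^ (2 * k) * (x : ℂ) ^ (2 * k) := by
    rw [show (-2 * (Real.pi : ℂ) * Complex.I * x) = -((2 * Real.pi) * x * Complex.I) by ring]
    rw [Even.neg_pow (even_two_mul k), mul_pow, mul_pow, pow_mul Complex.I, Complex.I_sq]
    ring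
  rw [this]; push_cast; ring

/-- Induction two moments at a time: up to a nonzero constant, the `2k`-th derivative of `ŵ` is the
transform of the nonnegative function `x^{2k} w`, so the second-moment criterion applies again. -/
theorem integrable_even_pow_mul_of_analyticAt_fourier {w : ℝ → ℝ} (hw0 : ∀ x, 0 ≤ w x)
    (hw : Integrable w) (h : AnalyticAt ℝ (𝓕 fun x => (w x : ℂ)) 0) (k : ℕ) :
    Integrable fun x => x ^ (2 * k) * w x := by
  induction k with
  | zero => simpa using hw
  | succ k ih =>
    have h1 : AnalyticAt ℝ (iteratedDeriv (2 * k) (𝓕 fun x => (w x : ℂ))) 0 := by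
      rw [iteratedDeriv_eq_iterate]; exact h.iterated_deriv _
    rw [iteratedDeriv_even_fourier hw ih] at h1
    have h2 : AnalyticAt ℝ (𝓕 (fun x => ((x ^ (2 * k) * w x : ℝ) : ℂ))) 0 := by
      have h3 := (analyticAt_const (𝕜 := ℝ) (x := (0:ℝ))
        (v := ((-1) ^ k * (2 * Real.pi) ^ (2 * k) : ℂ)⁻¹)).mul h1
      refine h3.congr (Eventually.of_forall fun y => ?_)
      have : ((-1) ^ k * (2 * Real.pi) ^ (2 * k) : ℂ) ≠ 0 := by simp [Real.pi_ne_zero]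
      simp only [Pi.mul_apply]
      rw [inv_mul_cancel_left₀ this]
    have h4 := integrable_sq_mul_of_analyticAt_fourier
      (fun x => mul_nonneg ((even_two_mul k).pow_nonneg x) (hw0 x)) ih h2
    refine h4.congr (Eventually.of_forall fun x => ?_)
    ring

/-- Moments are derivatives at 0, that is, factorials times Taylor coefficients, and the
coefficients obey Cauchy estimates inside the radius of convergence. -/
theorem exists_even_moment_le {w : ℝ → ℝ} (hw0 : ∀ x, 0 ≤ w x)
    (hw : Integrable w) (h : AnalyticAt ℝ (𝓕 fun x => (w x : ℂ)) 0) :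
    ∃ C r : ℝ, 0 < r ∧ ∀ k : ℕ, (∫ x, x ^ (2 * k) * w x) * r ^ (2 * k) ≤ C * (2 * k).factorial := by
  obtain ⟨p, R, hp⟩ := h
  obtain ⟨r, hr0, hr⟩ := ENNReal.lt_iff_exists_nnreal_btwn.1 (hp.r_pos.trans_le hp.r_le)
  obtain ⟨C, hC0, hC⟩ := p.norm_mul_pow_le_of_lt_radius hr
  refine ⟨C, 2 * Real.pi * r, by have : 0 < r := by exact_mod_cast hr0
                                 positivity, fun k => ?_⟩
  have hintg := integrable_even_pow_mul_of_analyticAt_fourier hw0 hw ⟨p, R, hp⟩ k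
  have h1 := hp.factorial_smul 1 (2 * k)
  rw [← iteratedDeriv_eq_iteratedFDeriv] at h1
  have h2 : 𝓕 (fun x => ((x ^ (2 * k) * w x : ℝ) : ℂ)) 0 = ((∫ x, x ^ (2 * k) * w x : ℝ) : ℂ) := by
    rw [Real.fourier_eq, ← integral_complex_ofReal]
    simp
  have h3 := congrArg norm ((h1.trans (congrFun (iteratedDeriv_even_fourier hw hintg) 0)).trans
    (congrArg _ h2))
  have hnn : 0 ≤ ∫ x, x ^ (2 * k) * w x :=
    integral_nonneg fun x => mul_nonneg ((even_two_mul k).pow_nonneg x) (hw0 x)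
  simp only [nsmul_eq_mul, norm_mul, norm_pow, norm_neg, norm_one, one_pow, one_mul,
    Complex.norm_natCast, Complex.norm_real, Complex.norm_ofNat, Real.norm_eq_abs,
    abs_of_pos Real.pi_pos, abs_of_nonneg hnn] at h3
  have h4 : ‖p (2 * k) fun _ => 1‖ ≤ ‖p (2 * k)‖ := by
    simp
  calc (∫ x, x ^ (2 * k) * w x) * (2 * Real.pi * r) ^ (2 * k)
      = ((2 * Real.pi) ^ (2 * k) * ∫ x, x ^ (2 * k) * w x) * (r : ℝ) ^ (2 * k) := by
        rw [mul_pow]; ring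
    _ = (2 * k).factorial * (‖p (2 * k) fun _ => 1‖ * (r : ℝ) ^ (2 * k)) := by rw [← h3]; ring
    _ ≤ (2 * k).factorial * (‖p (2 * k)‖ * (r : ℝ) ^ (2 * k)) := by gcongr
    _ ≤ (2 * k).factorial * C := by gcongr; exact hC _
    _ = _ := mul_comm _ _

theorem exists_integrable_exp_abs_mul {w : ℝ → ℝ} (hm : Measurable w) (hw0 : ∀ x, 0 ≤ w x)
    (hw : Integrable w) (h : AnalyticAt ℝ (𝓕 fun x => (w x : ℂ)) 0) :
    ∃ τ : ℝ, 0 < τ ∧ Integrable fun x => Real.exp (τ * |x|) * w x := by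
  obtain ⟨C, r, hr, hC⟩ := exists_even_moment_le hw0 hw h
  have hintg := integrable_even_pow_mul_of_analyticAt_fourier hw0 hw h
  -- With half the radius the series of `cosh (r/2 * x)`, integrated against `w`, is dominated by a
  -- geometric series of ratio `1/4`; then `exp (r/2 * |x|) ≤ 2 cosh (r/2 * x)`.
  refine ⟨r / 2, by positivity, ?_⟩
  have hcosh : Integrable fun x => Real.cosh (r / 2 * x) * w x := by
    refine ⟨by fun_prop, ?_⟩
    rw [hasFiniteIntegral_iff_ofReal (Eventually.of_forall fun x =>
      mul_nonneg (Real.cosh_pos _).le (hw0 x))]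
    have h1 : ∀ x, ENNReal.ofReal (Real.cosh (r / 2 * x) * w x) =
        ∑' k : ℕ, ENNReal.ofReal ((r / 2 * x) ^ (2 * k) / (2 * k).factorial * w x) := by
      intro x
      have hs := (Real.hasSum_cosh (r / 2 * x)).mul_right (w x)
      rw [← hs.tsum_eq, ENNReal.ofReal_tsum_of_nonneg _ hs.summable]
      intro k
      exact mul_nonneg (div_nonneg ((even_two_mul k).pow_nonneg _) (by positivity)) (hw0 x)
    simp_rw [h1]
    rw [lintegral_tsum (fun k => by fun_prop)]
    have h2 : ∀ k : ℕ, ∫⁻ x, ENNReal.ofReal ((r / 2 * x) ^ (2 * k) / (2 * k).factorial * w x) ≤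
        ENNReal.ofReal (C * (1 / 4) ^ k) := by
      intro k
      have h3 : ∀ x : ℝ, (r / 2 * x) ^ (2 * k) / (2 * k).factorial * w x =
          (1 / 4) ^ k * r ^ (2 * k) / (2 * k).factorial * (x ^ (2 * k) * w x) := by
        intro x
        rw [mul_pow, div_pow, pow_mul (2 : ℝ)]; norm_num
        rw [div_pow]; ring
      simp_rw [h3]
      rw [← ofReal_integral_eq_lintegral_ofReal ((hintg k).const_mul _) (Eventually.of_forall fun x =>
        mul_nonneg (by positivity) (mul_nonneg ((even_two_mul k).pow_nonneg x) (hw0 x)))]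
      refine ENNReal.ofReal_le_ofReal ?_
      rw [integral_const_mul]
      have hf : (0 : ℝ) < (2 * k).factorial := by positivity
      calc (1 / 4) ^ k * r ^ (2 * k) / (2 * k).factorial * ∫ x, x ^ (2 * k) * w x
          = (1 / 4) ^ k * (((∫ x, x ^ (2 * k) * w x) * r ^ (2 * k)) / (2 * k).factorial) := by ring
        _ ≤ (1 / 4) ^ k * C := by gcongr; rw [div_le_iff₀ hf]; exact hC k
        _ = _ := mul_comm _ _
    refine (ENNReal.tsum_le_tsum h2).trans_lt ?_
    have hs : Summable fun k : ℕ => C * (1 / 4 : ℝ) ^ k :=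
      (summable_geometric_of_lt_one (by norm_num) (by norm_num)).mul_left C
    exact hs.tsum_ofReal_lt_top
  refine (hcosh.const_mul 2).mono' (by fun_prop) (Eventually.of_forall fun x => ?_)
  rw [Real.norm_of_nonneg (mul_nonneg (Real.exp_pos _).le (hw0 x)), ← mul_assoc]
  refine mul_le_mul_of_nonneg_right ?_ (hw0 x)
  rw [← Real.cosh_abs, abs_mul, abs_of_pos (by positivity : 0 < r / 2), Real.cosh_eq]
  have := Real.exp_pos (-(r / 2 * |x|))
  linarith

/-! ### The Laplace transform of the law of one weight -/

namespace NumberPartition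

/-- The law of a single weight with density `ρ`. -/
noncomputable def singleLaw (ρ : ℝ → ℝ) : Measure ℝ := volume.withDensity fun x => ENNReal.ofReal (ρ x)

/-- The two-sided Laplace transform of a measure, at complex arguments. -/
noncomputable def laplace (μ : Measure ℝ) (z : ℂ) : ℂ := ∫ x, Complex.exp (z * x) ∂μ

variable {ρ : ℝ → ℝ}

theorem integrable_singleLaw_iff {E : Type*} [NormedAddCommGroup E] [NormedSpace ℝ E]
    (hm : Measurable ρ) (h0 : ∀ x, 0 ≤ ρ x) {f : ℝ → E} :
    Integrable f (singleLaw ρ) ↔ Integrable fun x => ρ x • f x := by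
  rw [singleLaw, integrable_withDensity_iff_integrable_smul' (by fun_prop) (by simp)]
  simp [ENNReal.toReal_ofReal (h0 _)]

theorem integral_singleLaw {E : Type*} [NormedAddCommGroup E] [NormedSpace ℝ E]
    (hm : Measurable ρ) (h0 : ∀ x, 0 ≤ ρ x) (f : ℝ → E) :
    ∫ x, f x ∂(singleLaw ρ) = ∫ x, ρ x • f x := by
  rw [singleLaw, integral_withDensity_eq_integral_toReal_smul (by fun_prop) (by simp)]
  simp [ENNReal.toReal_ofReal (h0 _)]

theorem Admissible.isProbabilityMeasure (hρ : Admissible ρ) : IsProbabilityMeasure (singleLaw ρ) := by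
  refine ⟨?_⟩
  rw [singleLaw, withDensity_apply _ MeasurableSet.univ, Measure.restrict_univ,
    ← ofReal_integral_eq_lintegral_ofReal hρ.integrable (Eventually.of_forall hρ.nonneg),
    hρ.integral_eq_one, ENNReal.ofReal_one]

theorem Admissible.exists_integrable_exp (hρ : Admissible ρ) :
    ∃ τ : ℝ, 0 < τ ∧ Integrable (fun x => Real.exp (τ * |x|)) (singleLaw ρ) := by
  obtain ⟨τ, hτ, h⟩ := exists_integrable_exp_abs_mul hρ.measurable hρ.nonneg hρ.integrable
    hρ.fourier_analytic
  refine ⟨τ, hτ, (integrable_singleLaw_iff hρ.measurable hρ.nonneg).2 ?_⟩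
  simpa [mul_comm] using h

theorem Admissible.integral_comp_neg (hρ : Admissible ρ) {E : Type*} [NormedAddCommGroup E]
    [NormedSpace ℝ E] (f : ℝ → E) :
    ∫ x, f (-x) ∂(singleLaw ρ) = ∫ x, f x ∂(singleLaw ρ) := by
  rw [integral_singleLaw hρ.measurable hρ.nonneg, integral_singleLaw hρ.measurable hρ.nonneg,
    ← integral_neg_eq_self]
  simp [hρ.even]

theorem Admissible.laplace_neg (hρ : Admissible ρ) (z : ℂ) :
    laplace (singleLaw ρ) (-z) = laplace (singleLaw ρ) z := by
  rw [laplace, laplace, ← hρ.integral_comp_neg]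
  simp

theorem integrable_pow_mul_exp {μ : Measure ℝ} {τ : ℝ}
    (h : Integrable (fun x => Real.exp (τ * |x|)) μ) (k : ℕ) {s : ℝ} (hs : s < τ) :
    Integrable (fun x => |x| ^ k * Real.exp (s * |x|)) μ := by
  have hpos : 0 < τ - s := by linarith
  refine (h.const_mul (k.factorial / (τ - s) ^ k)).mono' (by fun_prop) (Eventually.of_forall fun x => ?_)
  rw [Real.norm_of_nonneg (by positivity)]
  have h1 := Real.pow_div_factorial_le_exp ((τ - s) * |x|) (by positivity) k
  have h2 : |x| ^ k ≤ k.factorial / (τ - s) ^ k * Real.exp ((τ - s) * |x|) := by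
    rw [div_le_iff₀ (by positivity), mul_pow] at h1
    rw [div_mul_eq_mul_div, le_div_iff₀ (by positivity)]
    linarith
  calc |x| ^ k * Real.exp (s * |x|)
      ≤ k.factorial / (τ - s) ^ k * Real.exp ((τ - s) * |x|) * Real.exp (s * |x|) := by gcongr
    _ = _ := by rw [mul_assoc, ← Real.exp_add]; ring_nf

theorem integrable_cexp_mul {μ : Measure ℝ} [IsFiniteMeasure μ] {τ : ℝ}
    (h : Integrable (fun x => Real.exp (τ * |x|)) μ) {z : ℂ} (hz : |z.re| ≤ τ) :
    Integrable (fun x : ℝ => Complex.exp (z * x)) μ := by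
  refine h.mono' (by fun_prop) (Eventually.of_forall fun x => ?_)
  rw [Complex.norm_exp]
  refine Real.exp_le_exp.2 ?_
  simp only [Complex.mul_re, Complex.ofReal_re, Complex.ofReal_im, mul_zero, sub_zero]
  calc z.re * x ≤ |z.re * x| := le_abs_self _
    _ = |z.re| * |x| := abs_mul _ _
    _ ≤ τ * |x| := by gcongr

theorem norm_laplace_le_one (μ : Measure ℝ) [IsProbabilityMeasure μ] {z : ℂ} (hz : z.re = 0) :
    ‖laplace μ z‖ ≤ 1 := by
  refine (norm_integral_le_integral_norm _).trans (le_of_eq ?_)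
  simp [Complex.norm_exp, hz]

theorem Admissible.integral_odd_pow (hρ : Admissible ρ) {k : ℕ} (hk : Odd k) :
    ∫ x, (x : ℂ) ^ k ∂(singleLaw ρ) = 0 := by
  have h := hρ.integral_comp_neg (fun x => (x : ℂ) ^ k)
  simp only [Complex.ofReal_neg, hk.neg_pow, integral_neg] at h
  exact self_eq_neg.1 h.symm

/-- Taylor expansion under the integral. Odd moments vanish by evenness, so the error is of fourth
order; summed over `n` columns at scale `α/√n` it becomes `α⁴/n`. -/
theorem Admissible.exists_norm_laplace_sub_le (hρ : Admissible ρ) :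
    ∃ C r : ℝ, 0 < r ∧ 0 < C ∧ ∀ z : ℂ, ‖z‖ ≤ r →
      ‖laplace (singleLaw ρ) z - (1 + z ^ 2 / 2)‖ ≤ C * ‖z‖ ^ 4 := by
  have := hρ.isProbabilityMeasure
  obtain ⟨τ, hτ, h⟩ := hρ.exists_integrable_exp
  have h4 := integrable_pow_mul_exp h 4 (s := τ / 2) (by linarith)
  have hpow : ∀ k : ℕ, Integrable (fun x : ℝ => (x : ℂ) ^ k) (singleLaw ρ) := by
    intro k
    have := integrable_pow_mul_exp h k (s := 0) hτ
    refine this.mono' (by fun_prop) (Eventually.of_forall fun x => ?_)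
    simp
  refine ⟨(∫ x, |x| ^ 4 * Real.exp (τ / 2 * |x|) ∂(singleLaw ρ)) + 1, τ / 2, by positivity,
    by have : 0 ≤ ∫ x, |x| ^ 4 * Real.exp (τ / 2 * |x|) ∂(singleLaw ρ) :=
        integral_nonneg fun x => by positivity
       linarith, fun z hz => ?_⟩
  have hz' : |z.re| ≤ τ := (Complex.abs_re_le_norm z).trans (by linarith)
  have hm0 : ∫ x, (x : ℂ) ^ 0 ∂(singleLaw ρ) = 1 := by simp
  have hm2 : ∫ x, (x : ℂ) ^ 2 ∂(singleLaw ρ) = 1 := by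
    have h1 : ∫ x, (x : ℝ) ^ 2 ∂(singleLaw ρ) = 1 := by
      rw [integral_singleLaw hρ.measurable hρ.nonneg, ← hρ.second_moment]
      simp [mul_comm]
    have := congrArg ((↑) : ℝ → ℂ) h1
    rw [← integral_complex_ofReal] at this
    simpa using this
  have hsum : ∫ x, (∑ k ∈ Finset.range 4, (z * x) ^ k / k.factorial) ∂(singleLaw ρ) =
      1 + z ^ 2 / 2 := by
    have hterm : ∀ k : ℕ, ∀ x : ℝ, (z * x) ^ k / k.factorial =
        z ^ k / k.factorial * (x : ℂ) ^ k := fun k x => by rw [mul_pow]; ring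
    simp_rw [hterm]
    rw [integral_finsetSum _ fun k _ => (hpow k).const_mul _]
    simp_rw [integral_const_mul]
    simp only [Finset.sum_range_succ, Finset.sum_range_zero, hm2, hm0,
      hρ.integral_odd_pow (k := 1) (by decide), hρ.integral_odd_pow (k := 3) (by decide)]
    simp [Nat.factorial]
  have hintg : Integrable (fun x : ℝ => ∑ k ∈ Finset.range 4, (z * x) ^ k / (k.factorial : ℂ))
      (singleLaw ρ) := by
    refine integrable_finsetSum _ fun k _ => ?_
    refine ((hpow k).const_mul (z ^ k / k.factorial)).congr (Eventually.of_forall fun x => ?_)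
    simp only [mul_pow]; ring
  rw [← hsum, laplace, ← integral_sub (integrable_cexp_mul h hz') hintg]
  have hb : ∀ x : ℝ, ‖Complex.exp (z * x) - ∑ k ∈ Finset.range 4, (z * x) ^ k / k.factorial‖ ≤
      ‖z‖ ^ 4 * (|x| ^ 4 * Real.exp (τ / 2 * |x|)) := by
    intro x
    refine (Complex.norm_exp_sub_sum_le_norm_mul_exp (z * x) 4).trans ?_
    rw [norm_mul, Complex.norm_real, Real.norm_eq_abs, mul_pow, mul_assoc]
    gcongr
  refine (norm_integral_le_of_norm_le (h4.const_mul _) (Eventually.of_forall hb)).trans ?_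
  rw [integral_const_mul, mul_comm]
  gcongr
  linarith

/-- The Taylor bound in multiplicative form, suited to products over columns. -/
theorem Admissible.exists_norm_laplace_mul_exp_sub_one_le (hρ : Admissible ρ) :
    ∃ C r : ℝ, 0 < r ∧ 0 < C ∧ ∀ z : ℂ, ‖z‖ ≤ r →
      ‖laplace (singleLaw ρ) z * Complex.exp (-(z ^ 2 / 2)) - 1‖ ≤ C * ‖z‖ ^ 4 := by
  obtain ⟨C, r, hr, hC, h⟩ := hρ.exists_norm_laplace_sub_le
  refine ⟨C * Real.exp 1 + 2, min r 1, by positivity, by positivity, fun z hz => ?_⟩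
  have hz1 : ‖z‖ ≤ 1 := hz.trans (min_le_right _ _)
  set w : ℂ := z ^ 2 / 2 with hw
  have hwn : ‖w‖ = ‖z‖ ^ 2 / 2 := by simp [hw]
  have hw1 : ‖w‖ ≤ 1 := by rw [hwn]; nlinarith [norm_nonneg z]
  have h1 : ‖Complex.exp (-w)‖ ≤ Real.exp 1 := by
    refine (Complex.norm_exp_le_exp_norm _).trans (Real.exp_le_exp.2 (by simpa using hw1))
  have h2 : ‖Complex.exp (-w) - (1 - w)‖ ≤ ‖w‖ ^ 2 := by
    have := Complex.norm_exp_sub_one_sub_id_le (x := -w) (by simpa using hw1)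
    rw [show Complex.exp (-w) - (1 - w) = Complex.exp (-w) - 1 - -w by ring]
    simpa using this
  have hid : laplace (singleLaw ρ) z * Complex.exp (-w) - 1 =
      (laplace (singleLaw ρ) z - (1 + w)) * Complex.exp (-w) +
      ((1 + w) * (Complex.exp (-w) - (1 - w)) - w ^ 2) := by ring
  rw [hid]
  have h3 : ‖(1 + w) * (Complex.exp (-w) - (1 - w))‖ ≤ 2 * ‖w‖ ^ 2 := by
    rw [norm_mul]
    have : ‖1 + w‖ ≤ 2 := (norm_add_le _ _).trans (by simp; linarith)
    gcongr
  have h4 : ‖(laplace (singleLaw ρ) z - (1 + w)) * Complex.exp (-w)‖ ≤ C * ‖z‖ ^ 4 * Real.exp 1 := by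
    rw [norm_mul]
    gcongr
    exact h z (hz.trans (min_le_left _ _))
  calc _ ≤ C * ‖z‖ ^ 4 * Real.exp 1 + (2 * ‖w‖ ^ 2 + ‖w‖ ^ 2) := by
        refine (norm_add_le _ _).trans (add_le_add h4 ((norm_sub_le _ _).trans (add_le_add h3 ?_)))
        rw [norm_pow]
    _ ≤ (C * Real.exp 1 + 2) * ‖z‖ ^ 4 := by
        rw [hwn]; nlinarith [pow_nonneg (norm_nonneg z) 4]

/-- The density is split at height `T = l^{-1/(1+ε)}`, which balances `T l` against `T^{-ε}` and
gives `β = ε/(1+ε)`. The bound later provides the small extra factor for arrays whose frequent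
columns are degenerate. -/
theorem Admissible.exists_measureReal_Icc_le (hρ : Admissible ρ) :
    ∃ C β : ℝ, 0 < β ∧ 0 < C ∧ ∀ a l : ℝ, 0 < l →
      (singleLaw ρ).real (Icc a (a + l)) ≤ C * l ^ β := by
  obtain ⟨ε, hε, hintg⟩ := hρ.integrable_rpow
  have := hρ.isProbabilityMeasure
  have hB : 0 ≤ ∫ x, |ρ x| ^ (1 + ε) := integral_nonneg fun x => by positivity
  refine ⟨1 + ∫ x, |ρ x| ^ (1 + ε), ε / (1 + ε), by positivity, by positivity, fun a l hl => ?_⟩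
  set T : ℝ := l ^ (-(1 / (1 + ε))) with hT
  have hT0 : 0 < T := by positivity
  have hpt : ∀ x, ρ x ≤ T + T ^ (-ε) * |ρ x| ^ (1 + ε) := by
    intro x
    rw [abs_of_nonneg (hρ.nonneg x)]
    rcases le_or_gt (ρ x) T with hx | hx
    · have : 0 ≤ T ^ (-ε) * ρ x ^ (1 + ε) := by have := hρ.nonneg x; positivity
      linarith
    · have hx0 : 0 < ρ x := hT0.trans hx
      have h1 : ρ x ≤ T ^ (-ε) * ρ x ^ (1 + ε) := by
        rw [Real.rpow_add hx0, Real.rpow_one, Real.rpow_neg hT0.le, ← div_eq_inv_mul,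
          le_div_iff₀ (by positivity)]
        have := Real.rpow_le_rpow hT0.le hx.le hε.le
        gcongr
      linarith
  have hTl : T * l = l ^ (ε / (1 + ε)) := by
    rw [hT]
    nth_rewrite 2 [← Real.rpow_one l]
    rw [← Real.rpow_add hl]
    congr 1; field_simp; ring
  have hTe : T ^ (-ε) = l ^ (ε / (1 + ε)) := by
    rw [hT, ← Real.rpow_mul hl.le]; congr 1; field_simp
  have h1 : (singleLaw ρ).real (Icc a (a + l)) = ∫ x in Icc a (a + l), ρ x := by
    rw [measureReal_def, singleLaw, withDensity_apply _ measurableSet_Icc,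
      ← ofReal_integral_eq_lintegral_ofReal hρ.integrable.integrableOn
        (Eventually.of_forall hρ.nonneg), ENNReal.toReal_ofReal]
    exact integral_nonneg hρ.nonneg
  rw [h1]
  have hi2 : Integrable (fun x => T ^ (-ε) * |ρ x| ^ (1 + ε)) := hintg.const_mul _
  have hi1 : IntegrableOn (fun _ : ℝ => T) (Icc a (a + l)) := by simp
  calc ∫ x in Icc a (a + l), ρ x
      ≤ ∫ x in Icc a (a + l), (T + T ^ (-ε) * |ρ x| ^ (1 + ε)) :=
        setIntegral_mono hρ.integrable.integrableOn (hi1.add hi2.integrableOn) hpt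
    _ = T * l + ∫ x in Icc a (a + l), T ^ (-ε) * |ρ x| ^ (1 + ε) := by
        rw [integral_add hi1 hi2.integrableOn]
        simp [hl.le, mul_comm]
    _ ≤ T * l + T ^ (-ε) * ∫ x, |ρ x| ^ (1 + ε) := by
        rw [← integral_const_mul]
        exact add_le_add le_rfl
          (setIntegral_le_integral hi2 (Eventually.of_forall fun x => by positivity))
    _ = _ := by rw [hTl, hTe]; ring

theorem Admissible.laplace_eq_fourier (hρ : Admissible ρ) (t u : ℝ) :
    laplace (singleLaw ρ) (t + 2 * Real.pi * u * Complex.I) =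
      𝓕 (fun x => ((Real.exp (t * x) * ρ x : ℝ) : ℂ)) (-u) := by
  rw [laplace, integral_singleLaw hρ.measurable hρ.nonneg, Real.fourier_real_eq_integral_exp_smul]
  congr 1; ext x
  simp only [Complex.real_smul, smul_eq_mul]
  push_cast
  rw [add_mul, Complex.exp_add]
  ring_nf

theorem Admissible.exists_lintegral_norm_laplace_pow_le (hρ : Admissible ρ) :
    ∃ (M : ℕ) (C t₀ : ℝ), 0 < M ∧ 0 < t₀ ∧ 0 < C ∧ ∀ t : ℝ, |t| ≤ t₀ →
      ∫⁻ u : ℝ, ENNReal.ofReal (‖laplace (singleLaw ρ) (t + 2 * Real.pi * u * Complex.I)‖ ^ M) ≤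
        ENNReal.ofReal C := by
  obtain ⟨ε, hε, hintg⟩ := hρ.integrable_rpow
  have := hρ.isProbabilityMeasure
  obtain ⟨τ, hτ, hexp⟩ := hρ.exists_integrable_exp
  have hexp' := (integrable_singleLaw_iff hρ.measurable hρ.nonneg).1 hexp
  simp only [smul_eq_mul] at hexp'
  -- The exponent is halved to pay for the tilt: with `t₀ (1 + δ) = τ/2`, the power `(e^{tx}
  -- ρ)^{1+δ}` is at most `ρ * (ρ^δ * e^{τ|x|/2})`, and the inequality between a product and the sum
  -- of squares bounds this by `ρ^{1+ε} + ρ e^{τ|x|}`.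
  set δ := ε / 2 with hδ
  have hδ0 : 0 < δ := by positivity
  set t₀ := τ / (2 * (1 + δ)) with ht₀
  have ht₀0 : 0 < t₀ := by positivity
  have ht₀τ : t₀ ≤ τ := by
    rw [ht₀, div_le_iff₀ (by positivity)]; nlinarith
  set A := ∫ x, ρ x * Real.exp (τ * |x|) with hA
  set B := (∫ x, |ρ x| ^ (1 + ε)) + A + 1 with hB
  have hA0 : 0 ≤ A := integral_nonneg fun x => mul_nonneg (hρ.nonneg x) (Real.exp_pos _).le
  have hB0 : 0 < B := by
    have : 0 ≤ ∫ x, |ρ x| ^ (1 + ε) := integral_nonneg fun x => by positivity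
    positivity
  obtain ⟨M, hM⟩ := exists_nat_gt (2 + 1 / δ)
  have hM0 : 0 < M := by
    have : (0 : ℝ) < M := lt_trans (by positivity) hM
    exact_mod_cast this
  obtain ⟨C, hC, hbound⟩ := exists_lintegral_norm_fourier_pow_le (A := A) hδ0 hB0 hM
  refine ⟨M, C.toReal + 1, t₀, hM0, ht₀0, by positivity, fun t ht => ?_⟩
  have hm := hρ.measurable
  have hle : ∀ x, Real.exp (t * x) ≤ Real.exp (t₀ * |x|) := fun x => by
    refine Real.exp_le_exp.2 ((le_abs_self _).trans ?_)
    rw [abs_mul]; gcongr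
  have h1 : ∀ x, Real.exp (t * x) * ρ x ≤ ρ x * Real.exp (τ * |x|) := fun x => by
    rw [mul_comm]
    refine mul_le_mul_of_nonneg_left ((hle x).trans ?_) (hρ.nonneg x)
    gcongr
  have hnn : ∀ x, 0 ≤ Real.exp (t * x) * ρ x := fun x => mul_nonneg (Real.exp_pos _).le (hρ.nonneg x)
  have hi1 : Integrable fun x => Real.exp (t * x) * ρ x :=
    hexp'.mono' (by fun_prop) (Eventually.of_forall fun x => by
      rw [Real.norm_of_nonneg (hnn x)]; exact h1 x)
  have h2 : ∀ x, (Real.exp (t * x) * ρ x) ^ (1 + δ) ≤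
      |ρ x| ^ (1 + ε) + ρ x * Real.exp (τ * |x|) := by
    intro x
    have hr := hρ.nonneg x
    rw [abs_of_nonneg hr]
    have e1 : (Real.exp (t * x)) ^ (1 + δ) ≤ Real.exp (τ / 2 * |x|) := by
      rw [← Real.exp_mul]
      refine Real.exp_le_exp.2 ?_
      have : t * x ≤ t₀ * |x| := Real.exp_le_exp.1 (hle x)
      calc t * x * (1 + δ) ≤ t₀ * |x| * (1 + δ) := by gcongr
        _ = τ / 2 * |x| := by rw [ht₀]; field_simp
    rcases hr.eq_or_lt with h0 | h0
    · rw [← h0]; simp [Real.zero_rpow (by positivity : (1 + δ) ≠ 0), Real.zero_rpow (by positivity : (1 + ε) ≠ 0)]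
    rw [Real.mul_rpow (Real.exp_pos _).le hr]
    have e2 : ρ x ^ (1 + δ) = ρ x * ρ x ^ δ := by rw [Real.rpow_add h0, Real.rpow_one]
    have e3 : ρ x ^ (1 + ε) = ρ x * (ρ x ^ δ) ^ 2 := by
      rw [Real.rpow_add h0, Real.rpow_one, ← Real.rpow_natCast, ← Real.rpow_mul hr, hδ]
      norm_num
    have e4 : Real.exp (τ * |x|) = Real.exp (τ / 2 * |x|) ^ 2 := by
      rw [← Real.exp_nat_mul]; congr 1; push_cast; ring
    rw [e2, e3, e4, ← mul_add]
    calc Real.exp (t * x) ^ (1 + δ) * (ρ x * ρ x ^ δ)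
        ≤ Real.exp (τ / 2 * |x|) * (ρ x * ρ x ^ δ) := by gcongr
      _ = ρ x * (Real.exp (τ / 2 * |x|) * ρ x ^ δ) := by ring
      _ ≤ _ := by
        gcongr
        nlinarith [sq_nonneg (ρ x ^ δ - Real.exp (τ / 2 * |x|)), Real.exp_pos (τ / 2 * |x|),
          Real.rpow_nonneg hr δ]
  have hi2 : Integrable fun x => (Real.exp (t * x) * ρ x) ^ (1 + δ) :=
    (hintg.add hexp').mono' (Measurable.pow_const (by fun_prop) _).aestronglyMeasurable (Eventually.of_forall fun x => by
      rw [Real.norm_of_nonneg (Real.rpow_nonneg (hnn x) _)]; exact h2 x)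
  have hfin := hbound (fun x => Real.exp (t * x) * ρ x) (by fun_prop) hnn hi1
    (integral_mono hi1 hexp' h1) hi2 (by
      refine (integral_mono hi2 (hintg.add hexp') h2).trans ?_
      simp only [Pi.add_apply]
      rw [integral_add hintg hexp', hB]; linarith)
  simp_rw [hρ.laplace_eq_fourier]
  rw [(Measure.measurePreserving_neg (volume : Measure ℝ)).lintegral_comp_emb
    (MeasurableEquiv.neg ℝ).measurableEmbedding (fun u => ENNReal.ofReal
      (‖𝓕 (fun x => ((Real.exp (t * x) * ρ x : ℝ) : ℂ)) u‖ ^ M))]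
  refine hfin.trans ?_
  rw [← ENNReal.ofReal_toReal hC]
  refine ENNReal.ofReal_le_ofReal ?_
  simp

/-- Modulus one would force `cos(2πux - θ) = 1` almost surely, so the law would live on a countable
set, which is impossible for a law with a density. -/
theorem Admissible.norm_laplace_lt_one (hρ : Admissible ρ) {u : ℝ} (hu : u ≠ 0) :
    ‖laplace (singleLaw ρ) (2 * Real.pi * u * Complex.I)‖ < 1 := by
  have := hρ.isProbabilityMeasure
  by_contra hcon
  push Not at hcon
  set c := laplace (singleLaw ρ) (2 * Real.pi * u * Complex.I) with hc
  set θ := Complex.arg c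
  have hintg : Integrable (fun x : ℝ => Complex.exp ((2 * Real.pi * u * x - θ : ℝ) * Complex.I))
      (singleLaw ρ) := by
    refine (integrable_const (1 : ℝ)).mono' (by fun_prop) (Eventually.of_forall fun x => ?_)
    rw [Complex.norm_exp_ofReal_mul_I]
  have h1 : ∫ x : ℝ, Complex.exp ((2 * Real.pi * u * x - θ : ℝ) * Complex.I) ∂(singleLaw ρ) =
      (‖c‖ : ℂ) := by
    have h2 : ∀ x : ℝ, Complex.exp ((2 * Real.pi * u * x - θ : ℝ) * Complex.I) =
        Complex.exp (-(θ * Complex.I)) * Complex.exp (2 * Real.pi * u * Complex.I * x) := by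
      intro x; rw [← Complex.exp_add]; push_cast; ring_nf
    simp_rw [h2]
    rw [integral_const_mul]
    change _ * c = _
    nth_rewrite 1 [← Complex.norm_mul_exp_arg_mul_I c]
    rw [mul_left_comm, ← Complex.exp_add]; simp [θ]
  have h3 : ∫ x : ℝ, Real.cos (2 * Real.pi * u * x - θ) ∂(singleLaw ρ) = ‖c‖ := by
    have h4 := congrArg Complex.re h1
    rw [← RCLike.re_eq_complex_re, ← integral_re hintg] at h4
    simpa only [RCLike.re_eq_complex_re, Complex.exp_ofReal_mul_I_re, Complex.ofReal_re] using h4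
  have hcos : Integrable (fun x : ℝ => Real.cos (2 * Real.pi * u * x - θ)) (singleLaw ρ) := by
    refine (integrable_const (1 : ℝ)).mono' (by fun_prop) (Eventually.of_forall fun x => ?_)
    simpa using Real.abs_cos_le_one _
  have h5 : ∫ x : ℝ, (1 - Real.cos (2 * Real.pi * u * x - θ)) ∂(singleLaw ρ) = 0 := by
    refine le_antisymm ?_ (integral_nonneg fun x => by simp [Real.cos_le_one])
    rw [integral_sub (integrable_const _) hcos, h3]
    simpa using hcon
  rw [integral_eq_zero_iff_of_nonneg (fun x => by simp [Real.cos_le_one])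
    (by exact (integrable_const _).sub hcos)] at h5
  have h6 : singleLaw ρ {x | ¬ (1 - Real.cos (2 * Real.pi * u * x - θ) = 0)} = 0 := h5
  have h7 : singleLaw ρ {x | 1 - Real.cos (2 * Real.pi * u * x - θ) = 0} = 0 := by
    refine withDensity_absolutelyContinuous _ _ (Countable.measure_zero ?_ _)
    refine (countable_range fun k : ℤ => (k * (2 * Real.pi) + θ) / (2 * Real.pi * u)).mono ?_
    intro x hx
    have hx' : Real.cos (2 * Real.pi * u * x - θ) = 1 := by
      have : 1 - Real.cos (2 * Real.pi * u * x - θ) = 0 := hx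
      linarith
    obtain ⟨k, hk⟩ := (Real.cos_eq_one_iff _).1 hx'
    refine ⟨k, ?_⟩
    simp only
    rw [hk]
    have := Real.pi_ne_zero
    field_simp; ring
  have h8 : singleLaw ρ univ = 0 := by
    refine measure_mono_null ?_ (measure_union_null h6 h7)
    intro x _
    by_cases hx : 1 - Real.cos (2 * Real.pi * u * x - θ) = 0
    · exact Or.inr hx
    · exact Or.inl hx
  simp at h8

/-- On the imaginary axis, Riemann-Lebesgue handles large frequencies and compactness the rest. A
real shift `t` moves the transform by at most `|t| D`, with `D` an exponentially weighted first
moment, uniformly in the frequency. -/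
theorem Admissible.exists_norm_laplace_le_of_le_abs (hρ : Admissible ρ) {η : ℝ} (hη : 0 < η) :
    ∃ κ t₀ : ℝ, 0 < κ ∧ κ < 1 ∧ 0 < t₀ ∧ ∀ t u : ℝ, |t| ≤ t₀ → η ≤ |u| →
      ‖laplace (singleLaw ρ) (t + 2 * Real.pi * u * Complex.I)‖ ≤ κ := by
  have := hρ.isProbabilityMeasure
  obtain ⟨τ, hτ, hexp⟩ := hρ.exists_integrable_exp
  set φ : ℝ → ℝ := fun u => ‖laplace (singleLaw ρ) (2 * Real.pi * u * Complex.I)‖ with hφ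
  have hφf : ∀ u, φ u = ‖𝓕 (fun x => (ρ x : ℂ)) (-u)‖ := by
    intro u
    have := hρ.laplace_eq_fourier 0 u
    simp only [Complex.ofReal_zero, zero_add, zero_mul, Real.exp_zero, one_mul] at this
    rw [hφ, ← this]
  have hcont : Continuous φ := by
    have h1 : φ = fun u => ‖𝓕 (fun x => (ρ x : ℂ)) (-u)‖ := funext hφf
    rw [h1]
    exact ((continuous_fourier_of_integrable (hρ.integrable.ofReal (𝕜 := ℂ))).comp continuous_neg).norm
  have hlim : Tendsto φ (cocompact ℝ) (𝓝 0) := by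
    have h1 : φ = fun u => ‖𝓕 (fun x => (ρ x : ℂ)) (-u)‖ := funext hφf
    rw [h1]
    have h2 := (Real.zero_at_infty_fourier (fun x => (ρ x : ℂ))).norm
    rw [norm_zero] at h2
    exact h2.comp (Homeomorph.neg ℝ).isClosedEmbedding.tendsto_cocompact
  obtain ⟨K, hK, hKsub⟩ := mem_cocompact.1 (hlim.eventually (gt_mem_nhds (by norm_num : (0 : ℝ) < 1 / 2)))
  have hκ : ∃ κ : ℝ, 1 / 2 ≤ κ ∧ κ < 1 ∧ ∀ u, η ≤ |u| → φ u ≤ κ := by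
    have hc : IsCompact (K ∩ {u | η ≤ |u|}) :=
      hK.inter_right (isClosed_le continuous_const continuous_abs)
    rcases (K ∩ {u | η ≤ |u|}).eq_empty_or_nonempty with he | hne
    · refine ⟨1 / 2, le_rfl, by norm_num, fun u hu => ?_⟩
      have : u ∉ K := fun h => by
        have : u ∈ K ∩ {u | η ≤ |u|} := ⟨h, hu⟩
        rw [he] at this; exact this
      exact le_of_lt (hKsub this)
    · obtain ⟨u₀, hu₀, hmax⟩ := hc.exists_isMaxOn hne hcont.continuousOn
      have hu₀' : u₀ ≠ 0 := by
        rintro rfl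
        have : η ≤ |(0 : ℝ)| := hu₀.2
        simp at this; linarith
      refine ⟨max (1 / 2) (φ u₀), le_max_left _ _,
        max_lt (by norm_num) (hρ.norm_laplace_lt_one hu₀'), fun u hu => ?_⟩
      by_cases h : u ∈ K
      · exact (hmax ⟨h, hu⟩).trans (le_max_right _ _)
      · exact (le_of_lt (hKsub h)).trans (le_max_left _ _)
  obtain ⟨κ, hκ2, hκ1, hκu⟩ := hκ
  have h1int := integrable_pow_mul_exp hexp 1 (s := τ / 2) (by linarith)
  set D := ∫ x, |x| ^ 1 * Real.exp (τ / 2 * |x|) ∂(singleLaw ρ) with hD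
  have hD0 : 0 ≤ D := integral_nonneg fun x => by positivity
  refine ⟨(1 + κ) / 2, min (τ / 2) ((1 - κ) / (2 * (D + 1))), by linarith, by linarith,
    lt_min (by positivity) (div_pos (by linarith) (by positivity)), fun t u ht hu => ?_⟩
  have ht1 : |t| ≤ τ / 2 := ht.trans (min_le_left _ _)
  have ht2 : |t| * (D + 1) ≤ (1 - κ) / 2 := by
    have := ht.trans (min_le_right _ _)
    rw [le_div_iff₀ (by positivity)] at this
    linarith
  have hi1 : Integrable (fun x : ℝ => Complex.exp ((t + 2 * Real.pi * u * Complex.I) * x))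
      (singleLaw ρ) := integrable_cexp_mul hexp (by simp; linarith)
  have hi2 : Integrable (fun x : ℝ => Complex.exp ((2 * Real.pi * u * Complex.I) * x))
      (singleLaw ρ) := integrable_cexp_mul hexp (by simp; linarith)
  have hdiff : ‖laplace (singleLaw ρ) (t + 2 * Real.pi * u * Complex.I) -
      laplace (singleLaw ρ) (2 * Real.pi * u * Complex.I)‖ ≤ |t| * D := by
    rw [laplace, laplace, ← integral_sub hi1 hi2, hD, ← integral_const_mul]
    refine norm_integral_le_of_norm_le (h1int.const_mul _) (Eventually.of_forall fun x => ?_)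
    rw [show Complex.exp ((t + 2 * Real.pi * u * Complex.I) * x) -
      Complex.exp ((2 * Real.pi * u * Complex.I) * x) =
      (Complex.exp ((t * x : ℝ) : ℂ) - 1) * Complex.exp ((2 * Real.pi * u * x : ℝ) * Complex.I) by
        rw [sub_mul, ← Complex.exp_add]; push_cast; ring_nf]
    rw [norm_mul, Complex.norm_exp_ofReal_mul_I, mul_one]
    have h2 := Complex.norm_exp_sub_sum_le_norm_mul_exp ((t * x : ℝ) : ℂ) 1
    simp only [Finset.range_one, Finset.sum_singleton, pow_zero, Nat.factorial_zero, Nat.cast_one,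
      div_one, pow_one, Complex.norm_real, Real.norm_eq_abs, abs_mul] at h2
    refine h2.trans ?_
    rw [pow_one, mul_assoc]
    gcongr
  have h3 := norm_add_le (laplace (singleLaw ρ) (t + 2 * Real.pi * u * Complex.I) -
      laplace (singleLaw ρ) (2 * Real.pi * u * Complex.I)) (laplace (singleLaw ρ) (2 * Real.pi * u * Complex.I))
  rw [sub_add_cancel] at h3
  have h4 := hκu u hu
  nlinarith [abs_nonneg t]

/-! ### Smooth cutoffs and Fourier inversion for box probabilities -/

/-- `h` is a smooth cutoff function: it takes values in `[0, 1]`, equals `1` on `[c, d]` and vanishes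
outside `[c - ε, d + ε]`. -/
structure IsCutoff (h : 𝓢(ℝ, ℂ)) (c d ε : ℝ) : Prop where
  ofReal_re : ∀ x, ((h x).re : ℂ) = h x
  nonneg : ∀ x, 0 ≤ (h x).re
  le_one : ∀ x, (h x).re ≤ 1
  eq_one : ∀ x ∈ Icc c d, (h x).re = 1
  eq_zero : ∀ x, x ∉ Icc (c - ε) (d + ε) → (h x).re = 0

theorem exists_isCutoff {c d ε : ℝ} (hcd : c < d) (hε : 0 < ε) : ∃ h, IsCutoff h c d ε := by
  let B : ContDiffBump ((c + d) / 2 : ℝ) := ⟨(d - c) / 2, (d - c) / 2 + ε, by linarith, by linarith⟩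
  have hc : HasCompactSupport fun x => (B x : ℂ) :=
    B.hasCompactSupport.comp_left (g := ((↑) : ℝ → ℂ)) (by simp)
  have hs : ContDiff ℝ ((⊤ : ℕ∞) : WithTop ℕ∞) fun x => (B x : ℂ) :=
    Complex.ofRealCLM.contDiff.comp B.contDiff
  have hre : ∀ x, ((hc.toSchwartzMap hs) x).re = B x := fun x => by simp
  refine ⟨hc.toSchwartzMap hs, ⟨fun x => by simp, fun x => ?_, fun x => ?_, fun x hx => ?_,
    fun x hx => ?_⟩⟩
  · rw [hre]; exact B.nonneg
  · rw [hre]; exact B.le_one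
  · rw [hre]
    refine B.one_of_mem_closedBall ?_
    rw [Metric.mem_closedBall, Real.dist_eq, abs_le]
    obtain ⟨h1, h2⟩ := hx
    constructor <;> simp only [B] <;> linarith
  · rw [hre]
    refine B.zero_of_le_dist ?_
    by_contra hcon
    push Not at hcon
    refine hx ?_
    rw [Real.dist_eq, abs_lt] at hcon
    simp only [B] at hcon
    constructor <;> linarith [hcon.1, hcon.2]

theorem integrable_re_schwartz (h : 𝓢(ℝ, ℂ)) : Integrable fun x => (h x).re := h.integrable.re

theorem IsCutoff.norm_eq {h : 𝓢(ℝ, ℂ)} {c d ε : ℝ} (H : IsCutoff h c d ε) (x : ℝ) :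
    ‖h x‖ = (h x).re := by
  rw [← H.ofReal_re x, Complex.norm_real, Complex.ofReal_re, Real.norm_of_nonneg (H.nonneg x)]

theorem IsCutoff.integral_le {h : 𝓢(ℝ, ℂ)} {c d ε : ℝ} (H : IsCutoff h c d ε) (hcd : c < d)
    (hε : 0 < ε) : ∫ x, (h x).re ≤ d - c + 2 * ε := by
  have h1 : ∫ x, (h x).re ≤ ∫ x, (Icc (c - ε) (d + ε)).indicator (fun _ => (1 : ℝ)) x := by
    refine integral_mono (integrable_re_schwartz h)
      ((integrable_indicator_iff measurableSet_Icc).2 (by simp)) fun x => ?_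
    by_cases hx : x ∈ Icc (c - ε) (d + ε)
    · rw [indicator_of_mem hx]; exact H.le_one x
    · rw [indicator_of_notMem hx]; exact (H.eq_zero x hx).le
  rw [integral_indicator measurableSet_Icc] at h1
  simp only [integral_const, MeasurableSet.univ, measureReal_restrict_apply, univ_inter,
    Real.volume_real_Icc, smul_eq_mul, mul_one] at h1
  rw [max_eq_left (by linarith)] at h1
  linarith

theorem IsCutoff.le_integral {h : 𝓢(ℝ, ℂ)} {c d ε : ℝ} (H : IsCutoff h c d ε) (hcd : c < d) :
    d - c ≤ ∫ x, (h x).re := by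
  have h1 : ∫ x, (Icc c d).indicator (fun _ => (1 : ℝ)) x ≤ ∫ x, (h x).re := by
    refine integral_mono ((integrable_indicator_iff measurableSet_Icc).2 (by simp))
      (integrable_re_schwartz h) fun x => ?_
    by_cases hx : x ∈ Icc c d
    · rw [indicator_of_mem hx]; exact (H.eq_one x hx).ge
    · rw [indicator_of_notMem hx]; exact H.nonneg x
  rw [integral_indicator measurableSet_Icc] at h1
  simpa [hcd.le] using h1

theorem IsCutoff.fourier_zero {h : 𝓢(ℝ, ℂ)} {c d ε : ℝ} (H : IsCutoff h c d ε) :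
    𝓕 h 0 = ((∫ x, (h x).re : ℝ) : ℂ) := by
  rw [SchwartzMap.fourier_coe, Real.fourier_eq, ← integral_complex_ofReal]
  simp [H.ofReal_re]

theorem IsCutoff.norm_fourier_le {h : 𝓢(ℝ, ℂ)} {c d ε : ℝ} (H : IsCutoff h c d ε) (u : ℝ) :
    ‖𝓕 h u‖ ≤ ∫ x, (h x).re := by
  rw [SchwartzMap.fourier_coe]
  refine (VectorFourier.norm_fourierIntegral_le_integral_norm _ _ _ _ _).trans (le_of_eq ?_)
  exact integral_congr_ae (Eventually.of_forall fun x => H.norm_eq x)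

theorem schwartz_eq_integral_fourier (h : 𝓢(ℝ, ℂ)) {w : ℝ} (hw : 0 < w) (y : ℝ) :
    h (y / w) = ∫ f : ℝ, w * 𝓕 h (w * f) * Complex.exp (2 * Real.pi * (f * y) * Complex.I) := by
  have h1 : h (y / w) = 𝓕⁻ (𝓕 h) (y / w) := by rw [FourierTransform.fourierInv_fourier_eq]
  rw [h1, SchwartzMap.fourierInv_coe, Real.fourierInv_eq']
  have h2 := Measure.integral_comp_mul_left (fun v : ℝ =>
    Complex.exp (((2 * Real.pi * inner ℝ v (y / w) : ℝ) : ℂ) * Complex.I) • 𝓕 h v) w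
  rw [abs_of_pos (by positivity), eq_comm, inv_smul_eq_iff₀ hw.ne'] at h2
  rw [h2, ← integral_smul]
  congr 1; ext f
  simp only [smul_eq_mul, RCLike.inner_apply, conj_trivial, Complex.real_smul]
  have : ((2 * Real.pi * (y / w * (w * f)) : ℝ) : ℂ) = 2 * Real.pi * (f * y) := by
    rw [show y / w * (w * f) = f * y by field_simp]; push_cast; ring
  rw [this]; ring

section Identity

variable {ι : Type*} [Fintype ι] {Ω : Type*} [MeasurableSpace Ω] {μ : Measure Ω}

/-- Fourier inversion of each test function, followed by Fubini. The weight `Y` will be the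
indicator of an event or an exponential tilt. -/
theorem integral_mul_prod_schwartz [SFinite μ] {Y : Ω → ℂ} (hY : Integrable Y μ)
    {S : ι → Ω → ℝ} (hS : ∀ j, Measurable (S j)) (h : ι → 𝓢(ℝ, ℂ)) {w : ℝ} (hw : 0 < w) (a : ℝ) :
    ∫ ω, Y ω * ∏ j, h j ((S j ω - a) / w) ∂μ =
      w ^ Fintype.card ι * ∫ f : ι → ℝ, (∏ j, 𝓕 (h j) (w * f j)) *
        Complex.exp (-(2 * Real.pi * (a * ∑ j, f j) * Complex.I)) *
        ∫ ω, Y ω * Complex.exp (2 * Real.pi * (∑ j, f j * S j ω : ℝ) * Complex.I) ∂μ := by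
  have hk : ∀ j, Integrable fun f : ℝ => (w : ℂ) * 𝓕 (h j) (w * f) := fun j =>
    ((integrable_comp_mul_left_iff _ hw.ne').2 (𝓕 (h j)).integrable).const_mul _
  have hprod : ∀ ω, ∏ j, h j ((S j ω - a) / w) = ∫ f : ι → ℝ, ∏ j,
      ((w : ℂ) * 𝓕 (h j) (w * f j) * Complex.exp (2 * Real.pi * (f j * (S j ω - a)) * Complex.I)) := by
    intro ω
    rw [integral_fintype_prod_volume_eq_prod (fun j (x : ℝ) =>
      (w : ℂ) * 𝓕 (h j) (w * x) * Complex.exp (2 * Real.pi * (x * (S j ω - a)) * Complex.I))]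
    refine Finset.prod_congr rfl fun j _ => ?_
    rw [schwartz_eq_integral_fourier (h j) hw]
    push_cast
    rfl
  have hsimp : ∀ (ω : Ω) (f : ι → ℝ), ∏ j, ((w : ℂ) * 𝓕 (h j) (w * f j) *
      Complex.exp (2 * Real.pi * (f j * (S j ω - a)) * Complex.I)) =
      (∏ j, ((w : ℂ) * 𝓕 (h j) (w * f j))) *
        (Complex.exp (-(2 * Real.pi * (a * ∑ j, f j) * Complex.I)) *
        Complex.exp (2 * Real.pi * (∑ j, f j * S j ω : ℝ) * Complex.I)) := by
    intro ω f
    rw [Finset.prod_mul_distrib, ← Complex.exp_sum, ← Complex.exp_add]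
    congr 2
    push_cast
    simp only [Finset.mul_sum, Finset.sum_mul, ← Finset.sum_neg_distrib, ← Finset.sum_add_distrib]
    refine Finset.sum_congr rfl fun j _ => ?_
    ring
  have hintg : Integrable (Function.uncurry fun (ω : Ω) (f : ι → ℝ) => Y ω *
      ((∏ j, ((w : ℂ) * 𝓕 (h j) (w * f j))) *
        (Complex.exp (-(2 * Real.pi * (a * ∑ j, f j) * Complex.I)) *
        Complex.exp (2 * Real.pi * (∑ j, f j * S j ω : ℝ) * Complex.I)))) (μ.prod volume) := by
    have h1 : Integrable (fun f : ι → ℝ => ∏ j, ((w : ℂ) * 𝓕 (h j) (w * f j))) volume :=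
      Integrable.fintype_prod hk
    have h2 := hY.mul_prod h1
    have h3 : AEStronglyMeasurable (fun p : Ω × (ι → ℝ) =>
        Complex.exp (-(2 * Real.pi * (a * ∑ j, p.2 j) * Complex.I)) *
        Complex.exp (2 * Real.pi * (∑ j, p.2 j * S j p.1 : ℝ) * Complex.I)) (μ.prod volume) := by
      have : Measurable fun p : Ω × (ι → ℝ) => (∑ j, p.2 j * S j p.1 : ℝ) :=
        Finset.measurable_sum _ fun j _ =>
          ((measurable_pi_apply j).comp measurable_snd).mul ((hS j).comp measurable_fst)
      refine Measurable.aestronglyMeasurable ?_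
      fun_prop
    have h4 := h2.mul_bdd (c := 1) h3 (Eventually.of_forall fun p => by
      rw [norm_mul, show (-(2 * Real.pi * (a * (∑ j, p.2 j : ℝ)) * Complex.I)) =
        ((-(2 * Real.pi * (a * ∑ j, p.2 j)) : ℝ) : ℂ) * Complex.I by push_cast; ring,
        show (2 * Real.pi * (∑ j, p.2 j * S j p.1 : ℝ) * Complex.I) =
        ((2 * Real.pi * (∑ j, p.2 j * S j p.1) : ℝ) : ℂ) * Complex.I by push_cast; ring,
        Complex.norm_exp_ofReal_mul_I, Complex.norm_exp_ofReal_mul_I]; norm_num)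
    refine h4.congr (Eventually.of_forall fun p => ?_)
    simp only [Function.uncurry]
    ring
  simp_rw [hprod, hsimp, ← integral_const_mul]
  rw [integral_integral_swap hintg]
  congr 1; ext f
  congr 1; ext ω
  rw [Finset.prod_mul_distrib, Finset.prod_const, Finset.card_univ]
  ring

/-- The box is dominated by cutoffs with collars of width one, whose transforms are bounded by their
integrals, hence by `d j - c j + 2`. What remains is an absolute bound on the transform restricted
to `A`. -/
theorem measureReal_inter_box_le [IsFiniteMeasure μ] {A : Set Ω} (hA : MeasurableSet A)
    {S : ι → Ω → ℝ} (hS : ∀ j, Measurable (S j)) {w : ℝ} (hw : 0 < w) (a : ℝ)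
    {c d : ι → ℝ} (hcd : ∀ j, c j < d j) {b : (ι → ℝ) → ℝ} (hb : Integrable b)
    (hbound : ∀ f : ι → ℝ, ‖∫ ω in A, Complex.exp (2 * Real.pi * (∑ j, f j * S j ω : ℝ) * Complex.I) ∂μ‖
      ≤ b f) :
    μ.real (A ∩ {ω | ∀ j, S j ω ∈ Icc (a + c j * w) (a + d j * w)}) ≤
      w ^ Fintype.card ι * ((∏ j, (d j - c j + 2)) * ∫ f, b f) := by
  choose h hh using fun j => exists_isCutoff (hcd j) one_pos
  have hind : Integrable (A.indicator fun _ => (1 : ℂ)) μ := (integrable_const _).indicator hA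
  have hid := integral_mul_prod_schwartz hind hS h hw a
  have hbox : MeasurableSet {ω | ∀ j, S j ω ∈ Icc (a + c j * w) (a + d j * w)} := by
    rw [ofPred_forall]
    exact MeasurableSet.iInter fun j => hS j measurableSet_Icc
  have hre : ∀ ω, A.indicator (fun _ => (1 : ℂ)) ω * ∏ j, h j ((S j ω - a) / w) =
      ((A.indicator (fun _ => (1 : ℝ)) ω * ∏ j, (h j ((S j ω - a) / w)).re : ℝ) : ℂ) := by
    intro ω
    push_cast
    simp only [(hh _).ofReal_re]
    congr 1
    by_cases hω : ω ∈ A <;> simp [hω]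
  have hpn : ∀ ω, 0 ≤ ∏ j, (h j ((S j ω - a) / w)).re := fun ω =>
    Finset.prod_nonneg fun j _ => (hh j).nonneg _
  have hp1 : ∀ ω, ∏ j, (h j ((S j ω - a) / w)).re ≤ 1 := fun ω =>
    Finset.prod_le_one (fun j _ => (hh j).nonneg _) fun j _ => (hh j).le_one _
  have hpm : Measurable fun ω => ∏ j, (h j ((S j ω - a) / w)).re := by
    refine Finset.measurable_prod _ fun j _ => ?_
    exact Complex.measurable_re.comp ((h j).continuous.measurable.comp
      (((hS j).sub_const a).div_const w))
  have hintg : Integrable (fun ω => A.indicator (fun _ => (1 : ℝ)) ω *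
      ∏ j, (h j ((S j ω - a) / w)).re) μ := by
    refine ((integrable_const (1 : ℝ)).indicator hA).mul_bdd (c := 1) hpm.aestronglyMeasurable
      (Eventually.of_forall fun ω => ?_)
    rw [Real.norm_of_nonneg (hpn ω)]; exact hp1 ω
  have hlow : μ.real (A ∩ {ω | ∀ j, S j ω ∈ Icc (a + c j * w) (a + d j * w)}) ≤
      ∫ ω, A.indicator (fun _ => (1 : ℝ)) ω * ∏ j, (h j ((S j ω - a) / w)).re ∂μ := by
    rw [← integral_indicator_one (hA.inter hbox)]
    refine integral_mono ((integrable_const _).indicator (hA.inter hbox)) hintg fun ω => ?_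
    by_cases hω : ω ∈ A ∩ {ω | ∀ j, S j ω ∈ Icc (a + c j * w) (a + d j * w)}
    · rw [indicator_of_mem hω, indicator_of_mem hω.1, one_mul, Finset.prod_eq_one]
      · rfl
      · intro j _
        refine (hh j).eq_one _ ?_
        have := hω.2 j
        rw [mem_Icc] at this ⊢
        rw [le_div_iff₀ hw, div_le_iff₀ hw]
        constructor <;> linarith [this.1, this.2]
    · rw [indicator_of_notMem hω]
      exact mul_nonneg (indicator_nonneg (fun _ _ => zero_le_one) _) (hpn ω)
  refine hlow.trans ((le_abs_self _).trans ?_)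
  rw [← Real.norm_eq_abs, ← Complex.norm_real, ← integral_complex_ofReal, ← integral_congr_ae
    (Eventually.of_forall hre), hid, norm_mul, norm_pow, Complex.norm_real, Real.norm_of_nonneg hw.le]
  gcongr
  rw [← integral_const_mul]
  refine norm_integral_le_of_norm_le (hb.const_mul _) (Eventually.of_forall fun f => ?_)
  rw [norm_mul, norm_mul, norm_prod, show (-(2 * Real.pi * (a * (∑ j, f j : ℝ)) * Complex.I)) =
        ((-(2 * Real.pi * (a * ∑ j, f j)) : ℝ) : ℂ) * Complex.I by push_cast; ring,
        Complex.norm_exp_ofReal_mul_I, mul_one]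
  have hset : ∫ ω, A.indicator (fun _ => (1 : ℂ)) ω *
      Complex.exp (2 * Real.pi * (∑ j, f j * S j ω : ℝ) * Complex.I) ∂μ =
      ∫ ω in A, Complex.exp (2 * Real.pi * (∑ j, f j * S j ω : ℝ) * Complex.I) ∂μ := by
    rw [← integral_indicator hA]
    congr 1; ext ω
    by_cases hω : ω ∈ A <;> simp [hω]
  rw [hset]
  have hpr : ∏ j, ‖𝓕 (h j) (w * f j)‖ ≤ ∏ j, (d j - c j + 2) :=
    Finset.prod_le_prod (fun j _ => norm_nonneg _) fun j _ =>
      ((hh j).norm_fourier_le _).trans (((hh j).integral_le (hcd j) one_pos).trans (by linarith))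
  exact mul_le_mul hpr (hbound f) (norm_nonneg _)
    (Finset.prod_nonneg fun j _ => by linarith [hcd j])

end Identity

/-- Linear change of variables, with Jacobian factor `1/|det B| ≤ 1`. For sign matrices the
hypothesis is automatic once the determinant is nonzero, since it is an integer. -/
theorem integrable_prod_comp_mulVec {κ : Type*} [Fintype κ] [DecidableEq κ] {B : Matrix κ κ ℝ}
    (hB : 1 ≤ |B.det|) {ψ : κ → ℝ → ℝ} (h0 : ∀ k x, 0 ≤ ψ k x) (hψ : ∀ k, Integrable (ψ k)) :
    Integrable (fun f : κ → ℝ => ∏ k, ψ k (B.mulVec f k)) ∧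
      ∫ f : κ → ℝ, ∏ k, ψ k (B.mulVec f k) ≤ ∏ k, ∫ x, ψ k x := by
  have hdet : B.det ≠ 0 := by
    intro h; rw [h] at hB; norm_num at hB
  have hmap := Real.map_matrix_volume_pi_eq_smul_volume_pi hdet
  have hmeas : Measurable (Matrix.toLin' B) :=
    (LinearMap.continuous_of_finiteDimensional _).measurable
  have hF : Integrable (fun g : κ → ℝ => ∏ k, ψ k (g k)) volume := Integrable.fintype_prod hψ
  have hF' : Integrable (fun g : κ → ℝ => ∏ k, ψ k (g k))
      (Measure.map (Matrix.toLin' B) volume) := by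
    rw [hmap]; exact hF.smul_measure (by simp)
  refine ⟨hF'.comp_measurable hmeas, ?_⟩
  have h1 := integral_map hmeas.aemeasurable hF'.aestronglyMeasurable
  change ∫ f : κ → ℝ, (fun g : κ → ℝ => ∏ k, ψ k (g k)) (Matrix.toLin' B f) ≤ _
  rw [← h1, hmap, integral_smul_measure, integral_fintype_prod_volume_eq_prod]
  rw [ENNReal.toReal_ofReal (abs_nonneg _), smul_eq_mul]
  refine mul_le_of_le_one_left (Finset.prod_nonneg fun k _ => integral_nonneg (h0 k)) ?_
  rw [abs_inv]
  exact inv_le_one_of_one_le₀ hB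

theorem Admissible.exists_continuous_laplace {ρ : ℝ → ℝ} (hρ : Admissible ρ) :
    ∃ t₀ : ℝ, 0 < t₀ ∧ ∀ t : ℝ, |t| ≤ t₀ →
      Continuous fun u : ℝ => laplace (singleLaw ρ) (t + 2 * Real.pi * u * Complex.I) := by
  have := hρ.isProbabilityMeasure
  obtain ⟨τ, hτ, hexp⟩ := hρ.exists_integrable_exp
  refine ⟨τ, hτ, fun t ht => ?_⟩
  have hi := (integrable_singleLaw_iff hρ.measurable hρ.nonneg).1
    (integrable_cexp_mul hexp (z := t) (by simpa using ht))
  have hi' : Integrable fun x => ((Real.exp (t * x) * ρ x : ℝ) : ℂ) := by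
    refine hi.congr (Eventually.of_forall fun x => ?_)
    simp [mul_comm]
  simp_rw [hρ.laplace_eq_fourier]
  exact (continuous_fourier_of_integrable hi').comp continuous_neg

theorem Admissible.exists_integrable_norm_laplace_pow {ρ : ℝ → ℝ} (hρ : Admissible ρ) :
    ∃ (M : ℕ) (C t₀ : ℝ), 0 < M ∧ 0 < t₀ ∧ 0 < C ∧ ∀ t : ℝ, |t| ≤ t₀ →
      Integrable (fun u : ℝ => ‖laplace (singleLaw ρ) (t + 2 * Real.pi * u * Complex.I)‖ ^ M) ∧
      ∫ u : ℝ, ‖laplace (singleLaw ρ) (t + 2 * Real.pi * u * Complex.I)‖ ^ M ≤ C := by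
  obtain ⟨M, C, t₀, hM, ht₀, hC, h⟩ := hρ.exists_lintegral_norm_laplace_pow_le
  obtain ⟨τ, hτ, hcont⟩ := hρ.exists_continuous_laplace
  refine ⟨M, C, min t₀ τ, hM, lt_min ht₀ hτ, hC, fun t ht => ?_⟩
  have h1 := h t (ht.trans (min_le_left _ _))
  have hintg : Integrable fun u : ℝ => ‖laplace (singleLaw ρ) (t + 2 * Real.pi * u * Complex.I)‖ ^ M := by
    refine ⟨((hcont t (ht.trans (min_le_right _ _))).norm.pow M).aestronglyMeasurable, ?_⟩
    rw [hasFiniteIntegral_iff_ofReal (Eventually.of_forall fun u => by positivity)]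
    exact h1.trans_lt ENNReal.ofReal_lt_top
  refine ⟨hintg, ?_⟩
  rw [← ofReal_integral_eq_lintegral_ofReal hintg (Eventually.of_forall fun u => by positivity)] at h1
  exact (ENNReal.ofReal_le_ofReal_iff hC.le).1 h1

/-! ### Row sums of sign arrays and box bounds from repeated columns -/

variable {n : ℕ} {ι : Type*}

/-- The signed sum of the weights along the row `j` of the array of signs `s`. -/
def rowSum (s : Fin n → ι → ℤˣ) (j : ι) (X : Fin n → ℝ) : ℝ := ∑ i, ((s i j : ℤ) : ℝ) * X i

theorem measurable_rowSum (s : Fin n → ι → ℤˣ) (j : ι) : Measurable (rowSum s j) := by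
  unfold rowSum; fun_prop

variable [Fintype ι]

/-- The pairing of a sign vector with a real vector. -/
def signDot (v : ι → ℤˣ) (f : ι → ℝ) : ℝ := ∑ j, ((v j : ℤ) : ℝ) * f j

theorem sum_mul_rowSum (s : Fin n → ι → ℤˣ) (f : ι → ℝ) (X : Fin n → ℝ) :
    ∑ j, f j * rowSum s j X = ∑ i, signDot (s i) f * X i := by
  simp only [rowSum, signDot, Finset.mul_sum, Finset.sum_mul]
  rw [Finset.sum_comm]
  refine Finset.sum_congr rfl fun i _ => Finset.sum_congr rfl fun j _ => ?_
  ring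

theorem weightLaw_eq (ρ : ℝ → ℝ) (n : ℕ) : weightLaw ρ n = Measure.pi fun _ => singleLaw ρ := rfl

theorem integral_prod_exp (μ : Measure ℝ) [SigmaFinite μ] {κ : Type*} [Fintype κ] (z : κ → ℂ) :
    ∫ X : κ → ℝ, Complex.exp (∑ i, z i * X i) ∂(Measure.pi fun _ => μ) = ∏ i, laplace μ (z i) := by
  simp_rw [Complex.exp_sum]
  rw [integral_fintype_prod_eq_prod (fun i (x : ℝ) => Complex.exp (z i * x))]
  rfl

/-- Coordinates satisfying `p` are independent of the others. The event involves only the former and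
contributes its probability; the latter contribute the product of their transforms. -/
theorem norm_setIntegral_exp_le (μ : Measure ℝ) [IsProbabilityMeasure μ] (p : Fin n → Prop)
    [DecidablePred p] {A : Set ({i // p i} → ℝ)} (hA : MeasurableSet A) (y : Fin n → ℝ) :
    ‖∫ X in (fun X : Fin n → ℝ => fun i : {i // p i} => X i) ⁻¹' A,
        Complex.exp (2 * Real.pi * (∑ i, y i * X i : ℝ) * Complex.I) ∂(Measure.pi fun _ => μ)‖ ≤
      (Measure.pi fun _ : Fin n => μ).real
        ((fun X : Fin n → ℝ => fun i : {i // p i} => X i) ⁻¹' A) *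
      ∏ i : {i // ¬ p i}, ‖laplace μ (2 * Real.pi * y i * Complex.I)‖ := by
  have hmp := measurePreserving_piEquivPiSubtypeProd (fun _ : Fin n => μ) p
  have hres : Measurable fun X : Fin n → ℝ => fun i : {i // p i} => X i := by fun_prop
  have hmeas : (Measure.pi fun _ : Fin n => μ).real
      ((fun X : Fin n → ℝ => fun i : {i // p i} => X i) ⁻¹' A) =
      (Measure.pi fun _ : {i // p i} => μ).real A := by
    have h1 : (fun X : Fin n → ℝ => fun i : {i // p i} => X i) ⁻¹' A =
      (MeasurableEquiv.piEquivPiSubtypeProd (fun _ => ℝ) p) ⁻¹' (A ×ˢ univ) := by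
      ext X; simp [MeasurableEquiv.piEquivPiSubtypeProd, Equiv.piEquivPiSubtypeProd]
    rw [h1, measureReal_def, hmp.measure_preimage (hA.prod MeasurableSet.univ).nullMeasurableSet,
      Measure.prod_prod, measure_univ, mul_one, measureReal_def]
  rw [hmeas, ← integral_indicator (hres hA)]
  have hfac : ∀ X : Fin n → ℝ, ((fun X : Fin n → ℝ => fun i : {i // p i} => X i) ⁻¹' A).indicator
      (fun X => Complex.exp (2 * Real.pi * (∑ i, y i * X i : ℝ) * Complex.I)) X =
      (fun q : ({i // p i} → ℝ) × ({i // ¬ p i} → ℝ) =>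
        A.indicator (fun x => Complex.exp (2 * Real.pi * (∑ i : {i // p i}, y i * x i : ℝ) * Complex.I)) q.1 *
        Complex.exp (∑ i : {i // ¬ p i}, (2 * Real.pi * y i * Complex.I) * q.2 i))
        (MeasurableEquiv.piEquivPiSubtypeProd (fun _ => ℝ) p X) := by
    intro X
    simp only [MeasurableEquiv.piEquivPiSubtypeProd, Equiv.piEquivPiSubtypeProd,
      MeasurableEquiv.coe_mk, Equiv.coe_fn_mk]
    by_cases hX : (fun i : {i // p i} => X i) ∈ A
    · rw [indicator_of_mem hX, indicator_of_mem (by exact hX), ← Complex.exp_add]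
      congr 1
      rw [← Fintype.sum_subtype_add_sum_subtype p (fun i => y i * X i)]
      push_cast
      rw [mul_add, add_mul]
      congr 1
      rw [Finset.mul_sum, Finset.sum_mul]
      refine Finset.sum_congr rfl fun i _ => ?_
      ring
    · rw [indicator_of_notMem hX, indicator_of_notMem (by exact hX), zero_mul]
  rw [integral_congr_ae (Eventually.of_forall hfac),
    hmp.integral_comp (MeasurableEquiv.measurableEmbedding _)
      (fun q : ({i // p i} → ℝ) × ({i // ¬ p i} → ℝ) =>
        A.indicator (fun x => Complex.exp (2 * Real.pi * (∑ i : {i // p i}, y i * x i : ℝ) *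
          Complex.I)) q.1 *
        Complex.exp (∑ i : {i // ¬ p i}, (2 * Real.pi * y i * Complex.I) * q.2 i))]
  refine (le_of_eq (congrArg norm (integral_prod_mul (μ := Measure.pi fun _ : {i // p i} => μ)
    (ν := Measure.pi fun _ : {i // ¬ p i} => μ) (A.indicator (fun x => Complex.exp
      (2 * Real.pi * (∑ i : {i // p i}, y i * x i : ℝ) * Complex.I)))
    (fun x => Complex.exp (∑ i : {i // ¬ p i}, (2 * Real.pi * y i * Complex.I) * x i))))).trans ?_
  rw [norm_mul, integral_prod_exp, norm_prod]
  refine mul_le_mul_of_nonneg_right ?_ (Finset.prod_nonneg fun _ _ => norm_nonneg _)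
  rw [integral_indicator hA]
  have := norm_setIntegral_le_of_norm_le_const (μ := Measure.pi fun _ : {i // p i} => μ) (s := A)
    (f := fun x => Complex.exp (2 * Real.pi * (∑ i : {i // p i}, y i * x i : ℝ) * Complex.I)) (C := 1)
    (measure_lt_top _ _) (fun x _ => by
      rw [show (2 * Real.pi * (∑ i : {i // p i}, y i * x i : ℝ) * Complex.I) =
        ((2 * Real.pi * (∑ i : {i // p i}, y i * x i) : ℝ) : ℂ) * Complex.I by push_cast; ring,
        Complex.norm_exp_ofReal_mul_I])
  simpa using this

/-- The real matrix whose rows are the given sign vectors. -/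
def signMatrix {κ : Type*} (w : κ → κ → ℤˣ) : Matrix κ κ ℝ := fun k j => ((w k j : ℤ) : ℝ)

theorem one_le_abs_det_signMatrix {κ : Type*} [Fintype κ] [DecidableEq κ] {w : κ → κ → ℤˣ}
    (h : (signMatrix w).det ≠ 0) : 1 ≤ |(signMatrix w).det| := by
  have h1 : signMatrix w = (Matrix.of fun k j => (w k j : ℤ)).map (Int.castRingHom ℝ) := by
    ext k j; simp [signMatrix]
  rw [h1, ← RingHom.mapMatrix_apply, ← RingHom.map_det] at h ⊢
  have h2 : (Matrix.of fun k j => (w k j : ℤ)).det ≠ 0 := by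
    intro h3; rw [h3] at h; simp at h
  have h3 := Int.one_le_abs h2
  simp only [eq_intCast]
  exact_mod_cast h3

theorem injective_of_det_signMatrix_ne_zero {κ : Type*} [Fintype κ] [DecidableEq κ]
    {w : κ → κ → ℤˣ} (h : (signMatrix w).det ≠ 0) : Function.Injective w := by
  intro a b hab
  by_contra hne
  exact h (Matrix.det_zero_of_row_eq hne (by ext j; simp [signMatrix, hab]))

/-- Factors are grouped by type. As all are at most one, types outside the range of `w` and
repetitions beyond `M` may be dropped. -/
theorem prod_le_prod_pow_of_card_le {κ τ β : Type*} [Fintype κ] [Fintype τ] [DecidableEq τ]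
    [Fintype β] [DecidableEq β]
    {x : τ → ℝ} (hx0 : ∀ v, 0 ≤ x v) (hx1 : ∀ v, x v ≤ 1) (s : β → τ) {w : κ → τ}
    (hw : Function.Injective w) {M : ℕ} (hM : ∀ k, M ≤ (Finset.univ.filter fun i => s i = w k).card) :
    ∏ i, x (s i) ≤ ∏ k, x (w k) ^ M := by
  classical
  have h1 : ∏ i, x (s i) = ∏ v, x v ^ (Finset.univ.filter fun i => s i = v).card := by
    rw [← Finset.prod_fiberwise Finset.univ s]
    refine Finset.prod_congr rfl fun v _ => ?_
    rw [← Finset.prod_const]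
    exact Finset.prod_congr rfl fun i hi => by rw [(Finset.mem_filter.1 hi).2]
  have h2 : ∏ k, x (w k) ^ M = ∏ v ∈ Finset.univ.image w, x v ^ M := by
    rw [Finset.prod_image fun a _ b _ h => hw h]
  rw [h1, h2]
  refine (Finset.prod_le_prod_of_subset_of_le_one (Finset.subset_univ (Finset.univ.image w))
    (fun v _ => pow_nonneg (hx0 v) _) fun v _ _ => pow_le_one₀ (hx0 v) (hx1 v)).trans ?_
  refine Finset.prod_le_prod (fun v _ => pow_nonneg (hx0 v) _) fun v hv => ?_
  obtain ⟨k, -, rfl⟩ := Finset.mem_image.1 hv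
  exact pow_le_pow_of_le_one (hx0 _) (hx1 _) (hM k)

/-- `M` copies of each of the independent columns `w k` among the coordinates outside `p` suffice
for an integrable transform. Keeping the probability of the event on the other coordinates as a
factor is what later yields the gain in the degenerate case. -/
theorem measureReal_inter_rowSum_box_le {μ : Measure ℝ} [IsProbabilityMeasure μ] {M : ℕ} {C : ℝ}
    (hintg : Integrable fun u : ℝ => ‖laplace μ (2 * Real.pi * u * Complex.I)‖ ^ M)
    (hC : ∫ u : ℝ, ‖laplace μ (2 * Real.pi * u * Complex.I)‖ ^ M ≤ C)
    {κ : Type*} [Fintype κ] [DecidableEq κ] {w : κ → κ → ℤˣ} (hw : (signMatrix w).det ≠ 0)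
    (s : Fin n → κ → ℤˣ) (p : Fin n → Prop) [DecidablePred p]
    (hM : ∀ k, M ≤ (Finset.univ.filter fun i : {i // ¬ p i} => s i = w k).card)
    {A : Set ({i // p i} → ℝ)} (hA : MeasurableSet A) (a : ℝ) {r : ℝ} (hr : 0 < r) {c d : κ → ℝ}
    (hcd : ∀ k, c k < d k) :
    (Measure.pi fun _ : Fin n => μ).real ((fun X : Fin n → ℝ => fun i : {i // p i} => X i) ⁻¹' A ∩
        {X | ∀ k, rowSum s k X ∈ Icc (a + c k * r) (a + d k * r)}) ≤
      r ^ Fintype.card κ * ((∏ k, (d k - c k + 2)) * ((Measure.pi fun _ : Fin n => μ).real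
        ((fun X : Fin n → ℝ => fun i : {i // p i} => X i) ⁻¹' A) * C ^ Fintype.card κ)) := by
  set PA := (Measure.pi fun _ : Fin n => μ).real
        ((fun X : Fin n → ℝ => fun i : {i // p i} => X i) ⁻¹' A) with hPA
  have hmat := integrable_prod_comp_mulVec (one_le_abs_det_signMatrix hw)
    (ψ := fun _ u => ‖laplace μ (2 * Real.pi * u * Complex.I)‖ ^ M)
    (fun _ _ => by positivity) (fun _ => hintg)
  have hdot : ∀ k f, (signMatrix w).mulVec f k = signDot (w k) f := fun k f => rfl
  simp only [hdot] at hmat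
  have hres : Measurable fun X : Fin n → ℝ => fun i : {i // p i} => X i := by fun_prop
  have hC0 : 0 ≤ ∫ u : ℝ, ‖laplace μ (2 * Real.pi * u * Complex.I)‖ ^ M :=
    integral_nonneg fun u => by positivity
  refine (measureReal_inter_box_le (hres hA) (fun k => measurable_rowSum s k) hr a hcd
    (hmat.1.const_mul PA) fun f => ?_).trans ?_
  · simp_rw [sum_mul_rowSum]
    refine (norm_setIntegral_exp_le μ p hA fun i => signDot (s i) f).trans ?_
    refine mul_le_mul_of_nonneg_left ?_ measureReal_nonneg
    exact prod_le_prod_pow_of_card_le (x := fun v : κ → ℤˣ =>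
      ‖laplace μ (2 * Real.pi * (signDot v f : ℝ) * Complex.I)‖) (fun v => norm_nonneg _)
      (fun v => norm_laplace_le_one μ (by simp)) (fun i : {i // ¬ p i} => s i)
      (injective_of_det_signMatrix_ne_zero hw) hM
  · refine mul_le_mul_of_nonneg_left ?_ (by positivity)
    refine mul_le_mul_of_nonneg_left ?_ (Finset.prod_nonneg fun k _ => by linarith [hcd k])
    rw [integral_const_mul]
    refine mul_le_mul_of_nonneg_left (hmat.2.trans ?_) measureReal_nonneg
    rw [Finset.prod_const, Finset.card_univ]
    exact pow_le_pow_left₀ hC0 hC _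

/-! ### Bounds for the tilted transform of an array -/

/-- Quantitative bounds on the Laplace transform near the imaginary axis. -/
structure LaplaceBounds (μ : Measure ℝ) (M : ℕ) (C Q η : ℝ) : Prop where
  prob : IsProbabilityMeasure μ
  C_pos : 0 < C
  Q_pos : 0 < Q
  η_pos : 0 < η
  integrable_exp : Integrable (fun x => Real.exp (η * |x|)) μ
  taylor : ∀ z : ℂ, ‖z‖ ≤ η → ‖laplace μ z * Complex.exp (-(z ^ 2 / 2)) - 1‖ ≤ C * ‖z‖ ^ 4
  continuous : ∀ t : ℝ, |t| ≤ η → Continuous fun u : ℝ => laplace μ (t + 2 * Real.pi * u * Complex.I)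
  integrable_pow : ∀ t : ℝ, |t| ≤ η →
    Integrable (fun u : ℝ => ‖laplace μ (t + 2 * Real.pi * u * Complex.I)‖ ^ M)
  integral_pow_le : ∀ t : ℝ, |t| ≤ η →
    ∫ u : ℝ, ‖laplace μ (t + 2 * Real.pi * u * Complex.I)‖ ^ M ≤ Q
  decay : ∀ ε : ℝ, 0 < ε → ∃ κ t₀ : ℝ, 0 < κ ∧ κ < 1 ∧ 0 < t₀ ∧ ∀ t u : ℝ, |t| ≤ t₀ → ε ≤ |u| →
      ‖laplace μ (t + 2 * Real.pi * u * Complex.I)‖ ≤ κ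

theorem Admissible.exists_laplaceBounds {ρ : ℝ → ℝ} (hρ : Admissible ρ) :
    ∃ (M : ℕ) (C Q η : ℝ), LaplaceBounds (singleLaw ρ) M C Q η := by
  have := hρ.isProbabilityMeasure
  obtain ⟨C, r, hr, hC, h1⟩ := hρ.exists_norm_laplace_mul_exp_sub_one_le
  obtain ⟨M, Q, t₀, hM, ht₀, hQ, h2⟩ := hρ.exists_integrable_norm_laplace_pow
  obtain ⟨t₁, ht₁, h3⟩ := hρ.exists_continuous_laplace
  obtain ⟨τ, hτ, h4⟩ := hρ.exists_integrable_exp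
  set η := min (min r t₀) (min t₁ τ) with hη
  have e1 : η ≤ r := (min_le_left _ _).trans (min_le_left _ _)
  have e2 : η ≤ t₀ := (min_le_left _ _).trans (min_le_right _ _)
  have e3 : η ≤ t₁ := (min_le_right _ _).trans (min_le_left _ _)
  have e4 : η ≤ τ := (min_le_right _ _).trans (min_le_right _ _)
  refine ⟨M, C, Q, η, this, hC, hQ, lt_min (lt_min hr ht₀) (lt_min ht₁ hτ), ?_,
    fun z hz => h1 z (hz.trans e1),
    fun t ht => h3 t (ht.trans e3), fun t ht => (h2 t (ht.trans e2)).1,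
    fun t ht => (h2 t (ht.trans e2)).2, fun ε hε => hρ.exists_norm_laplace_le_of_le_abs hε⟩
  refine h4.mono' (by fun_prop) (Eventually.of_forall fun x => ?_)
  rw [Real.norm_of_nonneg (Real.exp_pos _).le]
  gcongr

variable {μ : Measure ℝ} {M : ℕ} {C Q η : ℝ}

/-- On a vertical line the modulus of the transform of a positive measure is largest at the real
point, where the Taylor bound applies. -/
theorem LaplaceBounds.norm_le_exp (H : LaplaceBounds μ M C Q η) {t u : ℝ} (ht : |t| ≤ η)
    : ‖laplace μ (t + 2 * Real.pi * u * Complex.I)‖ ≤ Real.exp (t ^ 2 / 2 + 2 * C * t ^ 4) := by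
  have := H.prob
  have h1 : ‖laplace μ (t + 2 * Real.pi * u * Complex.I)‖ ≤ ‖laplace μ t‖ := by
    have h2 : laplace μ t = ((∫ x, Real.exp (t * x) ∂μ : ℝ) : ℂ) := by
      rw [laplace, ← integral_complex_ofReal]; push_cast; rfl
    rw [h2, Complex.norm_real]
    refine (norm_integral_le_integral_norm _).trans ((le_of_eq ?_).trans (le_abs_self _))
    congr 1; ext x
    rw [Complex.norm_exp]; congr 1; simp
  refine h1.trans ?_
  have h3 := H.taylor t (by simpa using ht)
  have h4 : ‖laplace μ t * Complex.exp (-((t : ℂ) ^ 2 / 2))‖ ≤ 1 + C * |t| ^ 4 := by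
    have := norm_add_le (laplace μ t * Complex.exp (-((t : ℂ) ^ 2 / 2)) - 1) 1
    rw [sub_add_cancel, norm_one] at this
    rw [Complex.norm_real, Real.norm_eq_abs] at h3
    linarith
  rw [norm_mul, show (-((t : ℂ) ^ 2 / 2)) = ((-(t ^ 2 / 2) : ℝ) : ℂ) by push_cast; rfl,
    Complex.norm_exp_ofReal, Real.exp_neg, ← div_eq_mul_inv, div_le_iff₀ (Real.exp_pos _)] at h4
  refine h4.trans ?_
  rw [add_comm (t ^ 2 / 2), Real.exp_add]
  gcongr
  have := Real.add_one_le_exp (2 * C * t ^ 4)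
  have h5 : |t| ^ 4 = t ^ 4 := by rw [← abs_pow]; exact abs_of_nonneg (by positivity)
  have := H.C_pos
  rw [h5]
  nlinarith [pow_nonneg (abs_nonneg t) 4]

/-- With `U = 2πu` the Gaussian factor has exponent `(t² - U²)/2`. The Taylor error is at most `2C
t⁴ + 2C U⁴`, and the second bound on `ε` ensures `8C U² ≤ 1`, so `U²/4` absorbs the term in `U⁴`.
The remaining `-U²/4` is below `-u²`. -/
theorem LaplaceBounds.exists_norm_le_exp_sub (H : LaplaceBounds μ M C Q η) :
    ∃ ε : ℝ, 0 < ε ∧ ε ≤ η ∧ ∀ t u : ℝ, |t| ≤ ε → |u| ≤ ε →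
    ‖laplace μ (t + 2 * Real.pi * u * Complex.I)‖ ≤ Real.exp (t ^ 2 / 2 + 2 * C * t ^ 4 - u ^ 2) := by
  have := H.prob
  have hC := H.C_pos
  have hη := H.η_pos
  have hπ := Real.pi_pos
  refine ⟨min (η / (2 * Real.pi + 1)) (1 / (2 * Real.pi * (8 * C + 1))), by positivity,
    (min_le_left _ _).trans (div_le_self hη.le (by linarith)), fun t u ht hu => ?_⟩
  set U := 2 * Real.pi * u with hU
  have hz : ((t : ℂ) + 2 * Real.pi * u * Complex.I) = t + U * Complex.I := by rw [hU]; push_cast; ring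
  rw [hz]
  have hn : ‖(t : ℂ) + U * Complex.I‖ ^ 2 = t ^ 2 + U ^ 2 := by
    rw [← Complex.normSq_eq_norm_sq, Complex.normSq_add_mul_I]
  have hnη : ‖(t : ℂ) + U * Complex.I‖ ≤ η := by
    refine (norm_add_le _ _).trans ?_
    rw [Complex.norm_mul, Complex.norm_I, mul_one, Complex.norm_real, Complex.norm_real,
      Real.norm_eq_abs, Real.norm_eq_abs, hU, abs_mul, abs_of_pos (by positivity : 0 < 2 * Real.pi)]
    have h1 := ht.trans (min_le_left _ _)
    have h2 := hu.trans (min_le_left _ _)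
    calc |t| + 2 * Real.pi * |u| ≤ η / (2 * Real.pi + 1) + 2 * Real.pi * (η / (2 * Real.pi + 1)) := by
          gcongr
      _ = η := by field_simp; ring
  have hU1 : U ^ 2 * (8 * C) ≤ 1 := by
    have h2 := hu.trans (min_le_right _ _)
    have h3 : |U| ≤ 1 / (8 * C + 1) := by
      rw [hU, abs_mul, abs_of_pos (by positivity : 0 < 2 * Real.pi)]
      calc 2 * Real.pi * |u| ≤ 2 * Real.pi * (1 / (2 * Real.pi * (8 * C + 1))) := by gcongr
        _ = 1 / (8 * C + 1) := by field_simp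
    rw [le_div_iff₀ (by positivity)] at h3
    have h4 : |U| ≤ 1 := by nlinarith [abs_nonneg U]
    rw [← sq_abs]
    nlinarith [abs_nonneg U]
  have h3 := H.taylor _ hnη
  have h4 : ‖laplace μ (t + U * Complex.I) * Complex.exp (-(((t : ℂ) + U * Complex.I) ^ 2 / 2))‖ ≤
      1 + C * (t ^ 2 + U ^ 2) ^ 2 := by
    have := norm_add_le (laplace μ (t + U * Complex.I) *
      Complex.exp (-(((t : ℂ) + U * Complex.I) ^ 2 / 2)) - 1) 1
    rw [sub_add_cancel, norm_one] at this
    rw [← hn, ← pow_mul]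
    linarith
  have hre : (-(((t : ℂ) + U * Complex.I) ^ 2 / 2)).re = -((t ^ 2 - U ^ 2) / 2) := by
    have : ((t : ℂ) + U * Complex.I) ^ 2 = ((t ^ 2 - U ^ 2 : ℝ) : ℂ) + (2 * t * U : ℝ) * Complex.I := by
      push_cast
      linear_combination (U : ℂ) ^ 2 * Complex.I_sq
    rw [this]
    simp [Complex.add_re, Complex.mul_re, -Complex.ofReal_sub, -Complex.ofReal_mul]
  rw [norm_mul, Complex.norm_exp, hre, Real.exp_neg, ← div_eq_mul_inv,
    div_le_iff₀ (Real.exp_pos _)] at h4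
  refine h4.trans ?_
  have h5 : 1 + C * (t ^ 2 + U ^ 2) ^ 2 ≤ Real.exp (2 * C * t ^ 4 + U ^ 2 / 4) := by
    refine le_trans ?_ (Real.add_one_le_exp _)
    nlinarith [sq_nonneg (t ^ 2 - U ^ 2), mul_nonneg hC.le (sq_nonneg (t ^ 2 - U ^ 2)), sq_nonneg U]
  calc _ ≤ Real.exp (2 * C * t ^ 4 + U ^ 2 / 4) * Real.exp ((t ^ 2 - U ^ 2) / 2) := by gcongr
    _ = Real.exp (t ^ 2 / 2 + 2 * C * t ^ 4 - U ^ 2 / 4) := by rw [← Real.exp_add]; ring_nf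
    _ ≤ _ := by
      refine Real.exp_le_exp.2 ?_
      have : u ^ 2 ≤ U ^ 2 / 4 := by
        rw [hU]
        have : 1 ≤ Real.pi ^ 2 := by nlinarith [Real.pi_gt_three]
        nlinarith [sq_nonneg u]
      linarith

section SignDot

variable {ι : Type*} [Fintype ι]

theorem abs_signDot_le (v : ι → ℤˣ) (f : ι → ℝ) : |signDot v f| ≤ ∑ j, |f j| := by
  refine (Finset.abs_sum_le_sum_abs _ _).trans (le_of_eq (Finset.sum_congr rfl fun j _ => ?_))
  rcases Int.units_eq_one_or (v j) with h | h <;> simp [h]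

theorem abs_signDot_one_le (v : ι → ℤˣ) : |signDot v 1| ≤ Fintype.card ι := by
  simpa using abs_signDot_le v 1

/-- The vector of signs of a real vector. -/
noncomputable def signVec (f : ι → ℝ) : ι → ℤˣ := fun j => if 0 ≤ f j then 1 else -1

theorem signDot_signVec (f : ι → ℝ) : signDot (signVec f) f = ∑ j, |f j| := by
  refine Finset.sum_congr rfl fun j _ => ?_
  unfold signVec
  split_ifs with h
  · simp [abs_of_nonneg h]
  · simp [abs_of_neg (not_le.1 h)]

/-- In a balanced array the columns aligned with the signs of `f` are numerous, and this bound shows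
that they alone give decay in the direction `f`. -/
theorem sum_sq_le_signDot_signVec_sq (f : ι → ℝ) : ∑ j, f j ^ 2 ≤ signDot (signVec f) f ^ 2 := by
  rw [signDot_signVec]
  calc ∑ j, f j ^ 2 = ∑ j, |f j| * |f j| := by simp [← sq]
    _ ≤ ∑ j, |f j| * ∑ k, |f k| := by
        refine Finset.sum_le_sum fun j _ => ?_
        gcongr
        exact Finset.single_le_sum (f := fun k => |f k|) (fun k _ => abs_nonneg _) (Finset.mem_univ j)
    _ = _ := by rw [← Finset.sum_mul, sq]

end SignDot

variable {n : ℕ} {ι : Type*} [Fintype ι]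

/-- The number of columns of `s` equal to `v`. -/
def colCount (s : Fin n → ι → ℤˣ) (v : ι → ℤˣ) : ℕ := (Finset.univ.filter fun i => s i = v).card

/-- The mean square of the column sums. -/
noncomputable def meanSqColSum (s : Fin n → ι → ℤˣ) : ℝ := (∑ i, signDot (s i) 1 ^ 2) / n

/-- The argument of the Laplace transform attached to a column `v` at frequency `f`. -/
noncomputable def columnArg (n : ℕ) (α : ℝ) (v : ι → ℤˣ) (f : ι → ℝ) : ℂ :=
  ((α * signDot v 1 / Real.sqrt n : ℝ) : ℂ) +
    2 * Real.pi * ((signDot v f / Real.sqrt n : ℝ) : ℂ) * Complex.I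

variable {μ : Measure ℝ} {M : ℕ} {C Q η : ℝ}

theorem abs_tilt_le (hn : 0 < n) (α : ℝ) (v : ι → ℤˣ) :
    |α * signDot v 1 / Real.sqrt n| ≤ Fintype.card ι * |α| / Real.sqrt n := by
  have : 0 < Real.sqrt n := Real.sqrt_pos.2 (by exact_mod_cast hn)
  rw [abs_div, abs_mul, abs_of_pos this, mul_comm]
  gcongr
  exact abs_signDot_one_le v

/-- The quadratic terms add up exactly to `α² * meanSqColSum s / 2`; each tilt is at most `K|α|/√n`,
so the quartic terms add up to at most `2C K⁴ α⁴/n`. -/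
theorem sum_tilt_exponent_le (hn : 0 < n) {C : ℝ} (hC : 0 ≤ C) {α : ℝ} (hα : α ^ 4 ≤ n)
    (s : Fin n → ι → ℤˣ) :
    ∑ i, ((α * signDot (s i) 1 / Real.sqrt n) ^ 2 / 2 + 2 * C * (α * signDot (s i) 1 / Real.sqrt n) ^ 4)
      ≤ α ^ 2 * meanSqColSum s / 2 + 2 * C * (Fintype.card ι : ℝ) ^ 4 := by
  have hn' : (0 : ℝ) < n := by exact_mod_cast hn
  have hsq : Real.sqrt n ^ 2 = n := Real.sq_sqrt hn'.le
  have hs0 : 0 < Real.sqrt n := Real.sqrt_pos.2 hn'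
  rw [Finset.sum_add_distrib]
  refine add_le_add (le_of_eq ?_) ?_
  · rw [meanSqColSum, mul_div_assoc', Finset.mul_sum, Finset.sum_div, Finset.sum_div]
    refine Finset.sum_congr rfl fun i _ => ?_
    rw [div_pow, hsq, mul_pow]
  · have h1 : ∀ i ∈ Finset.univ, 2 * C * (α * signDot (s i) 1 / Real.sqrt n) ^ 4 ≤
        2 * C * ((Fintype.card ι : ℝ) ^ 4 / n) := by
      intro i _
      gcongr
      have h2 := abs_tilt_le hn α (s i)
      calc (α * signDot (s i) 1 / Real.sqrt n) ^ 4 = |α * signDot (s i) 1 / Real.sqrt n| ^ 4 := by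
            rw [← abs_pow]; exact (abs_of_nonneg (by positivity)).symm
        _ ≤ (Fintype.card ι * |α| / Real.sqrt n) ^ 4 := by gcongr
        _ = (Fintype.card ι : ℝ) ^ 4 * α ^ 4 / (n * n) := by
            rw [div_pow, mul_pow, ← abs_pow, abs_of_nonneg (by positivity : 0 ≤ α ^ 4),
              show Real.sqrt n ^ 4 = n * n by rw [show 4 = 2 * 2 by norm_num, pow_mul, hsq, sq]]
        _ ≤ (Fintype.card ι : ℝ) ^ 4 * n / (n * n) := by gcongr
        _ = _ := by field_simp
    refine (Finset.sum_le_sum h1).trans (le_of_eq ?_)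
    rw [Finset.sum_const, Finset.card_univ, Fintype.card_fin, nsmul_eq_mul]
    field_simp

theorem sum_sq_frequency_ge (hn : 0 < n) {δ : ℝ} (s : Fin n → ι → ℤˣ)
    (hs : ∀ v, δ * n ≤ colCount s v) (f : ι → ℝ) :
    δ * ∑ j, f j ^ 2 ≤ ∑ i, (signDot (s i) f / Real.sqrt n) ^ 2 := by
  have hn' : (0 : ℝ) < n := by exact_mod_cast hn
  have hsq : Real.sqrt n ^ 2 = n := Real.sq_sqrt hn'.le
  have h1 : ∑ i ∈ Finset.univ.filter (fun i => s i = signVec f), (signDot (s i) f / Real.sqrt n) ^ 2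
      ≤ ∑ i, (signDot (s i) f / Real.sqrt n) ^ 2 :=
    Finset.sum_le_sum_of_subset_of_nonneg (Finset.filter_subset _ _) fun _ _ _ => by positivity
  refine le_trans ?_ h1
  have h2 : ∑ i ∈ Finset.univ.filter (fun i => s i = signVec f), (signDot (s i) f / Real.sqrt n) ^ 2 =
      colCount s (signVec f) * (signDot (signVec f) f ^ 2 / n) := by
    rw [colCount, ← nsmul_eq_mul, ← Finset.sum_const]
    refine Finset.sum_congr rfl fun i hi => ?_
    rw [(Finset.mem_filter.1 hi).2, div_pow, hsq]
  rw [h2]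
  have h3 := sum_sq_le_signDot_signVec_sq f
  have h4 := hs (signVec f)
  calc δ * ∑ j, f j ^ 2 = δ * n * ((∑ j, f j ^ 2) / n) := by field_simp
    _ ≤ colCount s (signVec f) * ((∑ j, f j ^ 2) / n) := by
        have : 0 ≤ (∑ j, f j ^ 2) / n := by positivity
        gcongr
    _ ≤ _ := by gcongr

theorem prod_norm_laplace_le_of_small (hn : 0 < n) {ε δ α : ℝ} (hC : 0 ≤ C)
    (hε : ∀ t u : ℝ, |t| ≤ ε → |u| ≤ ε → ‖laplace μ (t + 2 * Real.pi * u * Complex.I)‖ ≤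
      Real.exp (t ^ 2 / 2 + 2 * C * t ^ 4 - u ^ 2))
    (hα : α ^ 4 ≤ n) (hαε : Fintype.card ι * |α| / Real.sqrt n ≤ ε)
    (s : Fin n → ι → ℤˣ) (hs : ∀ v, δ * n ≤ colCount s v) {f : ι → ℝ}
    (hf : ∑ j, |f j| ≤ ε * Real.sqrt n) :
    ∏ i, ‖laplace μ (columnArg n α (s i) f)‖ ≤
      Real.exp (α ^ 2 * meanSqColSum s / 2 + 2 * C * (Fintype.card ι : ℝ) ^ 4) *
        Real.exp (-(δ * ∑ j, f j ^ 2)) := by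
  have hs0 : 0 < Real.sqrt n := Real.sqrt_pos.2 (by exact_mod_cast hn)
  have h1 : ∏ i, ‖laplace μ (columnArg n α (s i) f)‖ ≤
      ∏ i, Real.exp (((α * signDot (s i) 1 / Real.sqrt n) ^ 2 / 2 +
        2 * C * (α * signDot (s i) 1 / Real.sqrt n) ^ 4) - (signDot (s i) f / Real.sqrt n) ^ 2) := by
    refine Finset.prod_le_prod (fun _ _ => norm_nonneg _) fun i _ => ?_
    refine hε _ _ ((abs_tilt_le hn α (s i)).trans hαε) ?_
    rw [abs_div, abs_of_pos hs0, div_le_iff₀ hs0]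
    exact (abs_signDot_le _ _).trans hf
  refine h1.trans ?_
  rw [← Real.exp_sum, ← Real.exp_add, Finset.sum_sub_distrib]
  refine Real.exp_le_exp.2 ?_
  have h2 := sum_tilt_exponent_le hn hC hα s
  have h3 := sum_sq_frequency_ge hn s hs f
  linarith

/-- Each factor `L` is divided by its bound `E ≥ 1`, so that the quotients `x` are at most one and
superfluous ones can be dropped. `M` copies of each `w k` are kept for integrability; beyond the
first `M`, every column aligned with `f` contributes a factor `κ`, because its frequency is at least
`ε` in modulus. -/
theorem prod_norm_laplace_le_of_large [DecidableEq ι] (H : LaplaceBounds μ M C Q η) (hn : 0 < n) {ε κ δ α : ℝ}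
    (hκ0 : 0 ≤ κ) (hκ1 : κ ≤ 1)
    (hε : ∀ t u : ℝ, |t| ≤ Fintype.card ι * |α| / Real.sqrt n → ε ≤ |u| →
      ‖laplace μ (t + 2 * Real.pi * u * Complex.I)‖ ≤ κ)
    (hα : α ^ 4 ≤ n) (hαη : Fintype.card ι * |α| / Real.sqrt n ≤ η)
    {w : ι → ι → ℤˣ} (hw : Function.Injective w)
    (s : Fin n → ι → ℤˣ) (hs : ∀ v, δ * n ≤ colCount s v) (hM : M ≤ ⌈δ * n⌉₊) {f : ι → ℝ}
    (hf : ε * Real.sqrt n ≤ ∑ j, |f j|) :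
    ∏ i, ‖laplace μ (columnArg n α (s i) f)‖ ≤
      Real.exp (α ^ 2 * meanSqColSum s / 2 + 2 * C * (Fintype.card ι : ℝ) ^ 4) *
        (κ ^ (⌈δ * n⌉₊ - M) * ∏ k, ‖laplace μ (columnArg n α (w k) f)‖ ^ M) := by
  have hs0 : 0 < Real.sqrt n := Real.sqrt_pos.2 (by exact_mod_cast hn)
  have hC := H.C_pos
  set E : (ι → ℤˣ) → ℝ := fun v => Real.exp ((α * signDot v 1 / Real.sqrt n) ^ 2 / 2 +
        2 * C * (α * signDot v 1 / Real.sqrt n) ^ 4) with hE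
  have hE1 : ∀ v, 1 ≤ E v := fun v => Real.one_le_exp (by positivity)
  have hEpos : ∀ v, 0 < E v := fun v => Real.exp_pos _
  set L : (ι → ℤˣ) → ℝ := fun v => ‖laplace μ (columnArg n α v f)‖ with hL
  have hLE : ∀ v, L v ≤ E v := fun v => H.norm_le_exp ((abs_tilt_le hn α v).trans hαη)
  have hL0 : ∀ v, 0 ≤ L v := fun v => norm_nonneg _
  set x : (ι → ℤˣ) → ℝ := fun v => L v / E v with hx
  have hx0 : ∀ v, 0 ≤ x v := fun v => div_nonneg (hL0 v) (hEpos v).le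
  have hx1 : ∀ v, x v ≤ 1 := fun v => (div_le_one (hEpos v)).2 (hLE v)
  have hxL : ∀ v, x v ≤ L v := fun v => div_le_self (hL0 v) (hE1 v)
  have hM' : ∀ v, M ≤ colCount s v := fun v => hM.trans (Nat.ceil_le.2 (hs v))
  have hprod : ∏ i, L (s i) = (∏ i, E (s i)) * ∏ i, x (s i) := by
    rw [← Finset.prod_mul_distrib]
    refine Finset.prod_congr rfl fun i _ => ?_
    rw [hx]; field_simp [(hEpos (s i)).ne']
  have hEprod : ∏ i, E (s i) ≤
      Real.exp (α ^ 2 * meanSqColSum s / 2 + 2 * C * (Fintype.card ι : ℝ) ^ 4) := by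
    rw [hE, ← Real.exp_sum]
    exact Real.exp_le_exp.2 (sum_tilt_exponent_le hn hC.le hα s)
  have hxprod : ∏ i, x (s i) ≤ κ ^ (⌈δ * n⌉₊ - M) * ∏ k, L (w k) ^ M := by
    have h1 : ∏ i, x (s i) = ∏ v, x v ^ colCount s v := by
      rw [← Finset.prod_fiberwise Finset.univ s]
      refine Finset.prod_congr rfl fun v _ => ?_
      rw [colCount, ← Finset.prod_const]
      exact Finset.prod_congr rfl fun i hi => by rw [(Finset.mem_filter.1 hi).2]
    have hstar : L (signVec f) ≤ κ := by
      refine hε _ _ (abs_tilt_le hn α _) ?_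
      rw [signDot_signVec, abs_of_nonneg (div_nonneg (Finset.sum_nonneg fun _ _ => abs_nonneg _) hs0.le),
        le_div_iff₀ hs0]
      exact hf
    have h2 : ∀ v ∈ Finset.univ, x v ^ colCount s v ≤
        (if v = signVec f then x v ^ (colCount s v - M) else 1) * x v ^ M := by
      intro v _
      split_ifs with h
      · rw [← pow_add, Nat.sub_add_cancel (hM' v)]
      · rw [one_mul]; exact pow_le_pow_of_le_one (hx0 v) (hx1 v) (hM' v)
    rw [h1]
    refine (Finset.prod_le_prod (fun v _ => pow_nonneg (hx0 v) _) h2).trans ?_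
    rw [Finset.prod_mul_distrib, Finset.prod_ite_eq' Finset.univ (signVec f)]
    simp only [Finset.mem_univ, if_true]
    refine mul_le_mul ?_ ?_ (Finset.prod_nonneg fun v _ => pow_nonneg (hx0 v) _) (by positivity)
    · calc x (signVec f) ^ (colCount s (signVec f) - M)
          ≤ κ ^ (colCount s (signVec f) - M) :=
            pow_le_pow_left₀ (hx0 _) ((hxL _).trans hstar) _
        _ ≤ _ := pow_le_pow_of_le_one hκ0 hκ1
            (Nat.sub_le_sub_right (Nat.ceil_le.2 (hs _)) _)
    · have h3 : ∏ k, x (w k) ^ M = ∏ v ∈ Finset.univ.image w, x v ^ M := by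
        rw [Finset.prod_image fun a _ b _ h => hw h]
      refine (Finset.prod_le_prod_of_subset_of_le_one (Finset.subset_univ (Finset.univ.image w))
        (fun v _ => pow_nonneg (hx0 v) _) fun v _ _ => pow_le_one₀ (hx0 v) (hx1 v)).trans ?_
      rw [← h3]
      exact Finset.prod_le_prod (fun k _ => pow_nonneg (hx0 _) _) fun k _ =>
        pow_le_pow_left₀ (hx0 _) (hxL _) _
  change ∏ i, L (s i) ≤ _
  rw [hprod]
  exact mul_le_mul hEprod hxprod (Finset.prod_nonneg fun i _ => hx0 _) (Real.exp_pos _).le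

/-- Frequencies are divided by `√n`, so each coordinate costs a factor `√n`; this polynomial growth
will be beaten by the power of `κ`. -/
theorem integrable_prod_norm_laplace_pow [DecidableEq ι] (H : LaplaceBounds μ M C Q η) (hn : 0 < n)
    {α : ℝ} (hαη : Fintype.card ι * |α| / Real.sqrt n ≤ η) {w : ι → ι → ℤˣ}
    (hw : (signMatrix w).det ≠ 0) :
    Integrable (fun f : ι → ℝ => ∏ k, ‖laplace μ (columnArg n α (w k) f)‖ ^ M) ∧
      ∫ f : ι → ℝ, ∏ k, ‖laplace μ (columnArg n α (w k) f)‖ ^ M ≤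
        (Real.sqrt n * Q) ^ Fintype.card ι := by
  have hs0 : 0 < Real.sqrt n := Real.sqrt_pos.2 (by exact_mod_cast hn)
  set ψ : ι → ℝ → ℝ := fun k x => ‖laplace μ (((α * signDot (w k) 1 / Real.sqrt n : ℝ) : ℂ) +
    2 * Real.pi * ((x / Real.sqrt n : ℝ) : ℂ) * Complex.I)‖ ^ M with hψ
  have htk : ∀ k, |α * signDot (w k) 1 / Real.sqrt n| ≤ η := fun k =>
    (abs_tilt_le hn α (w k)).trans hαη
  have hintg : ∀ k, Integrable (ψ k) := fun k =>
    (integrable_comp_div_iff _ hs0.ne').2 (H.integrable_pow _ (htk k))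
  have hval : ∀ k, ∫ x, ψ k x ≤ Real.sqrt n * Q := fun k => by
    have h1 := Measure.integral_comp_div (fun u : ℝ =>
      ‖laplace μ (((α * signDot (w k) 1 / Real.sqrt n : ℝ) : ℂ) + 2 * Real.pi * u * Complex.I)‖ ^ M)
      (Real.sqrt n)
    rw [abs_of_pos hs0, smul_eq_mul] at h1
    refine (le_of_eq h1).trans ?_
    exact mul_le_mul_of_nonneg_left (H.integral_pow_le _ (htk k)) hs0.le
  have hmat := integrable_prod_comp_mulVec (one_le_abs_det_signMatrix hw) (ψ := ψ)
    (fun k x => by positivity) hintg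
  refine ⟨hmat.1, hmat.2.trans ?_⟩
  rw [← Finset.card_univ, ← Finset.prod_const]
  exact Finset.prod_le_prod (fun k _ => integral_nonneg fun x => by positivity) fun k _ => hval k

variable {n : ℕ} {ι : Type*} {μ : Measure ℝ} {M : ℕ} {C Q η : ℝ}

/-- The overlap of the rows `j` and `k` of the array of signs `s`. -/
noncomputable def overlap (s : Fin n → ι → ℤˣ) (j k : ι) : ℝ :=
  (∑ i, ((s i j : ℤ) : ℝ) * ((s i k : ℤ) : ℝ)) / n

theorem overlap_self (hn : 0 < n) (s : Fin n → ι → ℤˣ) (j : ι) : overlap s j j = 1 := by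
  have h : ∀ i, ((s i j : ℤ) : ℝ) * ((s i j : ℤ) : ℝ) = 1 := fun i => by
    rcases Int.units_eq_one_or (s i j) with h | h <;> simp [h]
  have hn' : (n : ℝ) ≠ 0 := by exact_mod_cast hn.ne'
  simp [overlap, h, hn']

variable [Fintype ι]

theorem meanSqColSum_eq (s : Fin n → ι → ℤˣ) : meanSqColSum s = ∑ j, ∑ k, overlap s j k := by
  simp only [meanSqColSum, overlap, signDot, ← Finset.sum_div, sq, Finset.sum_mul_sum, Pi.one_apply,
    mul_one]
  congr 1
  rw [Finset.sum_comm]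
  exact Finset.sum_congr rfl fun j _ => Finset.sum_comm

theorem meanSqColSum_le (hn : 0 < n) (s : Fin n → ι → ℤˣ) {θ : ℝ} (hθ : 0 ≤ θ)
    (h : ∀ j k, j ≠ k → |overlap s j k| ≤ θ) :
    meanSqColSum s ≤ Fintype.card ι + (Fintype.card ι : ℝ) ^ 2 * θ := by
  classical
  rw [meanSqColSum_eq]
  have h1 : ∀ j k, overlap s j k ≤ (if j = k then 1 else 0) + θ := by
    intro j k
    split_ifs with hjk
    · rw [hjk, overlap_self hn]; linarith
    · linarith [le_abs_self (overlap s j k), h j k hjk]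
  refine (Finset.sum_le_sum fun j _ => Finset.sum_le_sum fun k _ => h1 j k).trans (le_of_eq ?_)
  simp [Finset.sum_add_distrib]
  ring

theorem columnArg_eq (n : ℕ) (α : ℝ) (v : ι → ℤˣ) (f : ι → ℝ) :
    columnArg n α v f =
      (∑ j, ((v j : ℤ) : ℂ) * (α + 2 * Real.pi * f j * Complex.I)) / (Real.sqrt n : ℂ) := by
  simp only [columnArg, signDot]
  push_cast
  simp only [Pi.one_apply, Complex.ofReal_one, mul_one, mul_add, Finset.sum_add_distrib, add_div]
  congr 1
  · rw [← Finset.sum_mul]; ring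
  · rw [← mul_div_assoc, div_mul_eq_mul_div, Finset.mul_sum, Finset.sum_mul]
    congr 1
    refine Finset.sum_congr rfl fun j _ => ?_
    ring

theorem norm_columnArg_le (n : ℕ) (α : ℝ) (v : ι → ℤˣ) (f : ι → ℝ) :
    ‖columnArg n α v f‖ ≤ (∑ j, ‖(α : ℂ) + 2 * Real.pi * f j * Complex.I‖) / Real.sqrt n := by
  rw [columnArg_eq, norm_div, Complex.norm_real, Real.norm_of_nonneg (Real.sqrt_nonneg _)]
  gcongr
  refine (norm_sum_le _ _).trans (le_of_eq (Finset.sum_congr rfl fun j _ => ?_))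
  have h1 : ‖((v j : ℤ) : ℂ)‖ = 1 := by
    rcases Int.units_eq_one_or (v j) with h | h <;> simp [h]
  rw [norm_mul, h1, one_mul]

/-- With `ζ j = α + 2πi f j`, the sum of squared arguments is the quadratic form `∑ overlap j k * ζ
j * ζ k`. Its diagonal is exact, and only the off-diagonal overlaps remain in the difference. -/
theorem norm_sum_columnArg_sq_sub_le (hn : 0 < n) (s : Fin n → ι → ℤˣ) {θ : ℝ} (hθ : 0 ≤ θ)
    (h : ∀ j k, j ≠ k → |overlap s j k| ≤ θ) (α : ℝ) (f : ι → ℝ) :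
    ‖∑ i, columnArg n α (s i) f ^ 2 - ∑ j, ((α : ℂ) + 2 * Real.pi * f j * Complex.I) ^ 2‖ ≤
      θ * (∑ j, ‖(α : ℂ) + 2 * Real.pi * f j * Complex.I‖) ^ 2 := by
  classical
  set ζ : ι → ℂ := fun j => (α : ℂ) + 2 * Real.pi * f j * Complex.I with hζ
  have hn' : (0 : ℝ) < n := by exact_mod_cast hn
  have hsq : ((Real.sqrt n : ℝ) : ℂ) ^ 2 = n := by
    rw [← Complex.ofReal_pow, Real.sq_sqrt hn'.le]; simp
  have h1 : ∑ i, columnArg n α (s i) f ^ 2 = ∑ j, ∑ k, (overlap s j k : ℂ) * (ζ j * ζ k) := by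
    simp_rw [columnArg_eq, div_pow, hsq, sq, Finset.sum_mul_sum]
    rw [← Finset.sum_div, Finset.sum_comm, Finset.sum_div]
    refine Finset.sum_congr rfl fun j _ => ?_
    rw [Finset.sum_comm, Finset.sum_div]
    refine Finset.sum_congr rfl fun k _ => ?_
    simp only [overlap]
    push_cast
    rw [div_mul_eq_mul_div, Finset.sum_mul]
    congr 1
    refine Finset.sum_congr rfl fun i _ => ?_
    simp only [hζ]
    ring
  have h2 : ∑ j, ζ j ^ 2 = ∑ j, ∑ k, (if j = k then (1 : ℂ) else 0) * (ζ j * ζ k) := by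
    refine Finset.sum_congr rfl fun j _ => ?_
    simp [sq]
  change ‖_ - ∑ j, ζ j ^ 2‖ ≤ θ * (∑ j, ‖ζ j‖) ^ 2
  rw [h1, h2, ← Finset.sum_sub_distrib]
  simp_rw [← Finset.sum_sub_distrib, ← sub_mul]
  rw [sq, Finset.sum_mul_sum, Finset.mul_sum]
  refine (norm_sum_le _ _).trans (Finset.sum_le_sum fun j _ => ?_)
  rw [Finset.mul_sum]
  refine (norm_sum_le _ _).trans (Finset.sum_le_sum fun k _ => ?_)
  rw [norm_mul, norm_mul]
  refine mul_le_mul_of_nonneg_right ?_ (by positivity)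
  split_ifs with hjk
  · rw [hjk, overlap_self hn]; simpa using hθ
  · rw [sub_zero, Complex.norm_real]; exact h j k hjk

/-- The main quantitative estimate behind the pointwise convergence of the tilted transforms. -/
theorem norm_prod_laplace_sub_le (H : LaplaceBounds μ M C Q η) (hn : 0 < n) (s : Fin n → ι → ℤˣ)
    (α : ℝ) (f : ι → ℝ) {A : ℝ} (hA : ∑ j, ‖(α : ℂ) + 2 * Real.pi * f j * Complex.I‖ ≤ A)
    (hAη : A / Real.sqrt n ≤ η) :
    ‖∏ i, (laplace μ (columnArg n α (s i) f) * Complex.exp (-(columnArg n α (s i) f ^ 2 / 2))) - 1‖ ≤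
      Real.exp (C * (A ^ 4 / n)) - 1 := by
  have hn' : (0 : ℝ) < n := by exact_mod_cast hn
  have hs0 : 0 < Real.sqrt n := Real.sqrt_pos.2 hn'
  have hC := H.C_pos
  have hz : ∀ i, ‖columnArg n α (s i) f‖ ≤ A / Real.sqrt n := fun i =>
    (norm_columnArg_le n α (s i) f).trans (by gcongr)
  have h1 := Finset.norm_prod_one_add_sub_one_le Finset.univ (fun i =>
    laplace μ (columnArg n α (s i) f) * Complex.exp (-(columnArg n α (s i) f ^ 2 / 2)) - 1)
  simp only [add_sub_cancel] at h1
  refine h1.trans ?_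
  gcongr
  calc _ ≤ ∑ _i : Fin n, C * (A / Real.sqrt n) ^ 4 := by
        refine Finset.sum_le_sum fun i _ => (H.taylor _ ((hz i).trans hAη)).trans ?_
        gcongr
        exact hz i
    _ = C * (A ^ 4 / n) := by
        rw [Finset.sum_const, Finset.card_univ, Fintype.card_fin, nsmul_eq_mul, div_pow,
          show Real.sqrt n ^ 4 = n * n by
            rw [show 4 = 2 * 2 by norm_num, pow_mul, Real.sq_sqrt hn'.le, sq]]
        field_simp

/-! ### Pointwise limit of the tilted transform for nearly orthogonal rows -/

section Limit

variable {β : Type*} {l : Filter β} {N : β → ℕ} {s : ∀ b, Fin (N b) → ι → ℤˣ} {α ξ θ : β → ℝ}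

/-- The product of transforms is `∏ (laplace * e^{-z²/2})` times `e^{∑ z²/2}`. The first factor
tends to 1 because `α⁴/n → 0`. The second is asymptotically `exp(Kα²/2 + 2πiα ∑ f - 2π² ∑ f²)`
because `(1 + α²) θ → 0`, and the prefactors cancel its first two terms. -/
theorem tendsto_prod_laplace (H : LaplaceBounds μ M C Q η) (hN : Tendsto N l atTop)
    (hα : Tendsto (fun b => α b ^ 4 / N b) l (𝓝 0))
    (hθ0 : ∀ b, 0 ≤ θ b) (hθ : Tendsto (fun b => (1 + α b ^ 2) * θ b) l (𝓝 0))
    (hov : ∀ᶠ b in l, ∀ j k, j ≠ k → |overlap (s b) j k| ≤ θ b) (f : ι → ℝ) :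
    Tendsto (fun b => Complex.exp (-(2 * Real.pi * (α b * (∑ j, f j : ℝ)) * Complex.I)) *
      (Complex.exp (-(Fintype.card ι * α b ^ 2 / 2)) *
        ∏ i, laplace μ (columnArg (N b) (α b) (s b i) f))) l
      (𝓝 (Real.exp (-(2 * Real.pi ^ 2) * ∑ j, f j ^ 2) : ℝ)) := by
  set K : ℝ := (Fintype.card ι : ℝ) with hK
  set D : ℝ := ∑ j, 2 * Real.pi * |f j| with hD
  set A : β → ℝ := fun b => K * |α b| + D with hAdef
  have hD0 : 0 ≤ D := Finset.sum_nonneg fun j _ => by positivity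
  have hA : ∀ b, ∑ j, ‖(α b : ℂ) + 2 * Real.pi * f j * Complex.I‖ ≤ A b := by
    intro b
    have h1 : ∀ j ∈ Finset.univ, ‖(α b : ℂ) + 2 * Real.pi * f j * Complex.I‖ ≤
        |α b| + 2 * Real.pi * |f j| := by
      intro j _
      refine (norm_add_le _ _).trans (le_of_eq ?_)
      simp [abs_of_pos Real.pi_pos]
    refine (Finset.sum_le_sum h1).trans (le_of_eq ?_)
    simp [Finset.sum_add_distrib, hAdef, K, hD]
  have hNr : Tendsto (fun b => (N b : ℝ)) l atTop := tendsto_natCast_atTop_atTop.comp hN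
  have hA4 : Tendsto (fun b => A b ^ 4 / N b) l (𝓝 0) := by
    have h1 : Tendsto (fun b => 8 * K ^ 4 * (α b ^ 4 / N b) + 8 * D ^ 4 * (1 / (N b : ℝ))) l (𝓝 0) := by
      have := (hα.const_mul (8 * K ^ 4)).add
        ((tendsto_const_nhds (x := (1 : ℝ)).div_atTop hNr).const_mul (8 * D ^ 4))
      simpa using this
    refine squeeze_zero (fun b => by positivity) (fun b => ?_) h1
    have h2 : A b ^ 4 ≤ 8 * K ^ 4 * α b ^ 4 + 8 * D ^ 4 := by
      have h3 : (A b) ^ 2 ≤ 2 * (K * |α b|) ^ 2 + 2 * D ^ 2 := by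
        simp only [hAdef]; nlinarith [sq_nonneg (K * |α b| - D)]
      have h4 : (A b ^ 2) ^ 2 ≤ (2 * (K * |α b|) ^ 2 + 2 * D ^ 2) ^ 2 := by gcongr
      have h5 : (K * |α b|) ^ 4 = K ^ 4 * α b ^ 4 := by
        rw [mul_pow, ← abs_pow, abs_of_nonneg (by positivity : 0 ≤ α b ^ 4)]
      nlinarith [sq_nonneg ((K * |α b|) ^ 2 - D ^ 2)]
    calc A b ^ 4 / N b ≤ (8 * K ^ 4 * α b ^ 4 + 8 * D ^ 4) / N b := by gcongr
      _ = _ := by ring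
  have hAη : ∀ᶠ b in l, A b / Real.sqrt (N b) ≤ η := by
    have hη := H.η_pos
    filter_upwards [hA4.eventually (ge_mem_nhds (show (0 : ℝ) < η ^ 4 by positivity)),
      hN.eventually_ge_atTop 1] with b hb hb1
    have hN1 : (1 : ℝ) ≤ N b := by exact_mod_cast hb1
    have hs0 : 0 < Real.sqrt (N b) := Real.sqrt_pos.2 (by linarith)
    refine le_of_pow_le_pow_left₀ (n := 4) (by norm_num) hη.le (le_trans ?_ hb)
    rw [div_pow, show Real.sqrt (N b) ^ 4 = N b * N b by
      rw [show 4 = 2 * 2 by norm_num, pow_mul, Real.sq_sqrt (by linarith), sq]]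
    gcongr
    nlinarith
  have hprod : Tendsto (fun b => ∏ i, (laplace μ (columnArg (N b) (α b) (s b i) f) *
      Complex.exp (-(columnArg (N b) (α b) (s b i) f ^ 2 / 2)))) l (𝓝 1) := by
    rw [tendsto_iff_norm_sub_tendsto_zero]
    have h1 : Tendsto (fun b => Real.exp (C * (A b ^ 4 / N b)) - 1) l (𝓝 0) := by
      have := (Real.continuous_exp.tendsto _).comp (hA4.const_mul C)
      simpa using this.sub_const 1
    refine squeeze_zero' (Eventually.of_forall fun b => norm_nonneg _) ?_ h1
    filter_upwards [hAη, hN.eventually_ge_atTop 1] with b hb hb1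
    exact norm_prod_laplace_sub_le H hb1 (s b) (α b) f (hA b) hb
  have hquad : Tendsto (fun b => ∑ i, columnArg (N b) (α b) (s b i) f ^ 2 -
      ∑ j, ((α b : ℂ) + 2 * Real.pi * f j * Complex.I) ^ 2) l (𝓝 0) := by
    rw [tendsto_zero_iff_norm_tendsto_zero]
    have h1 : Tendsto (fun b => (2 * K ^ 2 + 2 * D ^ 2) * ((1 + α b ^ 2) * θ b)) l (𝓝 0) := by
      simpa using hθ.const_mul (2 * K ^ 2 + 2 * D ^ 2)
    refine squeeze_zero' (Eventually.of_forall fun b => norm_nonneg _) ?_ h1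
    filter_upwards [hov, hN.eventually_ge_atTop 1] with b hb hb1
    refine (norm_sum_columnArg_sq_sub_le hb1 (s b) (hθ0 b) hb (α b) f).trans ?_
    have h2 : (∑ j, ‖(α b : ℂ) + 2 * Real.pi * f j * Complex.I‖) ^ 2 ≤ A b ^ 2 :=
      pow_le_pow_left₀ (Finset.sum_nonneg fun _ _ => norm_nonneg _) (hA b) 2
    have h3 : (A b) ^ 2 ≤ (2 * K ^ 2 + 2 * D ^ 2) * (1 + α b ^ 2) := by
      have h4 : (A b) ^ 2 ≤ 2 * (K * |α b|) ^ 2 + 2 * D ^ 2 := by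
        simp only [hAdef]; nlinarith [sq_nonneg (K * |α b| - D)]
      rw [mul_pow, sq_abs] at h4
      nlinarith [sq_nonneg K, sq_nonneg D, mul_nonneg (sq_nonneg D) (sq_nonneg (α b))]
    calc θ b * _ ≤ θ b * ((2 * K ^ 2 + 2 * D ^ 2) * (1 + α b ^ 2)) :=
          mul_le_mul_of_nonneg_left (h2.trans h3) (hθ0 b)
      _ = _ := by ring
  have hexp := (Complex.continuous_exp.tendsto _).comp (hquad.div_const 2)
  have hfin := (hprod.mul hexp).mul_const (((Real.exp (-(2 * Real.pi ^ 2) * ∑ j, f j ^ 2) : ℝ) : ℂ))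
  simp only [zero_div, Complex.exp_zero, one_mul, mul_one] at hfin
  refine hfin.congr fun b => ?_
  simp only [Function.comp]
  rw [Finset.prod_mul_distrib, ← Complex.exp_sum, Complex.ofReal_exp, mul_assoc, mul_assoc,
    ← Complex.exp_add, ← Complex.exp_add, mul_comm (Complex.exp (-(Fintype.card ι * (α b : ℂ) ^ 2 / 2))),
    mul_left_comm, ← Complex.exp_add]
  congr 2
  have hz : ∑ j, ((α b : ℂ) + 2 * Real.pi * f j * Complex.I) ^ 2 =
      Fintype.card ι * (α b : ℂ) ^ 2 + 4 * Real.pi * (α b) * Complex.I * ∑ j, (f j : ℂ) -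
        4 * Real.pi ^ 2 * ∑ j, (f j : ℂ) ^ 2 := by
    have : ∀ j, ((α b : ℂ) + 2 * Real.pi * f j * Complex.I) ^ 2 = (α b : ℂ) ^ 2 +
        4 * Real.pi * (α b) * Complex.I * (f j : ℂ) - 4 * Real.pi ^ 2 * (f j : ℂ) ^ 2 := fun j => by
      linear_combination (2 * Real.pi * f j : ℂ) ^ 2 * Complex.I_sq
    simp_rw [this]
    rw [Finset.sum_sub_distrib, Finset.sum_add_distrib, ← Finset.mul_sum, ← Finset.mul_sum]
    simp
  rw [hz, Finset.sum_neg_distrib, ← Finset.sum_div]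
  push_cast
  ring

end Limit

/-! ### Exponential tilting and the local limit theorem -/

variable {n : ℕ} {ι : Type*} {μ : Measure ℝ} {M : ℕ} {C Q η : ℝ}

/-- The normalized row sums. -/
noncomputable def normRowSum (s : Fin n → ι → ℤˣ) (j : ι) (X : Fin n → ℝ) : ℝ :=
  rowSum s j X / Real.sqrt n

theorem measurable_normRowSum (s : Fin n → ι → ℤˣ) (j : ι) : Measurable (normRowSum s j) :=
  (measurable_rowSum s j).div_const _

variable [Fintype ι]

theorem tilt_exponent_eq (s : Fin n → ι → ℤˣ) (α : ℝ) (f : ι → ℝ) (X : Fin n → ℝ) :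
    ((α * ∑ j, normRowSum s j X : ℝ) : ℂ) +
      2 * Real.pi * (∑ j, f j * normRowSum s j X : ℝ) * Complex.I =
      ∑ i, columnArg n α (s i) f * X i := by
  have h1 : ∑ j, normRowSum s j X = (∑ i, signDot (s i) 1 * X i) / Real.sqrt n := by
    rw [← sum_mul_rowSum, Finset.sum_div]
    simp [normRowSum]
  have h2 : ∑ j, f j * normRowSum s j X = (∑ i, signDot (s i) f * X i) / Real.sqrt n := by
    rw [← sum_mul_rowSum, Finset.sum_div]
    simp [normRowSum, mul_div_assoc]
  rw [h1, h2]
  push_cast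
  simp only [columnArg, add_mul, Finset.sum_add_distrib, Finset.sum_div, Finset.mul_sum,
    Finset.sum_mul]
  push_cast
  congr 1
  · refine Finset.sum_congr rfl fun i _ => ?_
    ring
  · refine Finset.sum_congr rfl fun i _ => ?_
    ring

theorem integrable_tilt (H : LaplaceBounds μ M C Q η) (hn : 0 < n) (s : Fin n → ι → ℤˣ) {α : ℝ}
    (hα : Fintype.card ι * |α| / Real.sqrt n ≤ η) :
    Integrable (fun X : Fin n → ℝ => Complex.exp ((α * ∑ j, normRowSum s j X : ℝ) : ℂ))
      (Measure.pi fun _ => μ) := by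
  have := H.prob
  have h1 : ∀ X : Fin n → ℝ, Complex.exp ((α * ∑ j, normRowSum s j X : ℝ) : ℂ) =
      ∏ i, Complex.exp (columnArg n α (s i) 0 * X i) := by
    intro X
    rw [← Complex.exp_sum, ← tilt_exponent_eq s α 0 X]
    simp
  simp_rw [h1]
  refine Integrable.fintype_prod (f := fun i (x : ℝ) => Complex.exp (columnArg n α (s i) 0 * x))
    fun i => integrable_cexp_mul H.integrable_exp ?_
  have h2 : (columnArg n α (s i) 0).re = α * signDot (s i) 1 / Real.sqrt n := by
    simp [columnArg, signDot]
  rw [h2]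
  exact (abs_tilt_le hn α (s i)).trans hα

/-- The tilt moves the frequencies off the imaginary axis to real part governed by `α`, the saddle
point for windows located near `α`. -/
theorem integral_tilt_mul_prod (H : LaplaceBounds μ M C Q η) (hn : 0 < n) (s : Fin n → ι → ℤˣ) {α : ℝ}
    (hα : Fintype.card ι * |α| / Real.sqrt n ≤ η) (h : ι → 𝓢(ℝ, ℂ)) {ξ : ℝ} (hξ : 0 < ξ) :
    ∫ X : Fin n → ℝ, Complex.exp ((α * ∑ j, normRowSum s j X : ℝ) : ℂ) *
        ∏ j, h j ((normRowSum s j X - α) / ξ) ∂(Measure.pi fun _ => μ) =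
      ξ ^ Fintype.card ι * ∫ f : ι → ℝ, (∏ j, 𝓕 (h j) (ξ * f j)) *
        Complex.exp (-(2 * Real.pi * (α * (∑ j, f j : ℝ)) * Complex.I)) *
        ∏ i, laplace μ (columnArg n α (s i) f) := by
  have := H.prob
  rw [integral_mul_prod_schwartz (integrable_tilt H hn s hα) (measurable_normRowSum s) h hξ α]
  congr 2
  ext f
  congr 1
  rw [← integral_prod_exp]
  congr 1; ext X
  rw [← tilt_exponent_eq, Complex.exp_add]

/-- The condition that every sign vector occurs among the columns with frequency at least `δ`. -/
def IsBalanced (δ : ℝ) (s : Fin n → ι → ℤˣ) : Prop := ∀ v, δ * n ≤ colCount s v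

theorem LaplaceBounds.exists_transform_bound [DecidableEq ι] (H : LaplaceBounds μ M C Q η)
    {w : ι → ι → ℤˣ} (hw : (signMatrix w).det ≠ 0) (δ : ℝ) :
    ∃ ε κ τ : ℝ, 0 < ε ∧ 0 < κ ∧ κ < 1 ∧ 0 < τ ∧ τ ≤ η ∧
      ∀ (n : ℕ) (α : ℝ) (s : Fin n → ι → ℤˣ), 0 < n → α ^ 4 ≤ n →
        Fintype.card ι * |α| / Real.sqrt n ≤ τ → IsBalanced δ s → M ≤ ⌈δ * n⌉₊ → ∀ f : ι → ℝ,
        (∑ j, |f j| ≤ ε * Real.sqrt n → ∏ i, ‖laplace μ (columnArg n α (s i) f)‖ ≤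
          Real.exp (α ^ 2 * meanSqColSum s / 2 + 2 * C * (Fintype.card ι : ℝ) ^ 4) *
            Real.exp (-(δ * ∑ j, f j ^ 2))) ∧
        (ε * Real.sqrt n ≤ ∑ j, |f j| → ∏ i, ‖laplace μ (columnArg n α (s i) f)‖ ≤
          Real.exp (α ^ 2 * meanSqColSum s / 2 + 2 * C * (Fintype.card ι : ℝ) ^ 4) *
            (κ ^ (⌈δ * n⌉₊ - M) * ∏ k, ‖laplace μ (columnArg n α (w k) f)‖ ^ M)) := by
  obtain ⟨ε, hε, hεη, h1⟩ := H.exists_norm_le_exp_sub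
  obtain ⟨κ, t₀, hκ0, hκ1, ht₀, h2⟩ := H.decay ε hε
  refine ⟨ε, κ, min ε t₀, hε, hκ0, hκ1, lt_min hε ht₀, (min_le_left _ _).trans hεη, ?_⟩
  intro n α s hn hα hαε hs hM f
  refine ⟨fun hf => ?_, fun hf => ?_⟩
  · exact prod_norm_laplace_le_of_small hn H.C_pos.le h1 hα (hαε.trans (min_le_left _ _)) s hs hf
  · exact prod_norm_laplace_le_of_large H hn hκ0.le hκ1.le
      (fun t u ht hu => h2 t u (ht.trans (hαε.trans (min_le_right _ _))) hu) hα
      (hαε.trans ((min_le_left _ _).trans hεη)) (injective_of_det_signMatrix_ne_zero hw) s hs hM hf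

theorem integrable_exp_neg_mul_sum_sq {δ : ℝ} (hδ : 0 < δ) :
    Integrable fun f : ι → ℝ => Real.exp (-(δ * ∑ j, f j ^ 2)) := by
  have h1 : ∀ f : ι → ℝ, Real.exp (-(δ * ∑ j, f j ^ 2)) = ∏ j, Real.exp (-δ * f j ^ 2) := by
    intro f
    rw [← Real.exp_sum, Finset.mul_sum, ← Finset.sum_neg_distrib]
    simp
  simp_rw [h1]
  exact Integrable.fintype_prod (f := fun _ (x : ℝ) => Real.exp (-δ * x ^ 2))
    fun _ => integrable_exp_neg_mul_sq hδ

theorem integral_exp_neg_sum_sq :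
    ∫ f : ι → ℝ, Real.exp (-(2 * Real.pi ^ 2) * ∑ j, f j ^ 2) =
      (Real.sqrt (2 * Real.pi))⁻¹ ^ Fintype.card ι := by
  have h1 : ∀ f : ι → ℝ, Real.exp (-(2 * Real.pi ^ 2) * ∑ j, f j ^ 2) =
      ∏ j, Real.exp (-(2 * Real.pi ^ 2) * f j ^ 2) := by
    intro f
    rw [← Real.exp_sum, Finset.mul_sum]
  simp_rw [h1]
  rw [integral_fintype_prod_volume_eq_pow (fun x : ℝ => Real.exp (-(2 * Real.pi ^ 2) * x ^ 2)),
    integral_gaussian, ← Real.sqrt_inv]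
  congr 2
  have := Real.pi_ne_zero
  field_simp

theorem continuous_prod_laplace (H : LaplaceBounds μ M C Q η) (hn : 0 < n) {α : ℝ}
    (hα : Fintype.card ι * |α| / Real.sqrt n ≤ η) (s : Fin n → ι → ℤˣ) :
    Continuous fun f : ι → ℝ => ∏ i, laplace μ (columnArg n α (s i) f) := by
  refine continuous_finsetProd _ fun i _ => ?_
  have h1 := H.continuous _ ((abs_tilt_le hn α (s i)).trans hα)
  have h2 : Continuous fun f : ι → ℝ => signDot (s i) f / Real.sqrt n := by
    unfold signDot; fun_prop
  exact h1.comp h2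

theorem tendsto_geometric_mul_sqrt_pow {κ δ : ℝ} (hκ0 : 0 < κ) (hκ1 : κ < 1) (hδ : 0 < δ) (M K : ℕ)
    (Q : ℝ) : Tendsto (fun n : ℕ => κ ^ (⌈δ * n⌉₊ - M) * (Real.sqrt n * Q) ^ K) atTop (𝓝 0) := by
  have hr1 : |κ ^ δ| < 1 := by
    rw [abs_of_pos (by positivity)]
    exact Real.rpow_lt_one hκ0.le hκ1 hδ
  have h1 := (tendsto_pow_const_mul_const_pow_of_abs_lt_one K hr1).const_mul ((κ ^ M)⁻¹ * |Q| ^ K)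
  rw [mul_zero] at h1
  refine squeeze_zero_norm' ?_ h1
  filter_upwards [eventually_ge_atTop 1] with n hn
  have hn' : (1 : ℝ) ≤ n := by exact_mod_cast hn
  rw [norm_mul, norm_pow, norm_pow, Real.norm_of_nonneg hκ0.le, norm_mul,
    Real.norm_of_nonneg (Real.sqrt_nonneg _), Real.norm_eq_abs, mul_pow]
  have h2 : κ ^ (⌈δ * n⌉₊ - M) ≤ (κ ^ M)⁻¹ * (κ ^ δ) ^ n := by
    rw [← Real.rpow_natCast (κ ^ δ), ← Real.rpow_mul hκ0.le, ← div_eq_inv_mul,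
      le_div_iff₀ (by positivity), ← pow_add]
    -- The truncated subtraction only enlarges the exponent, which is harmless as `κ < 1`.
    calc κ ^ (⌈δ * n⌉₊ - M + M) ≤ κ ^ ⌈δ * n⌉₊ := pow_le_pow_of_le_one hκ0.le hκ1.le (by omega)
      _ = κ ^ ((⌈δ * n⌉₊ : ℕ) : ℝ) := (Real.rpow_natCast _ _).symm
      _ ≤ κ ^ (δ * n) := Real.rpow_le_rpow_of_exponent_ge hκ0 hκ1.le (Nat.le_ceil _)
  have h3 : Real.sqrt n ^ K ≤ (n : ℝ) ^ K := by
    gcongr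
    exact Real.sqrt_le_iff.2 ⟨by positivity, by nlinarith⟩
  calc _ ≤ (κ ^ M)⁻¹ * (κ ^ δ) ^ n * ((n : ℝ) ^ K * |Q| ^ K) := by gcongr
    _ = _ := by ring

variable {n : ℕ} {ι : Type*} [Fintype ι] {μ : Measure ℝ} {M : ℕ} {C Q η : ℝ}

/-- The event that all normalized row sums lie in prescribed windows close to `α`. -/
def boxEvent (s : Fin n → ι → ℤˣ) (α ξ : ℝ) (c d : ι → ℝ) : Set (Fin n → ℝ) :=
  {X | ∀ j, normRowSum s j X ∈ Icc (α + c j * ξ) (α + d j * ξ)}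

theorem measurableSet_boxEvent (s : Fin n → ι → ℤˣ) (α ξ : ℝ) (c d : ι → ℝ) :
    MeasurableSet (boxEvent s α ξ c d) := by
  have : boxEvent s α ξ c d =
      ⋂ j, normRowSum s j ⁻¹' Icc (α + c j * ξ) (α + d j * ξ) := by
    ext X; simp [boxEvent]
  rw [this]
  exact MeasurableSet.iInter fun j => measurable_normRowSum s j measurableSet_Icc

/-- The tilted expectation of a product of test functions of the normalized row sums. -/
noncomputable def tiltedIntegral (μ : Measure ℝ) (s : Fin n → ι → ℤˣ) (α ξ : ℝ)
    (h : ι → 𝓢(ℝ, ℂ)) : ℝ :=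
  ∫ X : Fin n → ℝ, Real.exp (α * ∑ j, normRowSum s j X) *
    ∏ j, (h j ((normRowSum s j X - α) / ξ)).re ∂(Measure.pi fun _ => μ)

theorem integrable_tilt_mul_prod (H : LaplaceBounds μ M C Q η) (hn : 0 < n) (s : Fin n → ι → ℤˣ)
    {α : ℝ} (hα : Fintype.card ι * |α| / Real.sqrt n ≤ η) {h : ι → 𝓢(ℝ, ℂ)} {c d : ι → ℝ} {ε : ℝ}
    (hh : ∀ j, IsCutoff (h j) (c j) (d j) ε) (ξ : ℝ) :
    Integrable (fun X : Fin n → ℝ => Real.exp (α * ∑ j, normRowSum s j X) *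
      ∏ j, (h j ((normRowSum s j X - α) / ξ)).re) (Measure.pi fun _ => μ) := by
  have h1 : Integrable (fun X : Fin n → ℝ => Real.exp (α * ∑ j, normRowSum s j X))
      (Measure.pi fun _ => μ) := by
    have := (integrable_tilt H hn s hα).re
    simpa only [RCLike.re_to_complex, Complex.exp_ofReal_re] using this
  refine h1.mul_bdd (c := 1) ?_ (Eventually.of_forall fun X => ?_)
  · refine Measurable.aestronglyMeasurable (Finset.measurable_prod _ fun j _ => ?_)
    exact Complex.measurable_re.comp ((h j).continuous.measurable.comp
      (((measurable_normRowSum s j).sub_const _).div_const _))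
  · rw [Real.norm_of_nonneg (Finset.prod_nonneg fun j _ => (hh j).nonneg _)]
    exact Finset.prod_le_one (fun j _ => (hh j).nonneg _) fun j _ => (hh j).le_one _

theorem ofReal_tiltedIntegral (H : LaplaceBounds μ M C Q η) (hn : 0 < n) (s : Fin n → ι → ℤˣ)
    {α : ℝ} (hα : Fintype.card ι * |α| / Real.sqrt n ≤ η) {h : ι → 𝓢(ℝ, ℂ)} {c d : ι → ℝ} {ε : ℝ}
    (hh : ∀ j, IsCutoff (h j) (c j) (d j) ε) {ξ : ℝ} (hξ : 0 < ξ) :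
    (tiltedIntegral μ s α ξ h : ℂ) = ξ ^ Fintype.card ι * ∫ f : ι → ℝ, (∏ j, 𝓕 (h j) (ξ * f j)) *
        Complex.exp (-(2 * Real.pi * (α * (∑ j, f j : ℝ)) * Complex.I)) *
        ∏ i, laplace μ (columnArg n α (s i) f) := by
  rw [← integral_tilt_mul_prod H hn s hα h hξ, tiltedIntegral, ← integral_complex_ofReal]
  congr 1; ext X
  push_cast
  congr 1
  exact Finset.prod_congr rfl fun j _ => (hh j).ofReal_re _

/-- On the windows the tilt is the constant `e^{Kα²}` up to a factor tending to 1 when `|α| ξ → 0`.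
Tilted integrals can thereby be turned back into probabilities. -/
theorem sum_tilt_bounds {s : Fin n → ι → ℤˣ} {α ξ R : ℝ} {c d : ι → ℝ} {X : Fin n → ℝ} (hξ : 0 < ξ)
    (hc : ∀ j, |c j| ≤ R) (hd : ∀ j, |d j| ≤ R) (hX : X ∈ boxEvent s α ξ c d) :
    |α * ∑ j, normRowSum s j X - Fintype.card ι * α ^ 2| ≤ Fintype.card ι * (R * (|α| * ξ)) := by
  have h1 : α * ∑ j, normRowSum s j X - Fintype.card ι * α ^ 2 =
      ∑ j, α * (normRowSum s j X - α) := by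
    simp [Finset.mul_sum, mul_sub, Finset.sum_sub_distrib, sq]
  rw [h1]
  refine (Finset.abs_sum_le_sum_abs _ _).trans ?_
  rw [← nsmul_eq_mul, ← Finset.card_univ, ← Finset.sum_const]
  refine Finset.sum_le_sum fun j _ => ?_
  have h2 := hX j
  have h3 : |normRowSum s j X - α| ≤ R * ξ := by
    rw [abs_le]
    have h4 := abs_le.1 (hc j)
    have h5 := abs_le.1 (hd j)
    constructor <;> nlinarith [h2.1, h2.2]
  rw [abs_mul]
  calc |α| * |normRowSum s j X - α| ≤ |α| * (R * ξ) := by gcongr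
    _ = _ := by ring

theorem measureReal_boxEvent_mul_le (H : LaplaceBounds μ M C Q η) (hn : 0 < n)
    (s : Fin n → ι → ℤˣ) {α : ℝ} (hα : Fintype.card ι * |α| / Real.sqrt n ≤ η)
    {h : ι → 𝓢(ℝ, ℂ)} {c d : ι → ℝ} {ε : ℝ}
    (hh : ∀ j, IsCutoff (h j) (c j) (d j) ε) {ξ R : ℝ} (hξ : 0 < ξ) (hc : ∀ j, |c j| ≤ R)
    (hd : ∀ j, |d j| ≤ R) :
    (Measure.pi fun _ : Fin n => μ).real (boxEvent s α ξ c d) *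
      Real.exp (Fintype.card ι * α ^ 2 - Fintype.card ι * (R * (|α| * ξ))) ≤
      tiltedIntegral μ s α ξ h := by
  have := H.prob
  have h1 : (Measure.pi fun _ : Fin n => μ).real (boxEvent s α ξ c d) *
      Real.exp (Fintype.card ι * α ^ 2 - Fintype.card ι * (R * (|α| * ξ))) =
      ∫ X, (boxEvent s α ξ c d).indicator (fun _ => Real.exp (Fintype.card ι * α ^ 2 -
        Fintype.card ι * (R * (|α| * ξ)))) X ∂(Measure.pi fun _ : Fin n => μ) := by
    rw [integral_indicator (measurableSet_boxEvent s α ξ c d), setIntegral_const, smul_eq_mul]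
  rw [h1]
  refine integral_mono ((integrable_const _).indicator (measurableSet_boxEvent s α ξ c d))
    (integrable_tilt_mul_prod H hn s hα hh ξ) fun X => ?_
  by_cases hX : X ∈ boxEvent s α ξ c d
  · rw [indicator_of_mem hX]
    have h2 : ∏ j, (h j ((normRowSum s j X - α) / ξ)).re = 1 := by
      refine Finset.prod_eq_one fun j _ => (hh j).eq_one _ ?_
      have := hX j
      exact ⟨by rw [le_div_iff₀ hξ]; linarith [this.1], by rw [div_le_iff₀ hξ]; linarith [this.2]⟩
    simp only [h2, mul_one]
    refine Real.exp_le_exp.2 ?_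
    linarith [(abs_le.1 (sum_tilt_bounds hξ hc hd hX)).1]
  · rw [indicator_of_notMem hX]
    exact mul_nonneg (Real.exp_pos _).le (Finset.prod_nonneg fun j _ => (hh j).nonneg _)

/-- Here the cutoffs, collars included, are supported inside the windows, so they bound the
probability from below; cutoffs equal to one on the windows give the opposite bound. -/
theorem tiltedIntegral_le (H : LaplaceBounds μ M C Q η) (hn : 0 < n)
    (s : Fin n → ι → ℤˣ) {α : ℝ} (hα : Fintype.card ι * |α| / Real.sqrt n ≤ η)
    {h : ι → 𝓢(ℝ, ℂ)} {c d c' d' : ι → ℝ} {ε : ℝ}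
    (hh : ∀ j, IsCutoff (h j) (c' j) (d' j) ε) (hc' : ∀ j, c j ≤ c' j - ε)
    (hd' : ∀ j, d' j + ε ≤ d j) {ξ R : ℝ} (hξ : 0 < ξ) (hc : ∀ j, |c j| ≤ R)
    (hd : ∀ j, |d j| ≤ R) :
    tiltedIntegral μ s α ξ h ≤ (Measure.pi fun _ : Fin n => μ).real (boxEvent s α ξ c d) *
      Real.exp (Fintype.card ι * α ^ 2 + Fintype.card ι * (R * (|α| * ξ))) := by
  have := H.prob
  have h1 : (Measure.pi fun _ : Fin n => μ).real (boxEvent s α ξ c d) *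
      Real.exp (Fintype.card ι * α ^ 2 + Fintype.card ι * (R * (|α| * ξ))) =
      ∫ X, (boxEvent s α ξ c d).indicator (fun _ => Real.exp (Fintype.card ι * α ^ 2 +
        Fintype.card ι * (R * (|α| * ξ)))) X ∂(Measure.pi fun _ : Fin n => μ) := by
    rw [integral_indicator (measurableSet_boxEvent s α ξ c d), setIntegral_const, smul_eq_mul]
  rw [h1]
  refine integral_mono (integrable_tilt_mul_prod H hn s hα hh ξ)
    ((integrable_const _).indicator (measurableSet_boxEvent s α ξ c d)) fun X => ?_
  by_cases hX : X ∈ boxEvent s α ξ c d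
  · rw [indicator_of_mem hX]
    have h2 : ∏ j, (h j ((normRowSum s j X - α) / ξ)).re ≤ 1 :=
      Finset.prod_le_one (fun j _ => (hh j).nonneg _) fun j _ => (hh j).le_one _
    refine (mul_le_of_le_one_right (Real.exp_pos _).le h2).trans (Real.exp_le_exp.2 ?_)
    linarith [(abs_le.1 (sum_tilt_bounds hξ hc hd hX)).2]
  · rw [indicator_of_notMem hX]
    obtain ⟨j, hj⟩ : ∃ j, normRowSum s j X ∉ Icc (α + c j * ξ) (α + d j * ξ) := by
      simpa [boxEvent] using hX
    have h3 : (h j ((normRowSum s j X - α) / ξ)).re = 0 := by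
      refine (hh j).eq_zero _ fun h4 => hj ?_
      have h5 := (hc' j).trans h4.1
      have h6 := h4.2.trans (hd' j)
      rw [le_div_iff₀ hξ] at h5
      rw [div_le_iff₀ hξ] at h6
      exact ⟨by linarith, by linarith⟩
    simp only
    rw [Finset.prod_eq_zero (Finset.mem_univ j) h3, mul_zero]

/-- Integrability of the transform, with the Gaussian and the exponentially small contributions. -/
theorem LaplaceBounds.exists_integral_transform_le [DecidableEq ι] (H : LaplaceBounds μ M C Q η)
    {w : ι → ι → ℤˣ} (hw : (signMatrix w).det ≠ 0) {δ : ℝ} (hδ : 0 < δ) :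
    ∃ B τ : ℝ, 0 < B ∧ 0 < τ ∧ τ ≤ η ∧ ∃ n₀ : ℕ, ∀ n : ℕ, n₀ ≤ n → ∀ (α : ℝ) (s : Fin n → ι → ℤˣ),
      α ^ 4 ≤ n → Fintype.card ι * |α| / Real.sqrt n ≤ τ → IsBalanced δ s →
      Integrable (fun f : ι → ℝ => ∏ i, ‖laplace μ (columnArg n α (s i) f)‖) ∧
        ∫ f : ι → ℝ, ∏ i, ‖laplace μ (columnArg n α (s i) f)‖ ≤
          B * Real.exp (α ^ 2 * meanSqColSum s / 2) := by
  obtain ⟨ε, κ, τ, hε, hκ0, hκ1, hτ, hτη, hb⟩ := H.exists_transform_bound hw δ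
  have hlim := tendsto_geometric_mul_sqrt_pow hκ0 hκ1 hδ M (Fintype.card ι) Q
  have hceil : ∀ᶠ n : ℕ in atTop, M ≤ ⌈δ * n⌉₊ := by
    have : Tendsto (fun n : ℕ => ⌈δ * (n : ℝ)⌉₊) atTop atTop :=
      tendsto_nat_ceil_atTop.comp (tendsto_natCast_atTop_atTop.const_mul_atTop hδ)
    exact this.eventually_ge_atTop M
  obtain ⟨n₀, hn₀⟩ := eventually_atTop.1 ((hlim.eventually (ge_mem_nhds one_pos)).and
    (hceil.and (eventually_gt_atTop 0)))
  set E := Real.exp (2 * C * (Fintype.card ι : ℝ) ^ 4) with hE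
  set G := ∫ f : ι → ℝ, Real.exp (-(δ * ∑ j, f j ^ 2)) with hG
  have hG0 : 0 ≤ G := integral_nonneg fun f => (Real.exp_pos _).le
  refine ⟨E * (G + 1), τ, by positivity, hτ, hτη, n₀, fun n hn α s hα hατ hs => ?_⟩
  obtain ⟨h1, h2, hn0⟩ := hn₀ n hn
  set A := Real.exp (α ^ 2 * meanSqColSum s / 2 + 2 * C * (Fintype.card ι : ℝ) ^ 4) with hA
  have hintg := integrable_prod_norm_laplace_pow H hn0 (hατ.trans hτη) hw
  have hgauss : Integrable fun f : ι → ℝ => Real.exp (-(δ * ∑ j, f j ^ 2)) :=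
    integrable_exp_neg_mul_sum_sq hδ
  have hle : ∀ f : ι → ℝ, ∏ i, ‖laplace μ (columnArg n α (s i) f)‖ ≤
      A * (Real.exp (-(δ * ∑ j, f j ^ 2)) +
        κ ^ (⌈δ * n⌉₊ - M) * ∏ k, ‖laplace μ (columnArg n α (w k) f)‖ ^ M) := by
    intro f
    have hp1 := Real.exp_pos (-(δ * ∑ j, f j ^ 2))
    have hp2 : 0 ≤ κ ^ (⌈δ * n⌉₊ - M) * ∏ k, ‖laplace μ (columnArg n α (w k) f)‖ ^ M := by
      positivity
    have hA0 : 0 < A := Real.exp_pos _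
    rcases le_total (∑ j, |f j|) (ε * Real.sqrt n) with hf | hf
    · exact ((hb n α s hn0 hα hατ hs h2 f).1 hf).trans
        (mul_le_mul_of_nonneg_left (le_add_of_nonneg_right hp2) hA0.le)
    · exact ((hb n α s hn0 hα hατ hs h2 f).2 hf).trans
        (mul_le_mul_of_nonneg_left (le_add_of_nonneg_left hp1.le) hA0.le)
  have hint2 := (hgauss.add (hintg.1.const_mul (κ ^ (⌈δ * n⌉₊ - M)))).const_mul A
  have hcont : Continuous fun f : ι → ℝ => ∏ i, ‖laplace μ (columnArg n α (s i) f)‖ := by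
    simpa only [norm_prod] using (continuous_prod_laplace H hn0 (hατ.trans hτη) s).norm
  have hint3 : Integrable (fun f : ι → ℝ => ∏ i, ‖laplace μ (columnArg n α (s i) f)‖) := by
    refine hint2.mono' hcont.aestronglyMeasurable (Eventually.of_forall fun f => ?_)
    rw [Real.norm_of_nonneg (by positivity)]
    exact hle f
  refine ⟨hint3, ?_⟩
  refine (integral_mono hint3 hint2 hle).trans ?_
  have h3 : ∫ f : ι → ℝ, A * (Real.exp (-(δ * ∑ j, f j ^ 2)) +
        κ ^ (⌈δ * n⌉₊ - M) * ∏ k, ‖laplace μ (columnArg n α (w k) f)‖ ^ M) =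
      A * (G + κ ^ (⌈δ * n⌉₊ - M) * ∫ f : ι → ℝ, ∏ k, ‖laplace μ (columnArg n α (w k) f)‖ ^ M) := by
    rw [integral_const_mul, integral_add hgauss (hintg.1.const_mul _), integral_const_mul]
  refine (le_of_eq h3).trans ?_
  have h4 : κ ^ (⌈δ * n⌉₊ - M) * ∫ f : ι → ℝ, ∏ k, ‖laplace μ (columnArg n α (w k) f)‖ ^ M ≤ 1 :=
    (mul_le_mul_of_nonneg_left hintg.2 (by positivity)).trans h1
  calc _ ≤ A * (G + 1) := by gcongr
    _ = _ := by rw [hA, Real.exp_add]; ring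

/-- A uniform upper bound for the probability of the windows when all column types are frequent. -/
theorem LaplaceBounds.exists_measureReal_boxEvent_le [DecidableEq ι] (H : LaplaceBounds μ M C Q η)
    {w : ι → ι → ℤˣ} (hw : (signMatrix w).det ≠ 0) {δ : ℝ} (hδ : 0 < δ) {c d : ι → ℝ}
    (hcd : ∀ j, c j < d j) :
    ∃ B τ : ℝ, 0 < B ∧ 0 < τ ∧ ∃ n₀ : ℕ, ∀ n : ℕ, n₀ ≤ n → ∀ (α ξ : ℝ) (s : Fin n → ι → ℤˣ),
      α ^ 4 ≤ n → Fintype.card ι * |α| / Real.sqrt n ≤ τ → 0 < ξ → |α| * ξ ≤ 1 → IsBalanced δ s →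
      (Measure.pi fun _ : Fin n => μ).real (boxEvent s α ξ c d) ≤
        B * (ξ * Real.exp (-(α ^ 2 / 2))) ^ Fintype.card ι *
          Real.exp (α ^ 2 * (meanSqColSum s - Fintype.card ι) / 2) := by
  obtain ⟨B, τ, hB, hτ, hτη, n₀, hb⟩ := H.exists_integral_transform_le hw hδ
  choose h hh using fun j => exists_isCutoff (hcd j) one_pos
  set R : ℝ := ∑ j, (|c j| + |d j|) with hR
  have hcR : ∀ j, |c j| ≤ R := fun j =>
    (le_add_of_nonneg_right (abs_nonneg (d j))).trans
      (Finset.single_le_sum (f := fun j => |c j| + |d j|) (fun _ _ => by positivity)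
        (Finset.mem_univ j))
  have hdR : ∀ j, |d j| ≤ R := fun j =>
    (le_add_of_nonneg_left (abs_nonneg (c j))).trans
      (Finset.single_le_sum (f := fun j => |c j| + |d j|) (fun _ _ => by positivity)
        (Finset.mem_univ j))
  have hR0 : 0 ≤ R := Finset.sum_nonneg fun _ _ => by positivity
  set K := Fintype.card ι with hK
  set D : ℝ := ∏ j, ∫ x, (h j x).re with hD
  have hD0 : 0 < D := Finset.prod_pos fun j _ =>
    (sub_pos.2 (hcd j)).trans_le ((hh j).le_integral (hcd j))
  refine ⟨Real.exp (K * R) * D * B, τ, by positivity, hτ, max n₀ 1,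
    fun n hn α ξ s hα hατ hξ hαξ hs => ?_⟩
  have hn0 : 0 < n := (le_max_right _ _).trans hn
  obtain ⟨hintg, hle⟩ := hb n ((le_max_left _ _).trans hn) α s hα hατ hs
  have h1 := measureReal_boxEvent_mul_le H hn0 s (hατ.trans hτη) hh hξ hcR hdR
  have h2 : tiltedIntegral μ s α ξ h ≤ ξ ^ K * (D * (B * Real.exp (α ^ 2 * meanSqColSum s / 2))) := by
    have h3 : tiltedIntegral μ s α ξ h ≤ ‖(tiltedIntegral μ s α ξ h : ℂ)‖ := by
      rw [Complex.norm_real]; exact le_abs_self _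
    refine h3.trans ?_
    rw [ofReal_tiltedIntegral H hn0 s (hατ.trans hτη) hh hξ, norm_mul, norm_pow, Complex.norm_real,
      Real.norm_of_nonneg hξ.le]
    gcongr
    refine (norm_integral_le_integral_norm _).trans ?_
    refine le_trans ?_ (mul_le_mul_of_nonneg_left hle hD0.le)
    rw [← integral_const_mul]
    refine integral_mono_of_nonneg (Eventually.of_forall fun f => norm_nonneg _)
      (hintg.const_mul D) (Eventually.of_forall fun f => ?_)
    simp only
    rw [norm_mul, norm_mul, norm_prod, norm_prod]
    have h4 : ‖Complex.exp (-(2 * Real.pi * (α * (∑ j, f j : ℝ)) * Complex.I))‖ = 1 := by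
      rw [Complex.norm_exp]; simp
    rw [h4, mul_one]
    gcongr
    exact Finset.prod_le_prod (fun _ _ => norm_nonneg _) fun j _ => (hh j).norm_fourier_le _
  have h5 : (Measure.pi fun _ : Fin n => μ).real (boxEvent s α ξ c d) * Real.exp (K * α ^ 2 - K * R) ≤
      ξ ^ K * (D * (B * Real.exp (α ^ 2 * meanSqColSum s / 2))) := by
    refine le_trans ?_ (h1.trans h2)
    gcongr
    nlinarith
  rw [← le_div_iff₀ (Real.exp_pos _)] at h5
  refine h5.trans (le_of_eq ?_)
  rw [mul_pow, ← Real.exp_nat_mul, div_eq_mul_inv, ← Real.exp_neg]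
  -- Removing the tilt costs `e^{-Kα²}`: one half of the exponent supplies the Gaussian weights
  -- `e^{-α²/2}` of the `K` rows, the other half centres `meanSqColSum` at `K`, its value for
  -- orthogonal rows.
  have h6 : Real.exp (α ^ 2 * meanSqColSum s / 2) * Real.exp (-(K * α ^ 2 - K * R)) =
      Real.exp (K * R) * (Real.exp (K * -(α ^ 2 / 2)) * Real.exp (α ^ 2 * (meanSqColSum s - K) / 2)) := by
    rw [← Real.exp_add, ← Real.exp_add, ← Real.exp_add]; congr 1; ring
  linear_combination (ξ ^ K * D * B) * h6

variable {ι : Type*} [Fintype ι] {μ : Measure ℝ} {M : ℕ} {C Q η : ℝ}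
variable {β : Type*} {l : Filter β} {N : β → ℕ} {s : ∀ b, Fin (N b) → ι → ℤˣ} {α ξ θ : β → ℝ}

/-- The asymptotic regime of the local limit theorem. -/
structure LimitRegime (l : Filter β) (N : β → ℕ) (α ξ : β → ℝ) : Prop where
  tendsto_N : Tendsto N l atTop
  tendsto_α : Tendsto (fun b => α b ^ 4 / N b) l (𝓝 0)
  ξ_pos : ∀ᶠ b in l, 0 < ξ b
  tendsto_ξ : Tendsto ξ l (𝓝 0)
  tendsto_αξ : Tendsto (fun b => |α b| * ξ b) l (𝓝 0)

theorem LimitRegime.eventually_pow_le (R : LimitRegime l N α ξ) : ∀ᶠ b in l, α b ^ 4 ≤ N b := by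
  filter_upwards [R.tendsto_α.eventually (ge_mem_nhds one_pos),
    R.tendsto_N.eventually_gt_atTop 0] with b h1 h2
  have h2' : (0 : ℝ) < N b := by exact_mod_cast h2
  rwa [div_le_one h2'] at h1

theorem LimitRegime.eventually_tilt_le (R : LimitRegime l N α ξ) (K : ℝ) {τ : ℝ} (hτ : 0 < τ)
    : ∀ᶠ b in l, K * |α b| / Real.sqrt (N b) ≤ τ := by
  have h0 : Tendsto (fun b => K ^ 4 * (α b ^ 4 / N b) * (N b : ℝ)⁻¹) l (𝓝 0) := by
    have h1 : Tendsto (fun b => (N b : ℝ)⁻¹) l (𝓝 0) :=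
      tendsto_inv_atTop_zero.comp (tendsto_natCast_atTop_atTop.comp R.tendsto_N)
    simpa using (R.tendsto_α.const_mul (K ^ 4)).mul h1
  filter_upwards [h0.eventually (ge_mem_nhds (show (0 : ℝ) < τ ^ 4 by positivity)),
    R.tendsto_N.eventually_gt_atTop 0] with b h1 h2
  have h2' : (0 : ℝ) < N b := by exact_mod_cast h2
  have h3 : (K * |α b| / Real.sqrt (N b)) ^ 4 = K ^ 4 * (α b ^ 4 / N b) * (N b : ℝ)⁻¹ := by
    rw [div_pow, mul_pow, ← abs_pow, abs_of_nonneg (by positivity : 0 ≤ α b ^ 4),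
      show Real.sqrt (N b) ^ 4 = N b * N b by
        rw [show 4 = 2 * 2 by norm_num, pow_mul, Real.sq_sqrt h2'.le, sq]]
    field_simp
  rw [← h3] at h1
  exact le_of_pow_le_pow_left₀ (by norm_num) hτ.le h1

/-- Where `∑ |f j| ≤ ε₀ √N`, dominated convergence with a Gaussian majorant applies, and `𝓕 (h j) (ξ
f j)` tends to the integral of `h j` because `ξ → 0`. The complementary region contributes `O(κ^{δN
- M} (√N Q)^K)`. -/
theorem tendsto_integral_transform [DecidableEq ι] [l.IsCountablyGenerated]
    (H : LaplaceBounds μ M C Q η) (R : LimitRegime l N α ξ)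
    {w : ι → ι → ℤˣ} (hw : (signMatrix w).det ≠ 0) {δ : ℝ} (hδ : 0 < δ)
    (hθ0 : ∀ b, 0 ≤ θ b) (hθ : Tendsto (fun b => (1 + α b ^ 2) * θ b) l (𝓝 0))
    (hov : ∀ᶠ b in l, ∀ j k, j ≠ k → |overlap (s b) j k| ≤ θ b)
    (hbal : ∀ᶠ b in l, IsBalanced δ (s b))
    {h : ι → 𝓢(ℝ, ℂ)} {c d : ι → ℝ} {ε : ℝ} (hh : ∀ j, IsCutoff (h j) (c j) (d j) ε) :
    Tendsto (fun b => ∫ f : ι → ℝ, (∏ j, 𝓕 (h j) (ξ b * f j)) *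
        (Complex.exp (-(2 * Real.pi * (α b * (∑ j, f j : ℝ)) * Complex.I)) *
        (Complex.exp (-(Fintype.card ι * α b ^ 2 / 2)) *
        ∏ i, laplace μ (columnArg (N b) (α b) (s b i) f)))) l
      (𝓝 (((∏ j, ∫ x, (h j x).re) * (Real.sqrt (2 * Real.pi))⁻¹ ^ Fintype.card ι : ℝ) : ℂ)) := by
  obtain ⟨ε₀, κ, τ, hε₀, hκ0, hκ1, hτ, hτη, hb⟩ := H.exists_transform_bound hw δ
  set K := Fintype.card ι with hK
  set D : ℝ := ∏ j, ∫ x, (h j x).re with hD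
  have hD0 : 0 ≤ D := Finset.prod_nonneg fun j _ => integral_nonneg fun x => (hh j).nonneg x
  set Φ : β → (ι → ℝ) → ℂ := fun b f => (∏ j, 𝓕 (h j) (ξ b * f j)) *
        (Complex.exp (-(2 * Real.pi * (α b * (∑ j, f j : ℝ)) * Complex.I)) *
        (Complex.exp (-(K * α b ^ 2 / 2)) *
        ∏ i, laplace μ (columnArg (N b) (α b) (s b i) f))) with hΦ
  set A := Real.exp ((K : ℝ) ^ 2 / 2 + 2 * C * (K : ℝ) ^ 4) with hA
  set S : β → Set (ι → ℝ) := fun b => {f | ∑ j, |f j| ≤ ε₀ * Real.sqrt (N b)} with hS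
  have hSm : ∀ b, MeasurableSet (S b) := fun b =>
    (isClosed_le (by fun_prop) continuous_const).measurableSet
  have hceil : ∀ᶠ b in l, M ≤ ⌈δ * N b⌉₊ := by
    have h1 : Tendsto (fun b => ⌈δ * (N b : ℝ)⌉₊) l atTop :=
      tendsto_nat_ceil_atTop.comp ((tendsto_natCast_atTop_atTop.comp R.tendsto_N).const_mul_atTop hδ)
    exact h1.eventually_ge_atTop M
  -- Small overlaps give `meanSqColSum ≤ K + K² θ`, and eventually `α² θ ≤ 1`; hence the exponential
  -- growth in `α` cancels up to the constant `A`.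
  have hexp : ∀ᶠ b in l, Real.exp (-(K * α b ^ 2 / 2)) *
      Real.exp (α b ^ 2 * meanSqColSum (s b) / 2 + 2 * C * (K : ℝ) ^ 4) ≤ A := by
    filter_upwards [hov, hθ.eventually (ge_mem_nhds one_pos), R.tendsto_N.eventually_gt_atTop 0]
      with b h1 h2 h3
    rw [← Real.exp_add]
    refine Real.exp_le_exp.2 ?_
    have h4 := meanSqColSum_le h3 (s b) (hθ0 b) h1
    have h5 : α b ^ 2 * meanSqColSum (s b) ≤ α b ^ 2 * (K + (K : ℝ) ^ 2 * θ b) := by gcongr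
    have h6 : α b ^ 2 * θ b ≤ 1 := by nlinarith [hθ0 b]
    have h7 : (K : ℝ) ^ 2 * (α b ^ 2 * θ b) ≤ (K : ℝ) ^ 2 * 1 := by gcongr
    nlinarith
  have hΦle : ∀ b f, ‖Φ b f‖ ≤ D * (Real.exp (-(K * α b ^ 2 / 2)) *
      ∏ i, ‖laplace μ (columnArg (N b) (α b) (s b i) f)‖) := by
    intro b f
    have h4 : ‖Complex.exp (-(2 * Real.pi * (α b * (∑ j, f j : ℝ)) * Complex.I))‖ = 1 := by
      rw [Complex.norm_exp]; simp
    have h5 : ‖Complex.exp (-(K * (α b : ℂ) ^ 2 / 2))‖ = Real.exp (-(K * α b ^ 2 / 2)) := by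
      rw [← Complex.norm_exp_ofReal]; push_cast; rfl
    simp only [hΦ]
    rw [norm_mul, norm_mul, norm_mul, norm_prod, norm_prod, h4, h5, one_mul]
    gcongr
    exact Finset.prod_le_prod (fun _ _ => norm_nonneg _) fun j _ => (hh j).norm_fourier_le _
  have hΦcont : ∀ᶠ b in l, Continuous (Φ b) := by
    filter_upwards [R.eventually_tilt_le K hτ, R.tendsto_N.eventually_gt_atTop 0] with b h1 h2
    have h3 := continuous_prod_laplace H h2 (h1.trans hτη) (s b)
    have h4 : Continuous fun f : ι → ℝ => ∏ j, 𝓕 (h j) (ξ b * f j) :=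
      continuous_finsetProd _ fun j _ => (𝓕 (h j)).continuous.comp (by fun_prop)
    refine h4.mul (Continuous.mul (by fun_prop) (continuous_const.mul h3))
  have hin : Tendsto (fun b => ∫ f, (S b).indicator (Φ b) f) l
      (𝓝 (∫ f : ι → ℝ, (D : ℂ) * (Real.exp (-(2 * Real.pi ^ 2) * ∑ j, f j ^ 2) : ℝ))) := by
    refine tendsto_integral_filter_of_dominated_convergence
      (fun f => D * (A * Real.exp (-(δ * ∑ j, f j ^ 2)))) ?_ ?_ ?_ ?_
    · filter_upwards [hΦcont] with b h1
      exact h1.aestronglyMeasurable.indicator (hSm b)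
    · filter_upwards [hexp, hbal, hceil, R.eventually_pow_le, R.eventually_tilt_le K hτ,
        R.tendsto_N.eventually_gt_atTop 0] with b h1 h2 h3 h4 h5 h6
      refine Eventually.of_forall fun f => ?_
      by_cases hf : f ∈ S b
      · rw [indicator_of_mem hf]
        refine (hΦle b f).trans (mul_le_mul_of_nonneg_left ?_ hD0)
        have h7 := (hb (N b) (α b) (s b) h6 h4 h5 h2 h3 f).1 hf
        calc _ ≤ Real.exp (-(K * α b ^ 2 / 2)) *
              (Real.exp (α b ^ 2 * meanSqColSum (s b) / 2 + 2 * C * (K : ℝ) ^ 4) *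
                Real.exp (-(δ * ∑ j, f j ^ 2))) := by gcongr
          _ ≤ _ := by rw [← mul_assoc]; gcongr
      · rw [indicator_of_notMem hf, norm_zero]; positivity
    · exact ((integrable_exp_neg_mul_sum_sq hδ).const_mul A).const_mul D
    · refine Eventually.of_forall fun f => ?_
      have h1 := tendsto_prod_laplace (s := s) H R.tendsto_N R.tendsto_α hθ0 hθ hov f
      have h2 : Tendsto (fun b => ∏ j, 𝓕 (h j) (ξ b * f j)) l (𝓝 (D : ℂ)) := by
        have h3 : (D : ℂ) = ∏ j, 𝓕 (h j) (0 * f j) := by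
          rw [hD]; push_cast
          exact Finset.prod_congr rfl fun j _ => by rw [zero_mul, (hh j).fourier_zero]
        rw [h3]
        refine tendsto_finsetProd _ fun j _ => ?_
        exact ((𝓕 (h j)).continuous.tendsto _).comp (R.tendsto_ξ.mul_const _)
      refine (h2.mul h1).congr' ?_
      have h4 : Tendsto (fun b => ε₀ * Real.sqrt (N b)) l atTop :=
        (Real.tendsto_sqrt_atTop.comp
          (tendsto_natCast_atTop_atTop.comp R.tendsto_N)).const_mul_atTop hε₀
      filter_upwards [h4.eventually_ge_atTop (∑ j, |f j|)] with b h5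
      rw [indicator_of_mem (show f ∈ S b from h5)]
  have hout : Tendsto (fun b => ∫ f, (S b)ᶜ.indicator (Φ b) f) l (𝓝 0) := by
    have h0 := (((tendsto_geometric_mul_sqrt_pow hκ0 hκ1 hδ M K Q).comp R.tendsto_N).const_mul
      (D * A))
    rw [mul_zero] at h0
    refine squeeze_zero_norm' ?_ h0
    filter_upwards [hexp, hbal, hceil, R.eventually_pow_le, R.eventually_tilt_le K hτ,
        R.tendsto_N.eventually_gt_atTop 0] with b h1 h2 h3 h4 h5 h6
    have hintg := integrable_prod_norm_laplace_pow H h6 (h5.trans hτη) hw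
    have h8 : ∫ f, ‖(S b)ᶜ.indicator (Φ b) f‖ ≤ ∫ f, D * A * (κ ^ (⌈δ * N b⌉₊ - M) *
        ∏ k, ‖laplace μ (columnArg (N b) (α b) (w k) f)‖ ^ M) := by
      refine integral_mono_of_nonneg (Eventually.of_forall fun f => norm_nonneg _)
        ((hintg.1.const_mul _).const_mul _) (Eventually.of_forall fun f => ?_)
      by_cases hf : f ∈ (S b)ᶜ
      · simp only [indicator_of_mem hf]
        rw [mul_assoc D]
        refine (hΦle b f).trans (mul_le_mul_of_nonneg_left ?_ hD0)
        have h7 := (hb (N b) (α b) (s b) h6 h4 h5 h2 h3 f).2 (not_le.1 (show ¬∑ j, |f j| ≤ ε₀ * Real.sqrt (N b) from hf)).le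
        calc _ ≤ Real.exp (-(K * α b ^ 2 / 2)) *
              (Real.exp (α b ^ 2 * meanSqColSum (s b) / 2 + 2 * C * (K : ℝ) ^ 4) *
                (κ ^ (⌈δ * N b⌉₊ - M) *
                  ∏ k, ‖laplace μ (columnArg (N b) (α b) (w k) f)‖ ^ M)) := by gcongr
          _ ≤ _ := by rw [← mul_assoc]; gcongr
      · simp only [indicator_of_notMem hf, norm_zero]; positivity
    refine (norm_integral_le_integral_norm _).trans (h8.trans ?_)
    rw [integral_const_mul, integral_const_mul]
    simp only [Function.comp]
    gcongr
    exact hintg.2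
  have hintg : ∀ᶠ b in l, Integrable (Φ b) := by
    obtain ⟨B, τ', hB, hτ', hτ'η, n₀, h0⟩ := H.exists_integral_transform_le hw hδ
    filter_upwards [hbal, R.eventually_pow_le, R.eventually_tilt_le K hτ', hΦcont,
        R.tendsto_N.eventually_ge_atTop n₀] with b h2 h4 h5 h6 h7
    refine (((h0 (N b) h7 (α b) (s b) h4 h5 h2).1.const_mul
      (Real.exp (-(K * α b ^ 2 / 2)))).const_mul D).mono' h6.aestronglyMeasurable
      (Eventually.of_forall fun f => hΦle b f)
  have hlim : ∫ f : ι → ℝ, (D : ℂ) * (Real.exp (-(2 * Real.pi ^ 2) * ∑ j, f j ^ 2) : ℝ) =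
      ((D * (Real.sqrt (2 * Real.pi))⁻¹ ^ K : ℝ) : ℂ) := by
    rw [integral_const_mul, integral_complex_ofReal, integral_exp_neg_sum_sq]
    push_cast; rfl
  rw [← hlim]
  have h9 := hin.add hout
  rw [add_zero] at h9
  refine h9.congr' ?_
  filter_upwards [hintg] with b h1
  rw [integral_indicator (hSm b), integral_indicator (hSm b).compl, integral_add_compl (hSm b) h1]

theorem tendsto_tiltedIntegral [DecidableEq ι] [l.IsCountablyGenerated]
    (H : LaplaceBounds μ M C Q η) (R : LimitRegime l N α ξ)
    {w : ι → ι → ℤˣ} (hw : (signMatrix w).det ≠ 0) {δ : ℝ} (hδ : 0 < δ)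
    (hθ0 : ∀ b, 0 ≤ θ b) (hθ : Tendsto (fun b => (1 + α b ^ 2) * θ b) l (𝓝 0))
    (hov : ∀ᶠ b in l, ∀ j k, j ≠ k → |overlap (s b) j k| ≤ θ b)
    (hbal : ∀ᶠ b in l, IsBalanced δ (s b))
    {h : ι → 𝓢(ℝ, ℂ)} {c d : ι → ℝ} {ε : ℝ} (hh : ∀ j, IsCutoff (h j) (c j) (d j) ε) :
    Tendsto (fun b => tiltedIntegral μ (s b) (α b) (ξ b) h /
        (ξ b * Real.exp (α b ^ 2 / 2)) ^ Fintype.card ι) l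
      (𝓝 ((∏ j, ∫ x, (h j x).re) * (Real.sqrt (2 * Real.pi))⁻¹ ^ Fintype.card ι)) := by
  have h0 := tendsto_integral_transform H R hw hδ hθ0 hθ hov hbal hh
  have h1 := (Complex.continuous_re.tendsto _).comp h0
  rw [Complex.ofReal_re] at h1
  refine h1.congr' ?_
  filter_upwards [R.ξ_pos, R.eventually_tilt_le (Fintype.card ι) H.η_pos,
    R.tendsto_N.eventually_gt_atTop 0] with b h2 h3 h4
  have h5 := ofReal_tiltedIntegral H h4 (s b) h3 hh h2
  rw [Function.comp, ← Complex.ofReal_re (tiltedIntegral μ (s b) (α b) (ξ b) h / _)]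
  congr 1
  rw [Complex.ofReal_div, h5, mul_pow]
  push_cast
  have hξ : (ξ b : ℂ) ≠ 0 := by exact_mod_cast h2.ne'
  rw [mul_div_mul_left _ _ (pow_ne_zero _ hξ), ← Complex.exp_nat_mul, eq_div_iff (Complex.exp_ne_zero _),
    ← integral_mul_const]
  congr 1; ext f
  have h6 : Complex.exp (-(Fintype.card ι * (α b : ℂ) ^ 2 / 2)) *
      Complex.exp (Fintype.card ι * ((α b : ℂ) ^ 2 / 2)) = 1 := by
    rw [← Complex.exp_add, ← Complex.exp_zero]; congr 1; ring
  linear_combination ((∏ j, 𝓕 (h j) (ξ b * f j)) *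
    Complex.exp (-(2 * Real.pi * (α b * (∑ j, (f j : ℂ))) * Complex.I)) *
    ∏ i, laplace μ (columnArg (N b) (α b) (s b i) f)) * h6

section LocalLimit

variable {ι : Type*} [Fintype ι] {μ : Measure ℝ} {M : ℕ} {C Q η : ℝ}
variable {β : Type*} {l : Filter β} {N : β → ℕ} {s : ∀ b, Fin (N b) → ι → ℤˣ} {α ξ θ : β → ℝ}

theorem exists_abs_le_of_fintype (c d : ι → ℝ) :
    ∃ R : ℝ, 0 ≤ R ∧ (∀ j, |c j| ≤ R) ∧ ∀ j, |d j| ≤ R := by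
  refine ⟨∑ j, (|c j| + |d j|), Finset.sum_nonneg fun _ _ => by positivity, fun j => ?_, fun j => ?_⟩
  · exact (le_add_of_nonneg_right (abs_nonneg (d j))).trans
      (Finset.single_le_sum (f := fun j => |c j| + |d j|) (fun _ _ => by positivity)
        (Finset.mem_univ j))
  · exact (le_add_of_nonneg_left (abs_nonneg (c j))).trans
      (Finset.single_le_sum (f := fun j => |c j| + |d j|) (fun _ _ => by positivity)
        (Finset.mem_univ j))

/-- The local limit theorem for the normalized row sums of nearly orthogonal sign arrays. -/
theorem tendsto_measureReal_boxEvent [DecidableEq ι] [l.IsCountablyGenerated]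
    (H : LaplaceBounds μ M C Q η) (hR : LimitRegime l N α ξ)
    {w : ι → ι → ℤˣ} (hw : (signMatrix w).det ≠ 0) {δ : ℝ} (hδ : 0 < δ)
    (hθ0 : ∀ b, 0 ≤ θ b) (hθ : Tendsto (fun b => (1 + α b ^ 2) * θ b) l (𝓝 0))
    (hov : ∀ᶠ b in l, ∀ j k, j ≠ k → |overlap (s b) j k| ≤ θ b)
    (hbal : ∀ᶠ b in l, IsBalanced δ (s b)) {c d : ι → ℝ} (hcd : ∀ j, c j < d j) :
    Tendsto (fun b => (Measure.pi fun _ : Fin (N b) => μ).real (boxEvent (s b) (α b) (ξ b) c d) /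
        (ξ b * Real.exp (-(α b ^ 2 / 2))) ^ Fintype.card ι) l
      (𝓝 ((∏ j, (d j - c j)) * (Real.sqrt (2 * Real.pi))⁻¹ ^ Fintype.card ι)) := by
  set K := Fintype.card ι with hK
  obtain ⟨R, hR0, hcR, hdR⟩ := exists_abs_le_of_fintype c d
  set G : ℝ := (Real.sqrt (2 * Real.pi))⁻¹ ^ K with hG
  have hG0 : 0 < G := by positivity
  set E : β → ℝ := fun b => Real.exp (K * (R * (|α b| * ξ b))) with hE
  have hE1 : Tendsto E l (𝓝 1) := by
    have h1 := ((hR.tendsto_αξ.const_mul R).const_mul (K : ℝ))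
    rw [mul_zero, mul_zero] at h1
    simpa [hE, Function.comp_def] using (Real.continuous_exp.tendsto _).comp h1
  have hE0 : ∀ b, 0 < E b := fun b => Real.exp_pos _
  set W : β → ℝ := fun b => (ξ b * Real.exp (-(α b ^ 2 / 2))) ^ K with hW
  set V : β → ℝ := fun b => (ξ b * Real.exp (α b ^ 2 / 2)) ^ K with hV
  have hVW : ∀ b, V b = W b * Real.exp (K * α b ^ 2) := by
    intro b
    simp only [hV, hW, mul_pow, ← Real.exp_nat_mul]
    rw [mul_assoc, ← Real.exp_add]
    congr 2; ring
  have hWpos : ∀ᶠ b in l, 0 < W b := by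
    filter_upwards [hR.ξ_pos] with b hb
    positivity
  set P : β → ℝ := fun b => (Measure.pi fun _ : Fin (N b) => μ).real
    (boxEvent (s b) (α b) (ξ b) c d) with hP
  rw [tendsto_order]
  constructor
  · intro a ha
    -- Windows shrunk by `ε` at both ends leave room for collars of width `ε`, while the product of
    -- their lengths stays close to the original one.
    obtain ⟨ε, hε, hε1, hε2⟩ : ∃ ε : ℝ, 0 < ε ∧ (∀ j, c j + ε < d j - ε) ∧
        a < (∏ j, (d j - c j - 2 * ε)) * G := by
      have h1 : Tendsto (fun ε : ℝ => (∏ j, (d j - c j - 2 * ε)) * G) (𝓝[>] 0)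
          (𝓝 ((∏ j, (d j - c j)) * G)) := by
        have h2 : Continuous fun ε : ℝ => (∏ j, (d j - c j - 2 * ε)) * G := by fun_prop
        have h3 := h2.tendsto 0
        simp only [mul_zero, sub_zero] at h3
        exact h3.mono_left nhdsWithin_le_nhds
      have h4 : ∀ᶠ ε : ℝ in 𝓝[>] 0, ∀ j, c j + ε < d j - ε := by
        rw [eventually_all]
        intro j
        have h5 : ∀ᶠ ε : ℝ in 𝓝 0, ε < (d j - c j) / 2 := gt_mem_nhds (by linarith [hcd j])
        filter_upwards [nhdsWithin_le_nhds h5] with ε h6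
        linarith
      obtain ⟨ε, h5, h6, h7⟩ := ((h1.eventually (lt_mem_nhds ha)).and
        (h4.and self_mem_nhdsWithin)).exists
      exact ⟨ε, h7, h6, h5⟩
    choose h hh using fun j => exists_isCutoff (hε1 j) hε
    have hlim := (tendsto_tiltedIntegral H hR hw hδ hθ0 hθ hov hbal hh).div hE1 one_ne_zero
    have hlt : a < (∏ j, ∫ x, (h j x).re) * G / 1 := by
      rw [div_one]
      refine hε2.trans_le ?_
      gcongr with j
      · intro j _
        linarith [hε1 j]
      · have := (hh j).le_integral (hε1 j)
        linarith
    filter_upwards [hlim.eventually (lt_mem_nhds hlt), hWpos, hR.ξ_pos,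
      hR.eventually_tilt_le K H.η_pos, hR.tendsto_N.eventually_gt_atTop 0] with b h1 h2 h3 h4 h5
    refine h1.trans_le ?_
    have h6 := tiltedIntegral_le H h5 (s b) h4 hh (c := c) (d := d) (fun j => by linarith)
      (fun j => by linarith) h3 hcR hdR
    have h7 : tiltedIntegral μ (s b) (α b) (ξ b) h / V b / E b ≤ P b / W b := by
      rw [div_div, hVW, div_le_div_iff₀ (by have := hE0 b; positivity) h2]
      rw [Real.exp_add] at h6
      calc _ ≤ P b * (Real.exp (K * α b ^ 2) * E b) * W b := by gcongr
        _ = _ := by ring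
    exact h7
  · intro a ha
    obtain ⟨ε, hε, hε2⟩ : ∃ ε : ℝ, 0 < ε ∧ (∏ j, (d j - c j + 2 * ε)) * G < a := by
      have h1 : Tendsto (fun ε : ℝ => (∏ j, (d j - c j + 2 * ε)) * G) (𝓝[>] 0)
          (𝓝 ((∏ j, (d j - c j)) * G)) := by
        have h2 : Continuous fun ε : ℝ => (∏ j, (d j - c j + 2 * ε)) * G := by fun_prop
        have h3 := h2.tendsto 0
        simp only [mul_zero, add_zero] at h3
        exact h3.mono_left nhdsWithin_le_nhds
      obtain ⟨ε, h5, h7⟩ := ((h1.eventually (gt_mem_nhds ha)).and self_mem_nhdsWithin).exists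
      exact ⟨ε, h7, h5⟩
    choose h hh using fun j => exists_isCutoff (hcd j) hε
    have hlim := (tendsto_tiltedIntegral H hR hw hδ hθ0 hθ hov hbal hh).mul hE1
    have hlt : (∏ j, ∫ x, (h j x).re) * G * 1 < a := by
      rw [mul_one]
      refine lt_of_le_of_lt ?_ hε2
      gcongr with j
      · exact fun j _ => integral_nonneg fun x => (hh j).nonneg x
      · exact (hh j).integral_le (hcd j) hε
    filter_upwards [hlim.eventually (gt_mem_nhds hlt), hWpos, hR.ξ_pos,
      hR.eventually_tilt_le K H.η_pos, hR.tendsto_N.eventually_gt_atTop 0] with b h1 h2 h3 h4 h5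
    refine lt_of_le_of_lt ?_ h1
    have h6 := measureReal_boxEvent_mul_le H h5 (s b) h4 hh h3 hcR hdR
    have h7 : P b / W b ≤ tiltedIntegral μ (s b) (α b) (ξ b) h / V b * E b := by
      rw [sub_eq_add_neg, Real.exp_add, Real.exp_neg] at h6
      rw [hVW, div_mul_eq_mul_div, div_le_div_iff₀ h2 (by positivity)]
      have h8 : P b * Real.exp (K * α b ^ 2) ≤ tiltedIntegral μ (s b) (α b) (ξ b) h * E b := by
        rw [← div_le_iff₀ (hE0 b), div_eq_mul_inv, mul_assoc]
        exact h6
      calc _ = P b * Real.exp (K * α b ^ 2) * W b := by ring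
        _ ≤ _ := by gcongr
    exact h7

end LocalLimit

/-! ### Linear algebra of sign vectors and the rank of the frequent columns -/

section LinearAlgebra

variable {ι κ : Type*} [Fintype ι] [Fintype κ] [DecidableEq κ]

/-- A matrix with linearly independent columns has an invertible square submatrix consisting of
full rows. -/
theorem exists_det_ne_zero_of_linearIndependent {τ : Type*} (A : τ → κ → ℝ)
    (hA : LinearIndependent ℝ fun k => fun t => A t k) :
    ∃ w : κ → τ, (Matrix.of fun i k => A (w i) k).det ≠ 0 := by
  have hspan : Submodule.span ℝ (Set.range A) = ⊤ := by
    by_contra hne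
    obtain ⟨f, hf0, hf⟩ := Submodule.exists_le_ker_of_lt_top _ (lt_top_iff_ne_top.2 hne)
    apply hf0
    have h1 : ∀ t, ∑ k, f (Pi.single k 1) * A t k = 0 := by
      intro t
      have h2 : A t ∈ LinearMap.ker f := hf (Submodule.subset_span ⟨t, rfl⟩)
      rw [LinearMap.mem_ker] at h2
      rw [← h2]
      conv_rhs => rw [← LinearMap.sum_single_apply (φ := fun _ => ℝ) (A t), map_sum]
      refine Finset.sum_congr rfl fun k _ => ?_
      have : (Pi.single k (A t k) : κ → ℝ) = A t k • Pi.single k (1 : ℝ) := by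
        ext i
        by_cases h : i = k
        · subst h; simp
        · simp [h]
      rw [this, map_smul, smul_eq_mul, mul_comm]
    have h3 := Fintype.linearIndependent_iff.1 hA (fun k => f (Pi.single k 1)) (by
      ext t; simpa using h1 t)
    refine LinearMap.pi_ext' fun k => LinearMap.ext_ring ?_
    simpa using h3 k
  obtain ⟨b, hbs, hbspan, hbi⟩ := exists_linearIndependent ℝ (Set.range A)
  rw [hspan] at hbspan
  let B : Module.Basis b ℝ (κ → ℝ) := Module.Basis.mk hbi (by simpa using hbspan.ge)
  let e : b ≃ κ := B.indexEquiv (Pi.basisFun ℝ κ)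
  have hch : ∀ x : b, ∃ t, A t = x := fun x => hbs x.2
  choose t ht using hch
  refine ⟨fun k => t (e.symm k), ?_⟩
  have hli : LinearIndependent ℝ (Matrix.of fun i k => A (t (e.symm i)) k).row := by
    have h4 : (Matrix.of fun i k => A (t (e.symm i)) k).row = (fun x : b => (x : κ → ℝ)) ∘ e.symm := by
      ext i k; simp [Matrix.row, ht]
    rw [h4]
    exact hbi.comp _ e.symm.injective
  have h5 := (Matrix.linearIndependent_rows_iff_isUnit).1 hli
  exact ((Matrix.isUnit_iff_isUnit_det _).1 h5).ne_zero

/-- Comparing a linear relation at the all-ones vector and at the vector with coordinate `k` flipped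
isolates `2 * g k`. -/
theorem linearIndependent_sign_coord :
    LinearIndependent ℝ fun (k : κ) (v : κ → ℤˣ) => ((v k : ℤ) : ℝ) := by
  rw [Fintype.linearIndependent_iff]
  intro g hg k
  have h1 := congrFun hg 1
  have h2 := congrFun hg (Function.update 1 k (-1))
  simp only [Finset.sum_apply, Pi.smul_apply, smul_eq_mul, Pi.zero_apply] at h1 h2
  have h3 : ∑ i, g i * (((1 : κ → ℤˣ) i : ℤ) : ℝ) -
      ∑ i, g i * (((Function.update (1 : κ → ℤˣ) k (-1) i : ℤˣ) : ℤ) : ℝ) = 2 * g k := by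
    rw [← Finset.sum_sub_distrib, Finset.sum_eq_single k]
    · simp; ring
    · intro i _ hi; simp [hi]
    · simp
  rw [h1, h2] at h3
  linarith

theorem exists_signMatrix_det_ne_zero : ∃ w : κ → κ → ℤˣ, (signMatrix w).det ≠ 0 :=
  exists_det_ne_zero_of_linearIndependent _ linearIndependent_sign_coord

end LinearAlgebra

variable {ι : Type*} {T : Finset (ι → ℤˣ)} {J : Finset ι}

/-- Every coordinate is a fixed linear combination of those in `J`, so a vector of `T` is determined
by its restriction to `J`. This bounds the number of frequent types by `2 ^ J.card`. -/
theorem injOn_restrict_of_span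
    (hJ : ∀ j, ∃ a : J → ℝ, ∀ v ∈ T, ((v j : ℤ) : ℝ) = ∑ i : J, a i * ((v i : ℤ) : ℝ)) :
    Function.Injective fun (v : T) (i : J) => v.1 i := by
  intro v v' h
  refine Subtype.ext (funext fun j => ?_)
  obtain ⟨a, ha⟩ := hJ j
  have h1 : ((v.1 j : ℤ) : ℝ) = ((v'.1 j : ℤ) : ℝ) := by
    rw [ha v v.2, ha v' v'.2]
    exact Finset.sum_congr rfl fun i _ => by rw [show v.1 i = v'.1 i from congrFun h i]
  exact Units.ext (by exact_mod_cast h1)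

theorem card_le_two_pow_of_span
    (hJ : ∀ j, ∃ a : J → ℝ, ∀ v ∈ T, ((v j : ℤ) : ℝ) = ∑ i : J, a i * ((v i : ℤ) : ℝ)) :
    T.card ≤ 2 ^ J.card := by
  classical
  have h := Fintype.card_le_of_injective _ (injOn_restrict_of_span hJ)
  simpa using h

variable [Fintype ι]

/-- A linear functional taking only the values `±1` on the sign cube is a signed coordinate. -/
theorem exists_signDot_eq_coord (a : ι → ℝ)
    (h : ∀ v : ι → ℤˣ, ∃ e : ℤˣ, signDot v a = ((e : ℤ) : ℝ)) :
    ∃ (k : ι) (ε : ℤˣ), ∀ v : ι → ℤˣ, signDot v a = ((ε * v k : ℤˣ) : ℤ) := by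
  classical
  -- At the sign vector of `a` the functional equals `∑ |a j|`, so this sum is 1. Flipping
  -- coordinate `k` there lowers the value by `2 |a k|`; as values are `±1`, every `|a k|` is 0 or
  -- 1, and exactly one of them is 1.
  have h1 : ∑ j, |a j| = 1 := by
    obtain ⟨e, he⟩ := h (signVec a)
    rw [signDot_signVec] at he
    have h0 : 0 ≤ ∑ j, |a j| := Finset.sum_nonneg fun _ _ => abs_nonneg _
    rcases Int.units_eq_one_or e with rfl | rfl
    · simpa using he
    · rw [he] at h0; norm_num at h0
  have h2 : ∀ k, |a k| = 0 ∨ |a k| = 1 := by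
    intro k
    obtain ⟨e, he⟩ := h (Function.update (signVec a) k (-signVec a k))
    have h3 : signDot (signVec a) a - signDot (Function.update (signVec a) k (-signVec a k)) a =
        2 * (((signVec a k : ℤˣ) : ℤ) * a k) := by
      simp only [signDot]
      rw [← Finset.sum_sub_distrib, Finset.sum_eq_single k]
      · simp; ring
      · intro i _ hi; simp [hi]
      · simp
    have h4 : |(((signVec a k : ℤˣ) : ℤ) : ℝ) * a k| = |a k| := by
      rcases Int.units_eq_one_or (signVec a k) with h | h <;> simp [h]
    rw [signDot_signVec, h1, he] at h3
    rcases Int.units_eq_one_or e with rfl | rfl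
    · left
      rw [← h4]
      have : (((signVec a k : ℤˣ) : ℤ) : ℝ) * a k = 0 := by norm_num at h3; simpa using h3
      rw [this, abs_zero]
    · right
      rw [← h4]
      have : (((signVec a k : ℤˣ) : ℤ) : ℝ) * a k = 1 := by norm_num at h3; linarith
      rw [this, abs_one]
  obtain ⟨k, hk⟩ : ∃ k, |a k| = 1 := by
    by_contra hne
    push Not at hne
    have : ∑ j, |a j| = 0 := Finset.sum_eq_zero fun j _ => (h2 j).resolve_right (hne j)
    rw [this] at h1
    norm_num at h1
  have h5 : ∀ i, i ≠ k → a i = 0 := by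
    intro i hi
    rw [← Finset.add_sum_erase _ _ (Finset.mem_univ k), hk, add_eq_left] at h1
    have := (Finset.sum_eq_zero_iff_of_nonneg fun _ _ => abs_nonneg _).1 h1 i
      (Finset.mem_erase.2 ⟨hi, Finset.mem_univ i⟩)
    exact abs_eq_zero.1 this
  have h6 : ∀ v : ι → ℤˣ, signDot v a = ((v k : ℤ) : ℝ) * a k := by
    intro v
    refine Finset.sum_eq_single k (fun i _ hi => by rw [h5 i hi, mul_zero]) (by simp)
  rcases (abs_eq zero_le_one).1 hk with h | h
  · exact ⟨k, 1, fun v => by rw [h6, h]; simp⟩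
  · exact ⟨k, -1, fun v => by rw [h6, h]; simp⟩

/-- The coordinate functions on a set of sign vectors. -/
def signCoord (T : Finset (ι → ℤˣ)) (j : ι) (v : T) : ℝ := ((v.1 j : ℤ) : ℝ)

theorem exists_basis_signCoord (T : Finset (ι → ℤˣ)) :
    ∃ J : Finset ι, LinearIndependent ℝ (fun j : J => signCoord T j) ∧
      ∀ j, ∃ a : J → ℝ, ∀ v ∈ T, ((v j : ℤ) : ℝ) = ∑ i : J, a i * ((v i : ℤ) : ℝ) := by
  classical
  obtain ⟨κ, e, he, hspan, hli⟩ := exists_linearIndependent' ℝ (signCoord T)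
  have : Finite κ := Finite.of_injective e he
  have := Fintype.ofFinite κ
  set J : Finset ι := Finset.univ.image e with hJ
  let f : κ ≃ J := (Equiv.ofInjective e he).trans (Equiv.setCongr (by simp [hJ]))
  have hf : ∀ k, (f k : ι) = e k := fun k => rfl
  have hf' : ∀ j, e (f.symm j) = j := fun j => by rw [← hf, Equiv.apply_symm_apply]
  refine ⟨J, ?_, fun j => ?_⟩
  · have h1 : (fun j : J => signCoord T j) = (signCoord T ∘ e) ∘ f.symm := by
      ext j v; simp [hf']
    rw [h1]
    exact hli.comp _ f.symm.injective
  · have h1 : signCoord T j ∈ Submodule.span ℝ (Set.range (signCoord T ∘ e)) := by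
      rw [hspan]; exact Submodule.subset_span ⟨j, rfl⟩
    obtain ⟨a, ha⟩ := (Submodule.mem_span_range_iff_exists_fun ℝ).1 h1
    refine ⟨fun i => a (f.symm i), fun v hv => ?_⟩
    have h2 := congrFun ha ⟨v, hv⟩
    simp only [Finset.sum_apply, Pi.smul_apply, smul_eq_mul, Function.comp] at h2
    rw [← Equiv.sum_comp f.symm] at h2
    simpa [hf', signCoord] using h2.symm

/-- Equality of cardinalities means that the restrictions to `J` fill the whole cube. The functional
expressing coordinate `j` is then `±1`-valued on the cube, hence a signed coordinate. -/
theorem exists_row_eq_of_card_eq {ι : Type*} {T : Finset (ι → ℤˣ)} {J : Finset ι}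
    (hJ : ∀ j, ∃ a : J → ℝ, ∀ v ∈ T, ((v j : ℤ) : ℝ) = ∑ i : J, a i * ((v i : ℤ) : ℝ))
    (hT : T.card = 2 ^ J.card) {j : ι} (hj : j ∉ J) :
    ∃ i ≠ j, ∃ ε : ℤˣ, ∀ v ∈ T, v j = ε * v i := by
  classical
  have hbij : Function.Bijective fun (v : T) (i : J) => v.1 i :=
    (Fintype.bijective_iff_injective_and_card _).2 ⟨injOn_restrict_of_span hJ, by simpa using hT⟩
  obtain ⟨a, ha⟩ := hJ j
  have h1 : ∀ u : J → ℤˣ, ∃ e : ℤˣ, signDot u a = ((e : ℤ) : ℝ) := by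
    intro u
    obtain ⟨v, rfl⟩ := hbij.2 u
    refine ⟨v.1 j, ?_⟩
    rw [ha v v.2, signDot]
    exact Finset.sum_congr rfl fun i _ => mul_comm _ _
  obtain ⟨k, ε, hk⟩ := exists_signDot_eq_coord a h1
  refine ⟨k, fun h => hj (h ▸ k.2), ε, fun v hv => ?_⟩
  have h2 := hk fun i => v i
  have h3 : ((v j : ℤ) : ℝ) = ((ε * v k : ℤˣ) : ℤ) := by
    rw [← h2, ha v hv, signDot]
    exact Finset.sum_congr rfl fun i _ => mul_comm _ _
  exact Units.ext (by exact_mod_cast h3)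

theorem mem_of_card_eq (hT : T.card = 2 ^ J.card) (hJ : J = Finset.univ) (v : ι → ℤˣ) :
    v ∈ T := by
  classical
  suffices h : T = Finset.univ from h ▸ Finset.mem_univ v
  rw [← Finset.card_eq_iff_eq_univ, hT, hJ]
  simp

variable {μ : Measure ℝ}

/-- A linear combination of independent variables with a coefficient of modulus at least one is
at least as spread out as one of them. -/
theorem measureReal_sum_mem_Icc_le [IsProbabilityMeasure μ] {C β : ℝ} (hC : 0 < C)
    (hμ : ∀ a l : ℝ, 0 < l → μ.real (Icc a (a + l)) ≤ C * l ^ β)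
    {n : ℕ} (b : Fin n → ℝ) {k : Fin n} (hk : 1 ≤ |b k|) (a : ℝ) {l : ℝ} (hl : 0 < l) :
    (Measure.pi fun _ : Fin n => μ).real {X | ∑ i, b i * X i ∈ Icc a (a + l)} ≤ C * l ^ β := by
  obtain ⟨m, rfl⟩ : ∃ m, n = m + 1 := ⟨n - 1, by have := k.pos; omega⟩
  have hmp := measurePreserving_piFinSuccAbove (fun _ : Fin (m + 1) => μ) k
  set A : Set (ℝ × (Fin m → ℝ)) :=
    {p | b k * p.1 + ∑ i, b (k.succAbove i) * p.2 i ∈ Icc a (a + l)} with hA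
  have hAm : MeasurableSet A := by
    have : Continuous fun p : ℝ × (Fin m → ℝ) => b k * p.1 + ∑ i, b (k.succAbove i) * p.2 i := by
      fun_prop
    exact this.measurable measurableSet_Icc
  have hset : {X : Fin (m + 1) → ℝ | ∑ i, b i * X i ∈ Icc a (a + l)} =
      (MeasurableEquiv.piFinSuccAbove (fun _ : Fin (m + 1) => ℝ) k) ⁻¹' A := by
    ext X
    simp only [hA, mem_ofPred_eq, mem_preimage]
    rw [Fin.sum_univ_succAbove _ k]
    rfl
  rw [hset, measureReal_def, hmp.measure_preimage hAm.nullMeasurableSet, Measure.prod_apply_symm hAm]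
  -- With the other variables fixed, `X k` is confined to an interval of length `l / |b k| ≤ l`.
  have hsec : ∀ y : Fin m → ℝ, μ ((fun x => (x, y)) ⁻¹' A) ≤ ENNReal.ofReal (C * l ^ β) := by
    intro y
    have hbk : 0 < |b k| := one_pos.trans_le hk
    have hsub : ∃ a', (fun x => (x, y)) ⁻¹' A ⊆ Icc a' (a' + l) := by
      set t := ∑ i, b (k.succAbove i) * y i with ht
      rcases le_total 0 (b k) with hb | hb
      · rw [abs_of_nonneg hb] at hk hbk
        refine ⟨(a - t) / b k, fun x hx => ?_⟩
        obtain ⟨h1, h2⟩ : a ≤ b k * x + t ∧ b k * x + t ≤ a + l := hx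
        constructor
        · rw [div_le_iff₀ hbk]; linarith
        · have : x ≤ (a - t + l) / b k := by rw [le_div_iff₀ hbk]; linarith
          refine this.trans ?_
          rw [add_div]
          gcongr
          exact div_le_self hl.le hk
      · rw [abs_of_nonpos hb] at hk hbk
        refine ⟨(t - a - l) / (-b k), fun x hx => ?_⟩
        obtain ⟨h1, h2⟩ : a ≤ b k * x + t ∧ b k * x + t ≤ a + l := hx
        constructor
        · rw [div_le_iff₀ hbk]; linarith
        · have : x ≤ (t - a) / (-b k) := by rw [le_div_iff₀ hbk]; linarith
          refine this.trans ?_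
          rw [sub_div (t - a)]
          have := div_le_self hl.le hk
          linarith
    obtain ⟨a', ha'⟩ := hsub
    refine (measure_mono ha').trans ?_
    rw [← ofReal_measureReal]
    exact ENNReal.ofReal_le_ofReal (hμ a' l hl)
  refine ENNReal.toReal_le_of_le_ofReal (by positivity) ?_
  refine (lintegral_mono hsec).trans ?_
  simp

variable {n : ℕ} {ι : Type*}

theorem boxEvent_eq (hn : 0 < n) (s : Fin n → ι → ℤˣ) (α ξ : ℝ) (c d : ι → ℝ) :
    boxEvent s α ξ c d = {X | ∀ j, rowSum s j X ∈ Icc (α * Real.sqrt n + c j * (ξ * Real.sqrt n))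
      (α * Real.sqrt n + d j * (ξ * Real.sqrt n))} := by
  have hs0 : 0 < Real.sqrt n := Real.sqrt_pos.2 (by exact_mod_cast hn)
  ext X
  simp only [boxEvent, mem_ofPred_eq, normRowSum, mem_Icc, le_div_iff₀ hs0, div_le_iff₀ hs0]
  refine forall_congr' fun j => ?_
  rw [add_mul, add_mul, mul_assoc, mul_assoc]

variable [Fintype ι]

/-- The sign vectors occurring at least `M` times among the columns. -/
noncomputable def frequentTypes [DecidableEq ι] (M : ℕ) (s : Fin n → ι → ℤˣ) : Finset (ι → ℤˣ) :=
  Finset.univ.filter fun v => M ≤ colCount s v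

/-- The bound on the probability of the windows given by the rows that are independent on the
frequent columns, together with an event depending on the other columns only. -/
theorem measureReal_inter_boxEvent_le [DecidableEq ι] {M : ℕ} {C : ℝ} [IsProbabilityMeasure μ]
    (hintg : Integrable fun u : ℝ => ‖laplace μ (2 * Real.pi * u * Complex.I)‖ ^ M)
    (hC : ∫ u : ℝ, ‖laplace μ (2 * Real.pi * u * Complex.I)‖ ^ M ≤ C)
    (hn : 0 < n) (s : Fin n → ι → ℤˣ) {J : Finset ι}
    (hJ : LinearIndependent ℝ (fun j : J => signCoord (frequentTypes M s) j))
    {A : Set ({i // s i ∉ frequentTypes M s} → ℝ)} (hA : MeasurableSet A)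
    {α ξ : ℝ} (hξ : 0 < ξ) {c d : ι → ℝ} (hcd : ∀ j, c j < d j) :
    (Measure.pi fun _ : Fin n => μ).real
      ((fun X (i : {i // s i ∉ frequentTypes M s}) => X i) ⁻¹' A ∩ boxEvent s α ξ c d) ≤
      (ξ * Real.sqrt n) ^ J.card * ((∏ j : J, (d j - c j + 2)) *
        ((Measure.pi fun _ : Fin n => μ).real
          ((fun X (i : {i // s i ∉ frequentTypes M s}) => X i) ⁻¹' A) * C ^ J.card)) := by
  have hs0 : 0 < Real.sqrt n := Real.sqrt_pos.2 (by exact_mod_cast hn)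
  obtain ⟨w, hw⟩ := exists_det_ne_zero_of_linearIndependent
    (fun (v : frequentTypes M s) (j : J) => signCoord (frequentTypes M s) j v) hJ
  -- The rare columns carry the event `A`; the frequent ones supply `M` copies of each of the
  -- `J.card` independent types.
  have h1 := measureReal_inter_rowSum_box_le (κ := J) hintg hC (w := fun k j => (w k).1 j) hw
    (fun i j => s i j) (fun i => s i ∉ frequentTypes M s) (fun k => ?_) hA (α * Real.sqrt n)
    (r := ξ * Real.sqrt n) (by positivity) (fun j => hcd j)
  · rw [Fintype.card_coe] at h1
    refine le_trans (measureReal_mono ?_) h1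
    rw [boxEvent_eq hn]
    exact inter_subset_inter_right _ fun X hX j => hX j
  · have hk := (w k).2
    refine (Finset.mem_filter.1 hk).2.trans ?_
    rw [colCount]
    refine le_trans (Finset.card_le_card ?_) (Finset.card_image_le (f := Subtype.val))
    intro i hi
    have hi' := (Finset.mem_filter.1 hi).2
    refine Finset.mem_image.2 ⟨⟨i, not_not.2 (hi' ▸ hk)⟩, ?_, rfl⟩
    exact Finset.mem_filter.2 ⟨Finset.mem_univ _, by ext j; simp [hi']⟩

/-- The number of independent rows on the frequent columns controls both the number of frequent
types and the probability of the windows. -/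
theorem exists_measureReal_boxEvent_le_of_frequentTypes [DecidableEq ι] [IsProbabilityMeasure μ]
    {M : ℕ} (hintg : Integrable fun u : ℝ => ‖laplace μ (2 * Real.pi * u * Complex.I)‖ ^ M)
    {C₀ β : ℝ} (hC₀ : 0 < C₀)
    (hμ : ∀ a l : ℝ, 0 < l → μ.real (Icc a (a + l)) ≤ C₀ * l ^ β)
    {c d : ι → ℝ} (hc : ∀ j, 0 ≤ c j) (hcd : ∀ j, c j < d j) :
    ∃ B : ℝ, 0 < B ∧ ∀ (n : ℕ) (s : Fin n → ι → ℤˣ) (α ξ : ℝ), 0 < n → 0 < α → 0 < ξ →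
      Function.Injective (fun j i => s i j) →
      ((∀ v, v ∈ frequentTypes M s) ∧ (Measure.pi fun _ : Fin n => μ).real (boxEvent s α ξ c d) ≤
        B * (ξ * Real.sqrt n) ^ Fintype.card ι) ∨
      ∃ r ≤ Fintype.card ι, ((frequentTypes M s).card < 2 ^ r ∧
        (Measure.pi fun _ : Fin n => μ).real (boxEvent s α ξ c d) ≤ B * (ξ * Real.sqrt n) ^ r) ∨
        ((frequentTypes M s).card = 2 ^ r ∧
        (Measure.pi fun _ : Fin n => μ).real (boxEvent s α ξ c d) ≤
          B * ((ξ * Real.sqrt n) ^ r * (ξ * Real.sqrt n) ^ β)) := by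
  set C : ℝ := max 1 (∫ u : ℝ, ‖laplace μ (2 * Real.pi * u * Complex.I)‖ ^ M) with hCdef
  have hC1 : 1 ≤ C := le_max_left _ _
  set K := Fintype.card ι with hK
  set D : ℝ := ∏ j, (d j - c j + 2) with hD
  have hD1 : ∀ J : Finset ι, 0 < ∏ j : J, (d j - c j + 2) ∧ ∏ j : J, (d j - c j + 2) ≤ D := by
    intro J
    rw [Finset.prod_coe_sort J fun j => d j - c j + 2]
    refine ⟨Finset.prod_pos fun j _ => by linarith [hcd j], ?_⟩
    rw [hD, ← Finset.prod_mul_prod_compl J]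
    refine le_mul_of_one_le_right (Finset.prod_nonneg fun j _ => by linarith [hcd j]) ?_
    rw [← Finset.prod_const_one (s := Jᶜ)]
    exact Finset.prod_le_prod (fun _ _ => zero_le_one) fun j _ => by linarith [hcd j]
  have hD0 : 0 < D := Finset.prod_pos fun j _ => by linarith [hcd j]
  set R : ℝ := 1 + 2 * ∑ j, (d j - c j) with hR
  have hRj : ∀ j, d j - c j ≤ ∑ j, (d j - c j) := fun j =>
    Finset.single_le_sum (f := fun j => d j - c j) (fun j _ => by linarith [hcd j])
      (Finset.mem_univ j)
  have hR0 : 0 < R := by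
    have : 0 ≤ ∑ j, (d j - c j) := Finset.sum_nonneg fun j _ => by linarith [hcd j]
    linarith
  set P₁ : ℝ := C₀ * R ^ β with hP₁
  have hP₁0 : 0 < P₁ := by positivity
  refine ⟨D * C ^ K * (1 + P₁), by positivity, fun n s α ξ hn hα hξ hinj => ?_⟩
  have hs0 : 0 < Real.sqrt n := Real.sqrt_pos.2 (by exact_mod_cast hn)
  set y := ξ * Real.sqrt n with hy
  have hy0 : 0 < y := by positivity
  set T := frequentTypes M s with hT
  set P := (Measure.pi fun _ : Fin n => μ) with hP
  obtain ⟨J, hJ, hspan⟩ := exists_basis_signCoord T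
  have hJK : J.card ≤ K := Finset.card_le_univ J
  have hgen : ∀ A : Set ({i // s i ∉ T} → ℝ), MeasurableSet A →
      boxEvent s α ξ c d ⊆ (fun X (i : {i // s i ∉ T}) => X i) ⁻¹' A →
      P.real (boxEvent s α ξ c d) ≤
        D * C ^ K * (y ^ J.card * P.real ((fun X (i : {i // s i ∉ T}) => X i) ⁻¹' A)) := by
    intro A hA hsub
    have h1 := measureReal_inter_boxEvent_le hintg (le_max_right 1 _) hn s hJ hA (α := α) hξ hcd
    rw [inter_eq_right.2 hsub] at h1
    refine h1.trans ?_
    obtain ⟨h2, h3⟩ := hD1 J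
    calc _ ≤ y ^ J.card * (D * (P.real ((fun X (i : {i // s i ∉ T}) => X i) ⁻¹' A) * C ^ K)) := by
          gcongr
      _ = _ := by ring
  have hplain : P.real (boxEvent s α ξ c d) ≤ D * C ^ K * (1 + P₁) * y ^ J.card := by
    refine (hgen univ MeasurableSet.univ (by simp)).trans ?_
    rw [preimage_univ, probReal_univ, mul_one]
    refine mul_le_mul_of_nonneg_right ?_ (by positivity)
    exact le_mul_of_one_le_right (by positivity) (by linarith)
  rcases (card_le_two_pow_of_span hspan).lt_or_eq with hlt | heq
  · exact Or.inr ⟨J.card, hJK, Or.inl ⟨hlt, hplain⟩⟩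
  by_cases hJu : J = Finset.univ
  · refine Or.inl ⟨mem_of_card_eq heq hJu, ?_⟩
    rw [hJu, Finset.card_univ] at hplain
    exact hplain
  refine Or.inr ⟨J.card, hJK, Or.inr ⟨heq, ?_⟩⟩
  obtain ⟨j, hj⟩ : ∃ j, j ∉ J := by
    by_contra hne
    push Not at hne
    exact hJu (Finset.eq_univ_iff_forall.2 hne)
  obtain ⟨i, hij, ε, hε⟩ := exists_row_eq_of_card_eq hspan heq hj
  -- The combination of row `j` with row `i`, up to the sign `ε`, vanishes on frequent columns. On
  -- the box event it is confined to an interval of length `O(ξ√n)`, so this event on the rare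
  -- columns alone contributes the extra factor `(ξ√n)^β`.
  set b : Fin n → ℝ := fun k => ((s k j : ℤ) : ℝ) - ((ε * s k i : ℤˣ) : ℤ) with hb
  have hbT : ∀ k, s k ∈ T → b k = 0 := fun k hk => by simp only [hb]; rw [hε _ hk, sub_self]
  have hsum : ∀ X : Fin n → ℝ, ∑ k, b k * X k = rowSum s j X - ((ε : ℤ) : ℝ) * rowSum s i X := by
    intro X
    simp only [hb, rowSum, Finset.mul_sum, ← Finset.sum_sub_distrib]
    refine Finset.sum_congr rfl fun k _ => ?_
    push_cast; ring
  obtain ⟨u, hu⟩ : ∃ u, ∀ X ∈ boxEvent s α ξ c d, ∑ k, b k * X k ∈ Icc u (u + R * y) := by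
    have hRy : (d j - c j + (d i - c i)) * y ≤ R * y := by
      gcongr
      linarith [hRj i, hRj j]
    rcases Int.units_eq_one_or ε with h | h
    · refine ⟨(c j - d i) * y, fun X hX => ?_⟩
      rw [boxEvent_eq hn] at hX
      have h1 := hX j
      have h2 := hX i
      rw [hsum, h]
      simp only [Units.val_one, Int.cast_one, one_mul, mem_Icc] at h1 h2 ⊢
      constructor <;> linarith [h1.1, h1.2, h2.1, h2.2]
    · refine ⟨2 * (α * Real.sqrt n) + (c j + c i) * y, fun X hX => ?_⟩
      rw [boxEvent_eq hn] at hX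
      have h1 := hX j
      have h2 := hX i
      rw [hsum, h]
      simp only [Units.val_neg, Units.val_one, Int.cast_neg, Int.cast_one, neg_mul, one_mul,
        sub_neg_eq_add, mem_Icc] at h1 h2 ⊢
      constructor <;> linarith [h1.1, h1.2, h2.1, h2.2]
  -- If the two rows agree up to sign everywhere, then equality contradicts distinctness of the
  -- rows, and opposite rows cannot both have a signed sum at least `α > 0`, so the box event is
  -- empty.
  by_cases hzero : ∀ k, b k = 0
  · have hrow : ∀ k, s k j = ε * s k i := fun k => by
      have := sub_eq_zero.1 (hzero k)
      exact Units.ext (by exact_mod_cast this)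
    rcases Int.units_eq_one_or ε with h | h
    · exact absurd (hinj (funext fun k => by simpa [h] using (hrow k).symm)) hij
    · have hempty : boxEvent s α ξ c d = ∅ := by
        rw [eq_empty_iff_forall_notMem]
        intro X hX
        have h3 := hsum X
        rw [boxEvent_eq hn] at hX
        have h1 := (hX j).1
        have h2 := (hX i).1
        simp only [hzero, zero_mul, Finset.sum_const_zero, h, Units.val_neg, Units.val_one,
          Int.cast_neg, Int.cast_one, neg_mul, one_mul, sub_neg_eq_add] at h3
        have h4 := mul_nonneg (hc j) hy0.le
        have h5 := mul_nonneg (hc i) hy0.le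
        have h6 := mul_pos hα hs0
        linarith
      rw [hempty, measureReal_empty]
      positivity
  push Not at hzero
  obtain ⟨k, hk⟩ := hzero
  have hk1 : 1 ≤ |b k| := by
    simp only [hb] at hk ⊢
    rcases Int.units_eq_one_or (s k j) with h | h <;>
      rcases Int.units_eq_one_or (ε * s k i) with h' | h' <;> rw [h, h'] at hk ⊢ <;>
      first | (norm_num at hk; done) | norm_num
  have hsumT : ∀ X : Fin n → ℝ, ∑ k : {k // s k ∉ T}, b k * X k = ∑ k, b k * X k := by
    intro X
    rw [← Finset.sum_subtype (Finset.univ.filter fun k => s k ∉ T) (by simp) fun k => b k * X k]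
    refine Finset.sum_filter_of_ne fun k _ hk hkT => hk ?_
    rw [hbT k hkT, zero_mul]
  set A : Set ({k // s k ∉ T} → ℝ) := {Y | ∑ k : {k // s k ∉ T}, b k * Y k ∈ Icc u (u + R * y)} with hAdef
  have hAm : MeasurableSet A := by
    have : Continuous fun Y : {k // s k ∉ T} → ℝ => ∑ k : {k // s k ∉ T}, b k * Y k := by fun_prop
    exact this.measurable measurableSet_Icc
  have hpre : (fun X (k : {k // s k ∉ T}) => X k) ⁻¹' A =
      {X : Fin n → ℝ | ∑ k, b k * X k ∈ Icc u (u + R * y)} := by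
    ext X
    simp only [hAdef, mem_preimage, mem_ofPred_eq]
    rw [hsumT]
  refine (hgen A hAm (by rw [hpre]; exact hu)).trans ?_
  rw [hpre]
  have h7 := measureReal_sum_mem_Icc_le hC₀ hμ b hk1 u (l := R * y) (by positivity)
  rw [Real.mul_rpow hR0.le hy0.le, ← mul_assoc C₀] at h7
  calc _ ≤ D * C ^ K * (y ^ J.card * (P₁ * y ^ β)) := by gcongr
    _ = D * C ^ K * P₁ * (y ^ J.card * y ^ β) := by ring
    _ ≤ _ := by
      refine mul_le_mul_of_nonneg_right ?_ (by positivity)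
      exact mul_le_mul_of_nonneg_left (by linarith) (by positivity)

/-! ### Exponential bounds for counting words over a finite alphabet -/

section Sums

variable {V : Type*} [Fintype V] {n : ℕ}

/-- The generating sum factorizes over letters. For `|x| ≤ 1` one has `e^x ≤ 1 + x + x²`; the linear
term sums to zero, and `1 + (tL)² ≤ e^{(tL)²}`. -/
theorem sum_exp_sum_le {e : V → ℝ} {L t : ℝ} (he : ∀ v, |e v| ≤ L) (h0 : ∑ v, e v = 0)
    (ht : |t| * L ≤ 1) :
    ∑ s : Fin n → V, Real.exp (t * ∑ i, e (s i)) ≤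
      (Fintype.card V : ℝ) ^ n * Real.exp (n * (t * L) ^ 2) := by
  have h1 : ∀ s : Fin n → V, Real.exp (t * ∑ i, e (s i)) = ∏ i, Real.exp (t * e (s i)) := fun s => by
    rw [Finset.mul_sum, Real.exp_sum]
  simp_rw [h1]
  rw [← Fintype.sum_pow (fun v => Real.exp (t * e v)), Real.exp_nat_mul, ← mul_pow]
  gcongr
  have h2 : ∀ v, Real.exp (t * e v) ≤ t * e v + Real.exp ((t * L) ^ 2) := by
    intro v
    have h3 : |t * e v| ≤ |t| * L := by rw [abs_mul]; gcongr; exact he v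
    have h4 := (abs_le.1 (Real.abs_exp_sub_one_sub_id_le (h3.trans ht))).2
    have h5 : (t * e v) ^ 2 ≤ (t * L) ^ 2 := by
      rw [← sq_abs (t * e v), mul_pow t, ← sq_abs t, ← mul_pow]
      gcongr
    have h6 := Real.add_one_le_exp ((t * L) ^ 2)
    linarith
  refine (Finset.sum_le_sum fun v _ => h2 v).trans (le_of_eq ?_)
  rw [Finset.sum_add_distrib, ← Finset.mul_sum, h0]
  simp

/-- Chernoff's bound with `t = θ/2`, whose exponent is `nθ²/4 - nθ²/2`. -/
theorem card_lt_sum_le {e : V → ℝ} {θ : ℝ} (he : ∀ v, |e v| ≤ 1) (h0 : ∑ v, e v = 0)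
    (hθ0 : 0 ≤ θ) (hθ : θ ≤ 1) :
    ((Finset.univ.filter fun s : Fin n → V => n * θ < ∑ i, e (s i)).card : ℝ) ≤
      (Fintype.card V : ℝ) ^ n * Real.exp (-(n * θ ^ 2 / 4)) := by
  have h1 := sum_exp_sum_le (n := n) (t := θ / 2) he h0 (by rw [abs_of_nonneg (by positivity)]; linarith)
  have h2 : ((Finset.univ.filter fun s : Fin n → V => n * θ < ∑ i, e (s i)).card : ℝ) *
      Real.exp (θ / 2 * (n * θ)) ≤ ∑ s : Fin n → V, Real.exp (θ / 2 * ∑ i, e (s i)) := by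
    rw [← nsmul_eq_mul, ← Finset.sum_const]
    refine (Finset.sum_le_sum fun s hs => ?_).trans
      (Finset.sum_le_sum_of_subset_of_nonneg (Finset.filter_subset _ _) fun _ _ _ => (Real.exp_pos _).le)
    have := (Finset.mem_filter.1 hs).2
    gcongr
  rw [← le_div_iff₀ (Real.exp_pos _)] at h2
  refine (h2.trans (div_le_div_of_nonneg_right h1 (Real.exp_pos _).le)).trans (le_of_eq ?_)
  rw [mul_div_assoc, ← Real.exp_sub]
  congr 2
  ring

/-- The number of words most of whose letters lie in a given set. -/
theorem card_filter_notMem_le [DecidableEq V] (T : Finset V) {x : ℝ} (hx0 : 0 < x) (hx1 : x ≤ 1) (m : ℕ) :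
    ((Finset.univ.filter fun s : Fin n → V =>
      (Finset.univ.filter fun i => s i ∉ T).card ≤ m).card : ℝ) ≤
      (x ^ m)⁻¹ * (T.card + Fintype.card V * x) ^ n := by
  -- Each letter outside `T` is given weight `x ≤ 1`; words with at most `m` such letters have
  -- weight at least `x^m`.
  set φ : V → ℝ := fun v => if v ∉ T then x else 1 with hφ
  have h1 : ∀ s : Fin n → V, ∏ i, φ (s i) = x ^ (Finset.univ.filter fun i => s i ∉ T).card := by
    intro s
    simp only [hφ]
    rw [Finset.prod_ite, Finset.prod_const, Finset.prod_const_one, mul_one]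
  have h2 : ((Finset.univ.filter fun s : Fin n → V =>
      (Finset.univ.filter fun i => s i ∉ T).card ≤ m).card : ℝ) * x ^ m ≤
      ∑ s : Fin n → V, ∏ i, φ (s i) := by
    rw [← nsmul_eq_mul, ← Finset.sum_const]
    refine (Finset.sum_le_sum fun s hs => ?_).trans
      (Finset.sum_le_sum_of_subset_of_nonneg (Finset.filter_subset _ _) fun s _ _ => ?_)
    · rw [h1]
      exact pow_le_pow_of_le_one hx0.le hx1 (Finset.mem_filter.1 hs).2
    · rw [h1]; positivity
  rw [← Fintype.sum_pow] at h2
  have h3 : ∑ v, φ v ≤ T.card + Fintype.card V * x := by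
    have h4 : ∀ v, φ v ≤ (if v ∈ T then 1 else 0) + x := by
      intro v
      simp only [hφ]
      by_cases hv : v ∈ T <;> simp [hv, hx0.le]
    refine (Finset.sum_le_sum fun v _ => h4 v).trans (le_of_eq ?_)
    rw [Finset.sum_add_distrib]
    simp
  have h5 : 0 ≤ ∑ v, φ v := Finset.sum_nonneg fun v _ => by
    simp only [hφ]; split_ifs <;> positivity
  rw [← div_eq_inv_mul, le_div_iff₀ (by positivity)]
  exact h2.trans (by gcongr)

/-- Words in which some letter is rare are exponentially rare. -/
theorem exists_card_rare_le [DecidableEq V] [Nonempty V] : ∃ δ r : ℝ, 0 < δ ∧ 0 < r ∧ r < 1 ∧ ∀ n : ℕ,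
    ((Finset.univ.filter fun s : Fin n → V =>
      ∃ v, ((Finset.univ.filter fun i => s i = v).card : ℝ) < δ * n).card : ℝ) ≤
      Fintype.card V * (Fintype.card V * r) ^ n := by
  set N : ℝ := (Fintype.card V : ℝ) with hN
  have hN1 : 1 ≤ N := by
    rw [hN]; exact_mod_cast Fintype.card_pos
  -- Weight `1/2` on the rare letter lowers the total letter weight from `N` to `N (1 - 1/(2N))`,
  -- while Markov's inequality costs `2^{δn}`; `δ` is taken so small that the gain wins.
  obtain ⟨δ, hδ, hδ1⟩ : ∃ δ : ℝ, 0 < δ ∧ (2 : ℝ) ^ δ * (1 - 1 / (2 * N)) < 1 := by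
    have h1 : Tendsto (fun δ : ℝ => (2 : ℝ) ^ δ * (1 - 1 / (2 * N))) (𝓝[>] 0)
        (𝓝 ((2 : ℝ) ^ (0 : ℝ) * (1 - 1 / (2 * N)))) := by
      have h2 : Continuous fun δ : ℝ => (2 : ℝ) ^ δ * (1 - 1 / (2 * N)) :=
        (Real.continuous_const_rpow (by norm_num)).mul continuous_const
      exact (h2.tendsto 0).mono_left nhdsWithin_le_nhds
    have h3 : (2 : ℝ) ^ (0 : ℝ) * (1 - 1 / (2 * N)) < 1 := by
      rw [Real.rpow_zero, one_mul, sub_lt_self_iff]; positivity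
    obtain ⟨δ, h4, h5⟩ := ((h1.eventually (gt_mem_nhds h3)).and self_mem_nhdsWithin).exists
    exact ⟨δ, h5, h4⟩
  have hr0 : 0 < 1 - 1 / (2 * N) := by
    rw [sub_pos, div_lt_one (by positivity)]; linarith
  refine ⟨δ, (2 : ℝ) ^ δ * (1 - 1 / (2 * N)), hδ, by positivity, hδ1, fun n => ?_⟩
  have hone : ∀ v : V, ((Finset.univ.filter fun s : Fin n → V =>
      ((Finset.univ.filter fun i => s i = v).card : ℝ) < δ * n).card : ℝ) ≤
      (N * ((2 : ℝ) ^ δ * (1 - 1 / (2 * N)))) ^ n := by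
    intro v
    set φ : V → ℝ := fun u => if u = v then 1 / 2 else 1 with hφ
    have h1 : ∀ s : Fin n → V, ∏ i, φ (s i) =
        (1 / 2) ^ (Finset.univ.filter fun i => s i = v).card := by
      intro s
      simp only [hφ]
      rw [Finset.prod_ite, Finset.prod_const, Finset.prod_const_one, mul_one]
    have h2 : ((Finset.univ.filter fun s : Fin n → V =>
      ((Finset.univ.filter fun i => s i = v).card : ℝ) < δ * n).card : ℝ) * (1 / 2) ^ (δ * n) ≤
        ∑ s : Fin n → V, ∏ i, φ (s i) := by
      rw [← nsmul_eq_mul, ← Finset.sum_const]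
      refine (Finset.sum_le_sum fun s hs => ?_).trans
        (Finset.sum_le_sum_of_subset_of_nonneg (Finset.filter_subset _ _) fun s _ _ => ?_)
      · rw [h1, ← Real.rpow_natCast]
        exact Real.rpow_le_rpow_of_exponent_ge (by norm_num) (by norm_num)
          (Finset.mem_filter.1 hs).2.le
      · rw [h1]; positivity
    rw [← Fintype.sum_pow] at h2
    have h3 : ∑ u, φ u = N - 1 / 2 := by
      have h4 : ∀ u, φ u = 1 - (if u = v then 1 / 2 else 0) := by
        intro u
        simp only [hφ]
        split_ifs <;> norm_num
      simp_rw [h4, Finset.sum_sub_distrib]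
      simp [hN]
    rw [h3, ← le_div_iff₀ (by positivity)] at h2
    refine h2.trans (le_of_eq ?_)
    rw [one_div, Real.inv_rpow (by norm_num), div_inv_eq_mul, Real.rpow_mul (by norm_num),
      Real.rpow_natCast, ← mul_pow]
    congr 1
    field_simp
  have hsub : (Finset.univ.filter fun s : Fin n → V =>
      ∃ v, ((Finset.univ.filter fun i => s i = v).card : ℝ) < δ * n) ⊆
      Finset.univ.biUnion fun v => Finset.univ.filter fun s : Fin n → V =>
        ((Finset.univ.filter fun i => s i = v).card : ℝ) < δ * n := by
    intro s hs
    obtain ⟨v, hv⟩ := (Finset.mem_filter.1 hs).2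
    exact Finset.mem_biUnion.2 ⟨v, Finset.mem_univ v, Finset.mem_filter.2 ⟨Finset.mem_univ s, hv⟩⟩
  calc _ ≤ ((Finset.univ.biUnion fun v => Finset.univ.filter fun s : Fin n → V =>
        ((Finset.univ.filter fun i => s i = v).card : ℝ) < δ * n).card : ℝ) := by
        exact_mod_cast Finset.card_le_card hsub
    _ ≤ ∑ v, ((Finset.univ.filter fun s : Fin n → V =>
        ((Finset.univ.filter fun i => s i = v).card : ℝ) < δ * n).card : ℝ) := by
        exact_mod_cast Finset.card_biUnion_le
    _ ≤ ∑ _v : V, (N * ((2 : ℝ) ^ δ * (1 - 1 / (2 * N)))) ^ n := Finset.sum_le_sum fun v _ => hone v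
    _ = _ := by simp [hN]

end Sums

/-! ### Overlaps and column sums of a uniformly chosen array -/

variable {n : ℕ} {ι : Type*} [Fintype ι] [DecidableEq ι]

theorem card_signVectors : Fintype.card (ι → ℤˣ) = 2 ^ Fintype.card ι := by simp

/-- Flipping coordinate `j` is an involution changing the sign of the summand. -/
theorem sum_mul_signs_eq_zero {j k : ι} (hjk : j ≠ k) :
    ∑ v : ι → ℤˣ, ((v j : ℤ) : ℝ) * ((v k : ℤ) : ℝ) = 0 := by
  have h := Finset.sum_involution (s := Finset.univ)
    (f := fun v : ι → ℤˣ => ((v j : ℤ) : ℝ) * ((v k : ℤ) : ℝ))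
    (fun v _ => Function.update v j (-v j)) (fun v _ => by simp [hjk.symm])
    (fun v _ _ h => by
      have h1 := congrFun h j
      rw [Function.update_self] at h1
      exact absurd h1 (by rcases Int.units_eq_one_or (v j) with h | h <;> rw [h] <;> decide))
    (fun v _ => Finset.mem_univ _) (fun v _ => by simp)
  exact h

theorem sum_signDot_one_sq_sub : ∑ v : ι → ℤˣ, (signDot v 1 ^ 2 - Fintype.card ι) = 0 := by
  have h1 : ∀ v : ι → ℤˣ, signDot v 1 ^ 2 - Fintype.card ι =
      ∑ j, ∑ k, (if j = k then 0 else ((v j : ℤ) : ℝ) * ((v k : ℤ) : ℝ)) := by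
    intro v
    have h2 : ∀ j k, (if j = k then (0 : ℝ) else ((v j : ℤ) : ℝ) * ((v k : ℤ) : ℝ)) =
        ((v j : ℤ) : ℝ) * ((v k : ℤ) : ℝ) - (if j = k then 1 else 0) := by
      intro j k
      split_ifs with h
      · subst h
        rcases Int.units_eq_one_or (v j) with h | h <;> simp [h]
      · simp
    simp_rw [h2, Finset.sum_sub_distrib, signDot, sq, Finset.sum_mul_sum]
    simp
  simp_rw [h1]
  rw [Finset.sum_comm]
  refine Finset.sum_eq_zero fun j _ => ?_
  rw [Finset.sum_comm]
  refine Finset.sum_eq_zero fun k _ => ?_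
  split_ifs with h
  · simp
  · exact sum_mul_signs_eq_zero h

theorem abs_signDot_one_sq_sub_le {ι : Type*} [Fintype ι] (v : ι → ℤˣ) :
    |signDot v 1 ^ 2 - Fintype.card ι| ≤ (Fintype.card ι : ℝ) ^ 2 := by
  have h1 := abs_signDot_one_le v
  have h2 : signDot v 1 ^ 2 ≤ (Fintype.card ι : ℝ) ^ 2 := by
    rw [← sq_abs]; gcongr
  have h3 : (Fintype.card ι : ℝ) ≤ (Fintype.card ι : ℝ) ^ 2 := by
    exact_mod_cast Nat.le_self_pow (by norm_num) _
  rw [abs_le]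
  constructor
  · nlinarith [sq_nonneg (signDot v 1)]
  · have : (0 : ℝ) ≤ Fintype.card ι := by positivity
    linarith

theorem sum_exp_meanSqColSum_le (hn : 0 < n) {a : ℝ} (ha : |a| / n * (Fintype.card ι : ℝ) ^ 2 ≤ 1) :
    ∑ s : Fin n → ι → ℤˣ, Real.exp (a * (meanSqColSum s - Fintype.card ι)) ≤
      ((2 : ℝ) ^ Fintype.card ι) ^ n * Real.exp (a ^ 2 / n * (Fintype.card ι : ℝ) ^ 4) := by
  have hn' : (n : ℝ) ≠ 0 := by exact_mod_cast hn.ne'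
  have h1 : ∀ s : Fin n → ι → ℤˣ, a * (meanSqColSum s - Fintype.card ι) =
      a / n * ∑ i, (signDot (s i) 1 ^ 2 - Fintype.card ι) := by
    intro s
    rw [meanSqColSum, Finset.sum_sub_distrib]
    simp
    field_simp
  simp_rw [h1]
  refine (sum_exp_sum_le (e := fun v : ι → ℤˣ => signDot v 1 ^ 2 - Fintype.card ι)
    abs_signDot_one_sq_sub_le sum_signDot_one_sq_sub (by rwa [abs_div, Nat.abs_cast])).trans
    (le_of_eq ?_)
  rw [card_signVectors]
  push_cast
  congr 2
  field_simp

theorem card_overlap_gt_le (hn : 0 < n) {θ : ℝ} (hθ0 : 0 ≤ θ) (hθ : θ ≤ 1) :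
    ((Finset.univ.filter fun s : Fin n → ι → ℤˣ => ¬∀ j k, j ≠ k → |overlap s j k| ≤ θ).card : ℝ) ≤
      2 * (Fintype.card ι : ℝ) ^ 2 * (((2 : ℝ) ^ Fintype.card ι) ^ n * Real.exp (-(n * θ ^ 2 / 4))) := by
  have hn' : (0 : ℝ) < n := by exact_mod_cast hn
  set U := ((2 : ℝ) ^ Fintype.card ι) ^ n * Real.exp (-(n * θ ^ 2 / 4)) with hU
  set A : ι → ι → ℤˣ → Finset (Fin n → ι → ℤˣ) := fun j k ε => if j = k then ∅ else
    Finset.univ.filter fun s : Fin n → ι → ℤˣ =>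
      n * θ < ∑ i, ((ε : ℤ) : ℝ) * (((s i j : ℤ) : ℝ) * ((s i k : ℤ) : ℝ)) with hA
  have hAle : ∀ j k ε, ((A j k ε).card : ℝ) ≤ U := by
    intro j k ε
    simp only [hA]
    split_ifs with h
    · simp only [Finset.card_empty, Nat.cast_zero]; positivity
    · have h1 := card_lt_sum_le (n := n)
        (e := fun v : ι → ℤˣ => ((ε : ℤ) : ℝ) * (((v j : ℤ) : ℝ) * ((v k : ℤ) : ℝ)))
        (θ := θ) (fun v => ?_) ?_ hθ0 hθ
      · rw [card_signVectors] at h1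
        push_cast at h1
        exact h1
      · rcases Int.units_eq_one_or ε with h | h <;> rcases Int.units_eq_one_or (v j) with h' | h' <;>
          rcases Int.units_eq_one_or (v k) with h'' | h'' <;> simp [h, h', h'']
      · rw [← Finset.mul_sum, sum_mul_signs_eq_zero h, mul_zero]
  have hsub : (Finset.univ.filter fun s : Fin n → ι → ℤˣ => ¬∀ j k, j ≠ k → |overlap s j k| ≤ θ) ⊆
      Finset.univ.biUnion fun p : ι × ι × ℤˣ => A p.1 p.2.1 p.2.2 := by
    intro s hs
    have h1 := (Finset.mem_filter.1 hs).2
    push Not at h1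
    obtain ⟨j, k, hjk, h2⟩ := h1
    rw [overlap, abs_div, Nat.abs_cast, lt_div_iff₀ hn', lt_abs] at h2
    rcases h2 with h2 | h2
    · refine Finset.mem_biUnion.2 ⟨(j, k, 1), Finset.mem_univ _, ?_⟩
      simp only [hA, if_neg hjk, Finset.mem_filter, Finset.mem_univ, true_and]
      simpa [mul_comm θ] using h2
    · refine Finset.mem_biUnion.2 ⟨(j, k, -1), Finset.mem_univ _, ?_⟩
      simp only [hA, if_neg hjk, Finset.mem_filter, Finset.mem_univ, true_and]
      simpa [mul_comm θ] using h2
  calc _ ≤ ((Finset.univ.biUnion fun p : ι × ι × ℤˣ => A p.1 p.2.1 p.2.2).card : ℝ) := by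
        exact_mod_cast Finset.card_le_card hsub
    _ ≤ ∑ p : ι × ι × ℤˣ, ((A p.1 p.2.1 p.2.2).card : ℝ) := by exact_mod_cast Finset.card_biUnion_le
    _ ≤ ∑ _p : ι × ι × ℤˣ, U := Finset.sum_le_sum fun p _ => hAle _ _ _
    _ = _ := by
        simp only [Finset.sum_const, Finset.card_univ, Fintype.card_prod, Fintype.card_units_int,
          nsmul_eq_mul]
        push_cast
        ring

/-- The total weight of the arrays with a large overlap. -/
theorem sq_sum_exp_overlap_gt_le (hn : 0 < n) {θ a : ℝ} (hθ0 : 0 ≤ θ) (hθ : θ ≤ 1)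
    (ha : |2 * a| / n * (Fintype.card ι : ℝ) ^ 2 ≤ 1) :
    (∑ s ∈ Finset.univ.filter fun s : Fin n → ι → ℤˣ => ¬∀ j k, j ≠ k → |overlap s j k| ≤ θ,
      Real.exp (a * (meanSqColSum s - Fintype.card ι))) ^ 2 ≤
      (((2 : ℝ) ^ Fintype.card ι) ^ n) ^ 2 * (2 * (Fintype.card ι : ℝ) ^ 2 *
        Real.exp (-(n * θ ^ 2 / 4)) * Real.exp ((2 * a) ^ 2 / n * (Fintype.card ι : ℝ) ^ 4)) := by
  -- Cauchy-Schwarz separates the number of arrays with a large overlap from the exponential moment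
  -- at the doubled parameter.
  refine sq_sum_le_card_mul_sum_sq.trans ?_
  have h1 : ∑ s ∈ Finset.univ.filter fun s : Fin n → ι → ℤˣ => ¬∀ j k, j ≠ k → |overlap s j k| ≤ θ,
      Real.exp (a * (meanSqColSum s - Fintype.card ι)) ^ 2 ≤
      ∑ s : Fin n → ι → ℤˣ, Real.exp (2 * a * (meanSqColSum s - Fintype.card ι)) := by
    refine (le_of_eq (Finset.sum_congr rfl fun s _ => ?_)).trans
      (Finset.sum_le_sum_of_subset_of_nonneg (Finset.filter_subset _ _) fun _ _ _ => (Real.exp_pos _).le)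
    rw [← Real.exp_nat_mul]; congr 1; push_cast; ring
  have h2 := h1.trans (sum_exp_meanSqColSum_le hn ha)
  calc _ ≤ 2 * (Fintype.card ι : ℝ) ^ 2 * (((2 : ℝ) ^ Fintype.card ι) ^ n *
        Real.exp (-(n * θ ^ 2 / 4))) * (((2 : ℝ) ^ Fintype.card ι) ^ n *
          Real.exp ((2 * a) ^ 2 / n * (Fintype.card ι : ℝ) ^ 4)) :=
        mul_le_mul (card_overlap_gt_le hn hθ0 hθ) h2
          (Finset.sum_nonneg fun _ _ => by positivity) (by positivity)
    _ = _ := by ring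

/-! ### The scaling regime and the unbalanced arrays -/

/-- The regime in which the window width is of order `2 ^ (-n) * exp (α ^ 2 / 2)`. -/
structure ScalingRegime (α ξ : ℕ → ℝ) : Prop where
  α_pos : ∀ n, 0 < α n
  tendsto_α : Tendsto (fun n => α n ^ 4 / n) atTop (𝓝 0)
  ξ_pos : ∀ᶠ n in atTop, 0 < ξ n
  tendsto_ξ : Tendsto (fun n => 2 ^ n * (ξ n * Real.exp (-(α n ^ 2 / 2)))) atTop
    (𝓝 (Real.sqrt (2 * Real.pi)))

variable {α ξ : ℕ → ℝ}

theorem ScalingRegime.eventually_pow_le (R : ScalingRegime α ξ) : ∀ᶠ n : ℕ in atTop, α n ^ 4 ≤ n := by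
  filter_upwards [R.tendsto_α.eventually (ge_mem_nhds one_pos), eventually_gt_atTop 0] with n h1 h2
  have h2' : (0 : ℝ) < n := by exact_mod_cast h2
  rwa [div_le_one h2'] at h1

/-- The width `ξ` is of order `2^{-n} e^{α²/2}` with `α² ≤ √n`, so `e^{α²/2}` and `√n` are both
subexponential corrections to `2^{-n}`. -/
theorem ScalingRegime.eventually_le_pow (R : ScalingRegime α ξ) {b : ℝ} (hb : 1 < b) :
    ∀ᶠ n : ℕ in atTop, ξ n * Real.sqrt n ≤ (b / 2) ^ n := by
  set ε := Real.log b / 2 with hε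
  have hε0 : 0 < ε := half_pos (Real.log_pos hb)
  set D := (Real.sqrt (2 * Real.pi) + 1) * Real.exp (1 / (4 * ε)) with hD
  have hr : |Real.exp (-ε)| < 1 := by
    rw [abs_of_pos (Real.exp_pos _), Real.exp_lt_one_iff]; linarith
  have h0 := (tendsto_pow_const_mul_const_pow_of_abs_lt_one 1 hr).const_mul D
  rw [mul_zero] at h0
  filter_upwards [h0.eventually (ge_mem_nhds one_pos), R.eventually_pow_le, R.ξ_pos,
    R.tendsto_ξ.eventually (ge_mem_nhds (lt_add_one (Real.sqrt (2 * Real.pi)))),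
    eventually_ge_atTop 1] with n h1 h2 h3 h4 h5
  have h5' : (1 : ℝ) ≤ n := by exact_mod_cast h5
  set q := Real.sqrt n with hq
  have hq2 : q ^ 2 = n := Real.sq_sqrt (by positivity)
  have hq0 : 0 ≤ q := Real.sqrt_nonneg _
  have hqn : q ≤ n := Real.sqrt_le_iff.2 ⟨by positivity, by nlinarith⟩
  have hα2 : α n ^ 2 ≤ q := by
    refine le_of_sq_le_sq ?_ hq0
    rw [hq2]
    refine le_trans (le_of_eq ?_) h2
    ring
  have hexp : Real.exp (α n ^ 2 / 2) ≤ Real.exp (1 / (4 * ε)) * Real.exp (ε * n) := by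
    rw [← Real.exp_add]
    refine Real.exp_le_exp.2 ?_
    have h6 : q ≤ 1 / (4 * ε) + ε * n := by
      rw [← hq2, ← sub_nonneg]
      have : 1 / (4 * ε) + ε * q ^ 2 - q = ε * (q - 1 / (2 * ε)) ^ 2 := by field_simp; ring
      rw [this]; positivity
    linarith
  have hξ : ξ n * 2 ^ n ≤ (Real.sqrt (2 * Real.pi) + 1) * Real.exp (α n ^ 2 / 2) := by
    rw [← div_le_iff₀ (Real.exp_pos _), div_eq_mul_inv, ← Real.exp_neg]
    linarith
  have hb' : b ^ n = Real.exp (ε * n) * Real.exp (ε * n) := by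
    rw [← Real.exp_add, hε, ← Real.rpow_natCast, Real.rpow_def_of_pos (by linarith)]
    congr 1; ring
  rw [div_pow, le_div_iff₀ (by positivity), hb']
  calc ξ n * q * 2 ^ n = ξ n * 2 ^ n * q := by ring
    _ ≤ (Real.sqrt (2 * Real.pi) + 1) * (Real.exp (1 / (4 * ε)) * Real.exp (ε * n)) * n := by
        refine mul_le_mul (hξ.trans ?_) hqn hq0 (by positivity)
        gcongr
    _ = D * n * Real.exp (ε * n) := by rw [hD]; ring
    _ ≤ Real.exp (ε * n) * Real.exp (ε * n) := by
        gcongr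
        rw [pow_one, ← Real.exp_nat_mul, mul_comm (n : ℝ) (-ε), neg_mul, Real.exp_neg, ← mul_assoc,
          ← div_eq_mul_inv, div_le_one (Real.exp_pos _)] at h1
        exact h1

/-- The counting criterion for negligible classes: `A^n` arrays, each of probability `O((ξ√n)^p)`,
are harmless when `A < 2^p`. A base `b > 1` close to 1 with `A (b/2)^p < 1` yields geometric decay.
-/
theorem ScalingRegime.tendsto_pow_mul_rpow (R : ScalingRegime α ξ) {A p : ℝ} (hA : 0 ≤ A) (hp : 0 ≤ p)
    (hAp : A < 2 ^ p) : Tendsto (fun n : ℕ => A ^ n * (ξ n * Real.sqrt n) ^ p) atTop (𝓝 0) := by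
  obtain ⟨b, hb1, hb2⟩ : ∃ b : ℝ, 1 < b ∧ A * (b / 2) ^ p < 1 := by
    have h1 : Tendsto (fun b : ℝ => A * (b / 2) ^ p) (𝓝[>] 1) (𝓝 (A * ((1 : ℝ) / 2) ^ p)) := by
      have h2 : Continuous fun b : ℝ => A * (b / 2) ^ p :=
        continuous_const.mul ((continuous_id.div_const 2).rpow_const fun _ => Or.inr hp)
      exact (h2.tendsto 1).mono_left nhdsWithin_le_nhds
    have h3 : A * ((1 : ℝ) / 2) ^ p < 1 := by
      rw [one_div, Real.inv_rpow (by norm_num), ← div_eq_mul_inv, div_lt_one (by positivity)]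
      exact hAp
    obtain ⟨b, h4, h5⟩ := ((h1.eventually (gt_mem_nhds h3)).and self_mem_nhdsWithin).exists
    exact ⟨b, h5, h4⟩
  have hb0 : 0 < b / 2 := by linarith
  refine squeeze_zero' ?_ ?_ (tendsto_pow_atTop_nhds_zero_of_lt_one (r := A * (b / 2) ^ p)
    (by positivity) hb2)
  · filter_upwards [R.ξ_pos] with n hn
    positivity
  · filter_upwards [R.ξ_pos, R.eventually_le_pow hb1] with n hn h1
    rw [mul_pow, ← Real.rpow_natCast ((b / 2) ^ p), ← Real.rpow_mul hb0.le, mul_comm p,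
      Real.rpow_mul hb0.le, Real.rpow_natCast]
    gcongr

theorem ScalingRegime.tendsto_mul_sqrt (R : ScalingRegime α ξ) :
    Tendsto (fun n : ℕ => ξ n * Real.sqrt n) atTop (𝓝 0) := by
  simpa using R.tendsto_pow_mul_rpow (A := 1) (p := 1) (by norm_num) (by norm_num) (by norm_num)

theorem ScalingRegime.limitRegime (R : ScalingRegime α ξ) {β : Type*} {l : Filter β} {N : β → ℕ}
    (hN : Tendsto N l atTop) : LimitRegime l N (fun b => α (N b)) (fun b => ξ (N b)) := by
  have h1 : ∀ᶠ n : ℕ in atTop, 0 ≤ ξ n ∧ ξ n ≤ ξ n * Real.sqrt n := by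
    filter_upwards [R.ξ_pos, eventually_ge_atTop 1] with n h2 h3
    exact ⟨h2.le, le_mul_of_one_le_right h2.le (Real.one_le_sqrt.2 (by exact_mod_cast h3))⟩
  have h2 : ∀ᶠ n : ℕ in atTop, 0 ≤ |α n| * ξ n ∧ |α n| * ξ n ≤ ξ n * Real.sqrt n := by
    filter_upwards [R.ξ_pos, eventually_ge_atTop 1, R.eventually_pow_le] with n h2 h3 h4
    refine ⟨by positivity, ?_⟩
    rw [mul_comm]
    gcongr
    have h3' : (1 : ℝ) ≤ n := by exact_mod_cast h3
    refine Real.le_sqrt_of_sq_le ?_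
    rw [sq_abs]
    refine le_of_sq_le_sq ?_ (by positivity)
    nlinarith
  refine ⟨hN, R.tendsto_α.comp hN, hN.eventually R.ξ_pos, ?_, ?_⟩
  · exact (squeeze_zero' (h1.mono fun _ h => h.1) (h1.mono fun _ h => h.2) R.tendsto_mul_sqrt).comp hN
  · exact (squeeze_zero' (h2.mono fun _ h => h.1) (h2.mono fun _ h => h.2) R.tendsto_mul_sqrt).comp hN

variable {ι : Type*} [Fintype ι] [DecidableEq ι] {μ : Measure ℝ} {M : ℕ}

theorem card_notMem_frequentTypes_le {n : ℕ} (M : ℕ) (s : Fin n → ι → ℤˣ) :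
    (Finset.univ.filter fun i => s i ∉ frequentTypes M s).card ≤ Fintype.card (ι → ℤˣ) * M := by
  rw [← smul_eq_mul, ← Finset.card_univ, ← Finset.sum_const,
    Finset.card_eq_sum_card_fiberwise (f := s) (t := Finset.univ) (fun _ _ => Finset.mem_univ _)]
  refine Finset.sum_le_sum fun v _ => ?_
  by_cases hv : M ≤ colCount s v
  · have : ((Finset.univ.filter fun i => s i ∉ frequentTypes M s).filter fun i => s i = v) = ∅ := by
      refine Finset.filter_eq_empty_iff.2 fun i hi h => (Finset.mem_filter.1 hi).2 ?_
      rw [h]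
      exact Finset.mem_filter.2 ⟨Finset.mem_univ _, hv⟩
    rw [this]; simp
  · refine le_trans (Finset.card_le_card ?_) (not_le.1 hv).le
    intro i hi
    exact Finset.mem_filter.2 ⟨Finset.mem_univ _, (Finset.mem_filter.1 hi).2⟩

theorem card_frequentTypes_eq_le {n : ℕ} (M : ℕ) (T : Finset (ι → ℤˣ)) {x : ℝ} (hx0 : 0 < x)
    (hx1 : x ≤ 1) :
    ((Finset.univ.filter fun s : Fin n → ι → ℤˣ => frequentTypes M s = T).card : ℝ) ≤
      (x ^ (Fintype.card (ι → ℤˣ) * M))⁻¹ * (T.card + Fintype.card (ι → ℤˣ) * x) ^ n := by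
  refine le_trans ?_ (card_filter_notMem_le T hx0 hx1 (Fintype.card (ι → ℤˣ) * M))
  refine Nat.cast_le.2 (Finset.card_le_card (Finset.monotone_filter_right _ fun s _ hs => ?_))
  rw [← hs]
  exact card_notMem_frequentTypes_le M s

/-- All but boundedly many columns have types in `T`, so the number of these arrays grows at rate at
most `|T| + N x`, with `N` the number of types, for arbitrarily small `x > 0`; `x` is chosen to stay
below `2^p`. -/
theorem tendsto_card_frequentTypes_mul (R : ScalingRegime α ξ) (M : ℕ) (T : Finset (ι → ℤˣ)) {p : ℝ}
    (hp : 0 ≤ p) (hT : (T.card : ℝ) < 2 ^ p) :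
    Tendsto (fun n : ℕ => ((Finset.univ.filter fun s : Fin n → ι → ℤˣ =>
      frequentTypes M s = T).card : ℝ) * (ξ n * Real.sqrt n) ^ p) atTop (𝓝 0) := by
  set N : ℝ := (Fintype.card (ι → ℤˣ) : ℝ) with hN
  have hN0 : 0 < N := by rw [hN]; exact_mod_cast Fintype.card_pos
  set x : ℝ := min 1 ((2 ^ p - T.card) / (2 * N)) with hx
  have hx0 : 0 < x := lt_min one_pos (div_pos (by linarith) (by positivity))
  have hA : T.card + N * x < 2 ^ p := by
    have h1 : N * x ≤ (2 ^ p - T.card) / 2 := by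
      calc N * x ≤ N * ((2 ^ p - T.card) / (2 * N)) := by gcongr; exact min_le_right _ _
        _ = _ := by field_simp
    linarith
  have h2 := (R.tendsto_pow_mul_rpow (by positivity) hp hA).const_mul
    (x ^ (Fintype.card (ι → ℤˣ) * M))⁻¹
  rw [mul_zero] at h2
  refine squeeze_zero' ?_ ?_ h2
  · filter_upwards [R.ξ_pos] with n hn
    positivity
  · filter_upwards [R.ξ_pos] with n hn
    rw [← mul_assoc]
    gcongr
    exact card_frequentTypes_eq_le M T hx0 (min_le_left _ _)

/-- The arrays in which some type of column is rare do not contribute. -/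
theorem exists_tendsto_sum_unbalanced [IsProbabilityMeasure μ]
    (hintg : Integrable fun u : ℝ => ‖laplace μ (2 * Real.pi * u * Complex.I)‖ ^ M)
    {C₀ β : ℝ} (hC₀ : 0 < C₀) (hβ : 0 < β)
    (hμ : ∀ a l : ℝ, 0 < l → μ.real (Icc a (a + l)) ≤ C₀ * l ^ β)
    {c d : ι → ℝ} (hc : ∀ j, 0 ≤ c j) (hcd : ∀ j, c j < d j) :
    ∃ δ : ℝ, 0 < δ ∧ Tendsto (fun n : ℕ => ((Finset.univ.filter fun s : Fin n → ι → ℤˣ =>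
        ∃ v, (colCount s v : ℝ) < δ * n).card : ℝ) / ((2 : ℝ) ^ Fintype.card ι) ^ n) atTop (𝓝 0) ∧
      ∀ {α ξ : ℕ → ℝ}, ScalingRegime α ξ →
      Tendsto (fun n => ∑ s : Fin n → ι → ℤˣ,
        {s | Function.Injective (fun j i => s i j) ∧ ¬IsBalanced δ s}.indicator
          (fun s => (Measure.pi fun _ : Fin n => μ).real (boxEvent s (α n) (ξ n) c d)) s)
        atTop (𝓝 0) := by
  obtain ⟨δ, r, hδ, hr0, hr1, hcount⟩ := exists_card_rare_le (V := ι → ℤˣ)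
  obtain ⟨B, hB, hb⟩ := exists_measureReal_boxEvent_le_of_frequentTypes hintg hC₀ hμ hc hcd
  set K := Fintype.card ι with hK
  have hV : (Fintype.card (ι → ℤˣ) : ℝ) = 2 ^ K := by rw [card_signVectors]; push_cast; rfl
  rw [hV] at hcount
  refine ⟨δ, hδ, ?_, fun {α ξ} R => ?_⟩
  · have h1 := (tendsto_pow_atTop_nhds_zero_of_lt_one hr0.le hr1).const_mul ((2 : ℝ) ^ K)
    rw [mul_zero] at h1
    refine squeeze_zero (fun n => by positivity) (fun n => ?_) h1
    rw [div_le_iff₀ (by positivity), mul_assoc, ← mul_pow, mul_comm r]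
    exact hcount n
  set y : ℕ → ℝ := fun n => ξ n * Real.sqrt n with hy
  set c₁ : ℕ → ℝ := fun n => ((Finset.univ.filter fun s : Fin n → ι → ℤˣ =>
    ∃ v, ((Finset.univ.filter fun i => s i = v).card : ℝ) < δ * n).card : ℝ) with hc₁
  set c₂ : Finset (ι → ℤˣ) → ℕ → ℝ := fun T n => ((Finset.univ.filter fun s : Fin n → ι → ℤˣ =>
    frequentTypes M s = T).card : ℝ) with hc₂
  -- The two rank-deficient alternatives: exponent `k` when `|T| < 2^k`, and exponent `k + β` when
  -- `|T| = 2^k`. In both, `|T|` is less than 2 to that exponent. The count `c₁` serves the case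
  -- where all types are frequent but one still falls below the proportion `δ`.
  set u : Finset (ι → ℤˣ) → ℕ → ℕ → ℝ := fun T k n =>
    (if T.card < 2 ^ k then y n ^ (k : ℝ) else 0) +
      (if T.card = 2 ^ k then y n ^ ((k : ℝ) + β) else 0) with hu
  have hlim : Tendsto (fun n => B * (c₁ n * y n ^ (K : ℝ) +
      ∑ T : Finset (ι → ℤˣ), ∑ k ∈ Finset.range (K + 1), c₂ T n * u T k n)) atTop (𝓝 0) := by
    have h1 : Tendsto (fun n => c₁ n * y n ^ (K : ℝ)) atTop (𝓝 0) := by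
      have h2 := (R.tendsto_pow_mul_rpow (A := 2 ^ K * r) (p := K) (by positivity) (by positivity) (by
        rw [Real.rpow_natCast]
        exact mul_lt_of_lt_one_right (by positivity) hr1)).const_mul ((2 : ℝ) ^ K)
      rw [mul_zero] at h2
      refine squeeze_zero' ?_ ?_ h2
      · filter_upwards [R.ξ_pos] with n hn
        positivity
      · filter_upwards [R.ξ_pos] with n hn
        rw [← mul_assoc]
        gcongr
        exact hcount n
    have h3 : ∀ T k, Tendsto (fun n => c₂ T n * u T k n) atTop (𝓝 0) := by
      intro T k
      simp only [hu, mul_add]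
      rw [← add_zero (0 : ℝ)]
      refine Tendsto.add ?_ ?_
      · split_ifs with h
        · refine tendsto_card_frequentTypes_mul R M T (by positivity) ?_
          rw [Real.rpow_natCast]; exact_mod_cast h
        · simp
      · split_ifs with h
        · refine tendsto_card_frequentTypes_mul R M T (by positivity) ?_
          rw [h, Real.rpow_add (by norm_num), Real.rpow_natCast]
          push_cast
          exact lt_mul_of_one_lt_right (by positivity) (Real.one_lt_rpow (by norm_num) hβ)
        · simp
    have h4 : Tendsto (fun n => ∑ T : Finset (ι → ℤˣ), ∑ k ∈ Finset.range (K + 1), c₂ T n * u T k n)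
        atTop (𝓝 0) := by
      have := tendsto_finsetSum (Finset.univ : Finset (Finset (ι → ℤˣ))) fun T _ =>
        tendsto_finsetSum (Finset.range (K + 1)) fun k _ => h3 T k
      simpa using this
    simpa using (h1.add h4).const_mul B
  refine squeeze_zero' (Eventually.of_forall fun n => Finset.sum_nonneg fun s _ =>
    indicator_nonneg (fun _ _ => measureReal_nonneg) _) ?_ hlim
  filter_upwards [R.ξ_pos, eventually_gt_atTop 0] with n hξ hn
  have hy0 : 0 < y n := by
    have : 0 < Real.sqrt n := Real.sqrt_pos.2 (by exact_mod_cast hn)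
    positivity
  have hu0 : ∀ T k, 0 ≤ u T k n := fun T k => by
    simp only [hu]
    refine add_nonneg ?_ ?_ <;> split_ifs <;> positivity
  have hpt : ∀ s : Fin n → ι → ℤˣ,
      {s | Function.Injective (fun j i => s i j) ∧ ¬IsBalanced δ s}.indicator
        (fun s => (Measure.pi fun _ : Fin n => μ).real (boxEvent s (α n) (ξ n) c d)) s ≤
      B * ((if ∃ v, ((Finset.univ.filter fun i => s i = v).card : ℝ) < δ * n then y n ^ (K : ℝ) else 0) +
        ∑ T : Finset (ι → ℤˣ), ∑ k ∈ Finset.range (K + 1),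
          if frequentTypes M s = T then u T k n else 0) := by
    intro s
    have hS0 : 0 ≤ ∑ T : Finset (ι → ℤˣ), ∑ k ∈ Finset.range (K + 1),
        if frequentTypes M s = T then u T k n else 0 :=
      Finset.sum_nonneg fun T _ => Finset.sum_nonneg fun k _ => by
        split_ifs
        · exact hu0 T k
        · exact le_rfl
    have hI0 : 0 ≤ if ∃ v, ((Finset.univ.filter fun i => s i = v).card : ℝ) < δ * n then
        y n ^ (K : ℝ) else 0 := by split_ifs <;> positivity
    by_cases hs : Function.Injective (fun j i => s i j) ∧ ¬IsBalanced δ s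
    · rw [indicator_of_mem (by exact hs)]
      obtain ⟨hinj, hbal⟩ := hs
      have hbal' : ∃ v, ((Finset.univ.filter fun i => s i = v).card : ℝ) < δ * n := by
        simpa [IsBalanced, colCount] using hbal
      rcases hb n s (α n) (ξ n) hn (R.α_pos n) hξ hinj with ⟨_, h⟩ | ⟨k, hk, h⟩
      · refine h.trans ?_
        rw [if_pos hbal', Real.rpow_natCast]
        gcongr
        exact le_add_of_nonneg_right hS0
      · have h1 : u (frequentTypes M s) k n ≤ ∑ T : Finset (ι → ℤˣ), ∑ k ∈ Finset.range (K + 1),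
            if frequentTypes M s = T then u T k n else 0 := by
          have h2 : u (frequentTypes M s) k n ≤ ∑ k ∈ Finset.range (K + 1),
              if frequentTypes M s = frequentTypes M s then u (frequentTypes M s) k n else 0 := by
            simp only [if_true]
            exact Finset.single_le_sum (f := fun k => u (frequentTypes M s) k n)
              (fun k _ => hu0 _ k) (Finset.mem_range.2 (by omega))
          refine h2.trans (Finset.single_le_sum (f := fun T => ∑ k ∈ Finset.range (K + 1),
            if frequentTypes M s = T then u T k n else 0) (fun T _ => ?_) (Finset.mem_univ _))
          refine Finset.sum_nonneg fun k _ => ?_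
          split_ifs
          · exact hu0 T k
          · exact le_rfl
        have h3 : (Measure.pi fun _ : Fin n => μ).real (boxEvent s (α n) (ξ n) c d) ≤
            B * u (frequentTypes M s) k n := by
          simp only [hu]
          rcases h with ⟨h4, h5⟩ | ⟨h4, h5⟩
          · rw [if_pos h4, if_neg h4.ne, add_zero, Real.rpow_natCast]
            exact h5
          · rw [if_neg h4.not_lt, if_pos h4, zero_add, Real.rpow_add hy0, Real.rpow_natCast]
            exact h5
        refine h3.trans ?_
        gcongr
        exact h1.trans (le_add_of_nonneg_left hI0)
    · rw [indicator_of_notMem (by exact hs)]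
      positivity
  refine (Finset.sum_le_sum fun s _ => hpt s).trans (le_of_eq ?_)
  rw [← Finset.mul_sum, Finset.sum_add_distrib]
  congr 2
  · rw [← Finset.sum_filter, Finset.sum_const, nsmul_eq_mul]
  · rw [Finset.sum_comm]
    refine Finset.sum_congr rfl fun T _ => ?_
    rw [Finset.sum_comm]
    refine Finset.sum_congr rfl fun k _ => ?_
    rw [← Finset.sum_filter, Finset.sum_const, nsmul_eq_mul]

/-! ### Typical arrays and balanced arrays with a large overlap -/

variable {α ξ : ℕ → ℝ} {ι : Type*} [Fintype ι] [DecidableEq ι] {μ : Measure ℝ} {M : ℕ} {C Q η : ℝ}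

/-- The threshold below which overlaps do not affect the local limit theorem. -/
noncomputable def overlapThreshold (α : ℕ → ℝ) (n : ℕ) : ℝ :=
  Real.sqrt ((1 + α n ^ 2) / Real.sqrt n) / (1 + α n ^ 2)

theorem overlapThreshold_nonneg (α : ℕ → ℝ) (n : ℕ) : 0 ≤ overlapThreshold α n := by
  unfold overlapThreshold; positivity

theorem ScalingRegime.tendsto_sq_div_sqrt (R : ScalingRegime α ξ) :
    Tendsto (fun n : ℕ => α n ^ 2 / Real.sqrt n) atTop (𝓝 0) := by
  have h := (Real.continuous_sqrt.tendsto _).comp R.tendsto_α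
  rw [Real.sqrt_zero] at h
  refine h.congr fun n => ?_
  rw [Function.comp, Real.sqrt_div (by positivity), show α n ^ 4 = (α n ^ 2) ^ 2 by ring,
    Real.sqrt_sq (by positivity)]

theorem tendsto_one_div_sqrt : Tendsto (fun n : ℕ => 1 / Real.sqrt n) atTop (𝓝 0) :=
  tendsto_const_nhds.div_atTop (Real.tendsto_sqrt_atTop.comp tendsto_natCast_atTop_atTop)

theorem ScalingRegime.tendsto_ratio (R : ScalingRegime α ξ) :
    Tendsto (fun n : ℕ => (1 + α n ^ 2) / Real.sqrt n) atTop (𝓝 0) := by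
  have h := tendsto_one_div_sqrt.add R.tendsto_sq_div_sqrt
  rw [add_zero] at h
  exact h.congr fun n => by rw [add_div]

theorem ScalingRegime.tendsto_mul_overlapThreshold (R : ScalingRegime α ξ) :
    Tendsto (fun n => (1 + α n ^ 2) * overlapThreshold α n) atTop (𝓝 0) := by
  have h := (Real.continuous_sqrt.tendsto _).comp R.tendsto_ratio
  rw [Real.sqrt_zero] at h
  refine h.congr fun n => ?_
  rw [overlapThreshold, Function.comp, mul_div_cancel₀]
  positivity

theorem ScalingRegime.eventually_overlapThreshold_le_one (R : ScalingRegime α ξ) :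
    ∀ᶠ n in atTop, overlapThreshold α n ≤ 1 := by
  filter_upwards [R.tendsto_mul_overlapThreshold.eventually (ge_mem_nhds one_pos)] with n hn
  nlinarith [overlapThreshold_nonneg α n, sq_nonneg (α n)]

/-- With `q = (1 + α²)/√n → 0`, the threshold `θ = √q / (1 + α²)` is a compromise: `(1 + α²) θ = √q
→ 0` keeps the local limit theorem valid, while `n θ² = 1/q → ∞` makes larger overlaps rare. -/
theorem ScalingRegime.tendsto_exp_overlapThreshold (R : ScalingRegime α ξ) :
    Tendsto (fun n : ℕ => Real.exp (-(n * overlapThreshold α n ^ 2 / 4))) atTop (𝓝 0) := by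
  refine Real.tendsto_exp_neg_atTop_nhds_zero.comp (Tendsto.atTop_div_const (by norm_num) ?_)
  have h1 : Tendsto (fun n : ℕ => ((1 + α n ^ 2) / Real.sqrt n)⁻¹) atTop atTop := by
    refine Tendsto.inv_tendsto_nhdsGT_zero ?_
    refine tendsto_nhdsWithin_iff.2 ⟨R.tendsto_ratio, ?_⟩
    filter_upwards [eventually_gt_atTop 0] with n hn
    have : 0 < Real.sqrt n := Real.sqrt_pos.2 (by exact_mod_cast hn)
    exact div_pos (by positivity) this
  refine h1.congr' ?_
  filter_upwards [eventually_gt_atTop 0] with n hn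
  have hs : 0 < Real.sqrt n := Real.sqrt_pos.2 (by exact_mod_cast hn)
  have hs2 : (n : ℝ) = Real.sqrt n ^ 2 := (Real.sq_sqrt (by positivity)).symm
  rw [overlapThreshold, div_pow, Real.sq_sqrt (by positivity)]
  nth_rw 2 [hs2]
  field_simp

theorem ScalingRegime.eventually_tilt_sq_le (R : ScalingRegime α ξ) (K : ℝ) :
    ∀ᶠ n : ℕ in atTop, |2 * (α n ^ 2 / 2)| / n * K ^ 2 ≤ 1 := by
  have h := (R.tendsto_sq_div_sqrt.mul tendsto_one_div_sqrt).mul_const (K ^ 2)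
  rw [zero_mul, zero_mul] at h
  filter_upwards [h.eventually (ge_mem_nhds one_pos)] with n hn
  have h2 : |2 * (α n ^ 2 / 2)| / n = α n ^ 2 / Real.sqrt n * (1 / Real.sqrt n) := by
    rw [mul_div_cancel₀ _ two_ne_zero, abs_of_nonneg (by positivity), div_mul_div_comm, mul_one,
      Real.mul_self_sqrt (by positivity)]
  rw [h2]; exact hn

/-- The arrays to which the local limit theorem applies. -/
def IsTypical (δ θ : ℝ) {n : ℕ} (s : Fin n → ι → ℤˣ) : Prop :=
  IsBalanced δ s ∧ ∀ j k, j ≠ k → |overlap s j k| ≤ θ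

/-- The column type with `-1` at `j` and `1` elsewhere occurs, and such a column distinguishes row
`j` from every other row. -/
theorem IsBalanced.injective {δ : ℝ} (hδ : 0 < δ) {n : ℕ} (hn : 0 < n) {s : Fin n → ι → ℤˣ}
    (h : IsBalanced δ s) : Function.Injective fun j i => s i j := by
  intro j k hjk
  by_contra hne
  have hn' : (0 : ℝ) < n := by exact_mod_cast hn
  have h1 := h (Function.update 1 j (-1))
  have h2 : (0 : ℝ) < colCount s (Function.update 1 j (-1)) := lt_of_lt_of_le (by positivity) h1
  have h3 : 0 < colCount s (Function.update 1 j (-1)) := by exact_mod_cast h2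
  obtain ⟨i, hi⟩ := Finset.card_pos.1 h3
  have h4 := (Finset.mem_filter.1 hi).2
  have h5 : s i j = s i k := congrFun hjk i
  rw [h4, Function.update_self, Function.update_of_ne (Ne.symm hne)] at h5
  rw [Pi.one_apply] at h5
  exact absurd h5 (by decide)

/-- The uniform form of the local limit theorem. -/
theorem eventually_abs_measureReal_sub_le (H : LaplaceBounds μ M C Q η) (R : ScalingRegime α ξ)
    {δ : ℝ} (hδ : 0 < δ) {c d : ι → ℝ} (hcd : ∀ j, c j < d j) {ε : ℝ} (hε : 0 < ε) :
    ∀ᶠ n : ℕ in atTop, ∀ s : Fin n → ι → ℤˣ, IsTypical δ (overlapThreshold α n) s →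
      |(Measure.pi fun _ : Fin n => μ).real (boxEvent s (α n) (ξ n) c d) /
        (ξ n * Real.exp (-(α n ^ 2 / 2))) ^ Fintype.card ι -
        (∏ j, (d j - c j)) * (Real.sqrt (2 * Real.pi))⁻¹ ^ Fintype.card ι| ≤ ε := by
  obtain ⟨w, hw⟩ := exists_signMatrix_det_ne_zero (κ := ι)
  -- Convergence along this filter on pairs of a size and a typical array of that size is
  -- convergence uniform over typical arrays.
  obtain ⟨l, hl⟩ : ∃ l : Filter (Σ n : ℕ, Fin n → ι → ℤˣ), l = comap Sigma.fst atTop ⊓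
    𝓟 {b | IsTypical δ (overlapThreshold α b.1) b.2} := ⟨_, rfl⟩
  have hgen : l.IsCountablyGenerated := hl ▸ inferInstance
  have hN : Tendsto (Sigma.fst : (Σ n : ℕ, Fin n → ι → ℤˣ) → ℕ) l atTop :=
    hl ▸ tendsto_comap.mono_left inf_le_left
  have hev : ∀ᶠ b in l, IsTypical δ (overlapThreshold α b.1) b.2 :=
    hl ▸ mem_inf_of_right (mem_principal_self _)
  have hR := R.limitRegime hN
  have hθ := R.tendsto_mul_overlapThreshold.comp hN
  have hbal : ∀ᶠ b in l, IsBalanced δ b.2 := hev.mono fun b hb => hb.1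
  have hov : ∀ᶠ b in l, ∀ j k, j ≠ k → |overlap b.2 j k| ≤ overlapThreshold α b.1 :=
    hev.mono fun b hb => hb.2
  have hθ0 : ∀ b : Σ n : ℕ, Fin n → ι → ℤˣ, 0 ≤ overlapThreshold α b.1 :=
    fun b => overlapThreshold_nonneg α b.1
  have h := tendsto_measureReal_boxEvent (β := Σ n : ℕ, Fin n → ι → ℤˣ) (s := fun b => b.2) H hR hw hδ
    (θ := fun b => overlapThreshold α b.1) hθ0 hθ hov hbal hcd
  have h2 := (tendsto_order.1 (tendsto_iff_norm_sub_tendsto_zero.1 h)).2 ε hε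
  rw [hl, eventually_inf_principal, eventually_comap] at h2
  filter_upwards [h2] with n hn s hs
  exact (hn ⟨n, s⟩ rfl hs).le

theorem tendsto_card_typical (R : ScalingRegime α ξ) {δ : ℝ}
    (hδ : Tendsto (fun n : ℕ => ((Finset.univ.filter fun s : Fin n → ι → ℤˣ =>
        ∃ v, (colCount s v : ℝ) < δ * n).card : ℝ) / ((2 : ℝ) ^ Fintype.card ι) ^ n) atTop (𝓝 0)) :
    Tendsto (fun n : ℕ => (∑ s : Fin n → ι → ℤˣ,
      {s | IsTypical δ (overlapThreshold α n) s}.indicator (fun _ => (1 : ℝ)) s) /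
        ((2 : ℝ) ^ Fintype.card ι) ^ n) atTop (𝓝 1) := by
  set K := Fintype.card ι with hK
  have hov : Tendsto (fun n : ℕ => ((Finset.univ.filter fun s : Fin n → ι → ℤˣ =>
      ¬∀ j k, j ≠ k → |overlap s j k| ≤ overlapThreshold α n).card : ℝ) / ((2 : ℝ) ^ K) ^ n)
      atTop (𝓝 0) := by
    have h1 := R.tendsto_exp_overlapThreshold.const_mul (2 * (K : ℝ) ^ 2)
    rw [mul_zero] at h1
    refine squeeze_zero' (Eventually.of_forall fun n => by positivity) ?_ h1
    filter_upwards [R.eventually_overlapThreshold_le_one, eventually_gt_atTop 0] with n h2 h3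
    rw [div_le_iff₀ (by positivity)]
    refine (card_overlap_gt_le h3 (overlapThreshold_nonneg α n) h2).trans (le_of_eq ?_)
    ring
  have hlow : Tendsto (fun n : ℕ => 1 - (((Finset.univ.filter fun s : Fin n → ι → ℤˣ =>
        ∃ v, (colCount s v : ℝ) < δ * n).card : ℝ) / ((2 : ℝ) ^ K) ^ n +
      ((Finset.univ.filter fun s : Fin n → ι → ℤˣ =>
        ¬∀ j k, j ≠ k → |overlap s j k| ≤ overlapThreshold α n).card : ℝ) / ((2 : ℝ) ^ K) ^ n))
      atTop (𝓝 1) := by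
    simpa using (hδ.add hov).const_sub 1
  have hcard : ∀ n, ∑ _s : Fin n → ι → ℤˣ, (1 : ℝ) = ((2 : ℝ) ^ K) ^ n := by
    intro n
    simp [hK]
  refine tendsto_of_tendsto_of_tendsto_of_le_of_le hlow tendsto_const_nhds (fun n => ?_) fun n => ?_
  · simp only
    rw [← add_div, le_div_iff₀ (by positivity), sub_mul, div_mul_cancel₀ _ (by positivity), one_mul,
      ← hcard, sub_le_iff_le_add, Finset.card_filter, Finset.card_filter]
    push_cast
    rw [← Finset.sum_add_distrib, ← Finset.sum_add_distrib]
    refine Finset.sum_le_sum fun s _ => ?_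
    by_cases hs : IsTypical δ (overlapThreshold α n) s
    · rw [indicator_of_mem (by exact hs)]
      refine le_add_of_nonneg_right (add_nonneg ?_ ?_) <;> split_ifs <;> norm_num
    · rw [indicator_of_notMem (by exact hs), zero_add]
      by_cases hb : IsBalanced δ s
      · have h1 : ¬∀ j k, j ≠ k → |overlap s j k| ≤ overlapThreshold α n := fun h => hs ⟨hb, h⟩
        rw [if_pos h1]
        refine le_add_of_nonneg_left ?_
        split_ifs <;> norm_num
      · have h1 : ∃ v, (colCount s v : ℝ) < δ * n := by simpa [IsBalanced] using hb
        rw [if_pos h1]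
        refine le_add_of_nonneg_right ?_
        split_ifs <;> norm_num
  · simp only
    rw [div_le_one (by positivity), ← hcard]
    exact Finset.sum_le_sum fun s _ => indicator_le_self' (fun _ _ => zero_le_one) s

theorem ScalingRegime.tendsto_pow (R : ScalingRegime α ξ) (K : ℕ) :
    Tendsto (fun n : ℕ => (ξ n * Real.exp (-(α n ^ 2 / 2))) ^ K * ((2 : ℝ) ^ K) ^ n) atTop
      (𝓝 (Real.sqrt (2 * Real.pi) ^ K)) := by
  refine (R.tendsto_ξ.pow K).congr fun n => ?_
  rw [mul_pow, ← pow_mul, ← pow_mul, mul_comm n K]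
  ring

/-- The contribution of the typical arrays. -/
theorem tendsto_sum_typical (H : LaplaceBounds μ M C Q η) (R : ScalingRegime α ξ)
    {δ : ℝ} (hδ : 0 < δ)
    (hδ' : Tendsto (fun n : ℕ => ((Finset.univ.filter fun s : Fin n → ι → ℤˣ =>
        ∃ v, (colCount s v : ℝ) < δ * n).card : ℝ) / ((2 : ℝ) ^ Fintype.card ι) ^ n) atTop (𝓝 0))
    {c d : ι → ℝ} (hcd : ∀ j, c j < d j) :
    Tendsto (fun n : ℕ => ∑ s : Fin n → ι → ℤˣ,
      {s | IsTypical δ (overlapThreshold α n) s}.indicator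
        (fun s => (Measure.pi fun _ : Fin n => μ).real (boxEvent s (α n) (ξ n) c d)) s)
      atTop (𝓝 (∏ j, (d j - c j))) := by
  set K := Fintype.card ι with hK
  set G : ℝ := (Real.sqrt (2 * Real.pi))⁻¹ with hG
  set L : ℝ := (∏ j, (d j - c j)) * G ^ K with hL
  set W : ℕ → ℝ := fun n => (ξ n * Real.exp (-(α n ^ 2 / 2))) ^ K with hW
  set P : ∀ n : ℕ, (Fin n → ι → ℤˣ) → ℝ := fun n s =>
    (Measure.pi fun _ : Fin n => μ).real (boxEvent s (α n) (ξ n) c d) with hP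
  set g : ∀ n : ℕ, Set (Fin n → ι → ℤˣ) := fun n => {s | IsTypical δ (overlapThreshold α n) s} with hg
  have hcard := tendsto_card_typical R hδ'
  have hdiff : Tendsto (fun n : ℕ => (∑ s, (g n).indicator (fun s => P n s / W n - L) s) /
      ((2 : ℝ) ^ K) ^ n) atTop (𝓝 0) := by
    rw [Metric.tendsto_nhds]
    intro ε hε
    filter_upwards [eventually_abs_measureReal_sub_le H R hδ hcd (half_pos hε)] with n hn
    rw [dist_zero_right, norm_div, Real.norm_of_nonneg (by positivity : (0 : ℝ) ≤ (2 ^ K) ^ n),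
      div_lt_iff₀ (by positivity)]
    calc _ ≤ ∑ _s : Fin n → ι → ℤˣ, ε / 2 := by
          refine (norm_sum_le _ _).trans (Finset.sum_le_sum fun s _ => ?_)
          by_cases hs : s ∈ g n
          · rw [indicator_of_mem hs]; exact hn s hs
          · rw [indicator_of_notMem hs, norm_zero]; positivity
      _ = ε / 2 * ((2 : ℝ) ^ K) ^ n := by simp [hK, mul_comm]
      _ < _ := by
          have : (0 : ℝ) < ((2 : ℝ) ^ K) ^ n := by positivity
          nlinarith
  have h1 := ((hdiff.add (hcard.mul_const L)).mul (R.tendsto_pow K))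
  have h2 : (0 + 1 * L) * Real.sqrt (2 * Real.pi) ^ K = ∏ j, (d j - c j) := by
    rw [zero_add, one_mul, hL, mul_assoc, ← mul_pow, hG, inv_mul_cancel₀ (by positivity), one_pow,
      mul_one]
  rw [h2] at h1
  refine h1.congr' ?_
  filter_upwards [R.ξ_pos] with n hn
  have hW0 : W n ≠ 0 := by simp only [hW]; positivity
  have hV0 : (((2 : ℝ) ^ K) ^ n) ≠ 0 := by positivity
  have h3 : ∀ s, (g n).indicator (fun s => P n s) s =
      ((g n).indicator (fun s => P n s / W n - L) s + (g n).indicator (fun _ => (1 : ℝ)) s * L) * W n := by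
    intro s
    by_cases hs : s ∈ g n
    · simp only [indicator_of_mem hs]; field_simp; ring
    · simp only [indicator_of_notMem hs]; ring
  change _ = ∑ s, (g n).indicator (fun s => P n s) s
  simp_rw [h3]
  rw [← Finset.sum_mul, Finset.sum_add_distrib, ← Finset.sum_mul, div_mul_eq_mul_div, ← add_div,
    div_mul_eq_mul_div, div_eq_iff hV0]
  ring

/-- Balanced arrays with a large overlap do not contribute. -/
theorem tendsto_sum_overlap_gt (H : LaplaceBounds μ M C Q η) (R : ScalingRegime α ξ)
    {δ : ℝ} (hδ : 0 < δ) {c d : ι → ℝ} (hcd : ∀ j, c j < d j) :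
    Tendsto (fun n : ℕ => ∑ s : Fin n → ι → ℤˣ,
      {s | IsBalanced δ s ∧ ¬∀ j k, j ≠ k → |overlap s j k| ≤ overlapThreshold α n}.indicator
        (fun s => (Measure.pi fun _ : Fin n => μ).real (boxEvent s (α n) (ξ n) c d)) s)
      atTop (𝓝 0) := by
  obtain ⟨w, hw⟩ := exists_signMatrix_det_ne_zero (κ := ι)
  obtain ⟨B, τ, hB, hτ, n₀, hb⟩ := H.exists_measureReal_boxEvent_le hw hδ hcd
  set K := Fintype.card ι with hK
  set W : ℕ → ℝ := fun n => (ξ n * Real.exp (-(α n ^ 2 / 2))) ^ K with hW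
  have hR := R.limitRegime (tendsto_id (α := ℕ))
  -- Cauchy-Schwarz bounds the sum of the weights by `2^{Kn} √U`. The product `W 2^{Kn}` converges,
  -- and `U → 0` since its last factor is the exponential of `K⁴ α⁴/n`.
  set U : ℕ → ℝ := fun n => 2 * (K : ℝ) ^ 2 * Real.exp (-(n * overlapThreshold α n ^ 2 / 4)) *
    Real.exp ((2 * (α n ^ 2 / 2)) ^ 2 / n * (K : ℝ) ^ 4) with hU
  have hU0 : Tendsto U atTop (𝓝 0) := by
    have h1 : Tendsto (fun n : ℕ => Real.exp ((2 * (α n ^ 2 / 2)) ^ 2 / n * (K : ℝ) ^ 4)) atTop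
        (𝓝 (Real.exp (0 * (K : ℝ) ^ 4))) := by
      refine (Real.continuous_exp.tendsto _).comp ((R.tendsto_α.congr fun n => ?_).mul_const _)
      ring
    simpa using (R.tendsto_exp_overlapThreshold.const_mul (2 * (K : ℝ) ^ 2)).mul h1
  have hlim := ((R.tendsto_pow K).const_mul B).mul ((Real.continuous_sqrt.tendsto _).comp hU0)
  rw [Real.sqrt_zero, mul_zero] at hlim
  refine squeeze_zero' (Eventually.of_forall fun n => Finset.sum_nonneg fun s _ =>
    indicator_nonneg (fun _ _ => measureReal_nonneg) _) ?_ hlim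
  filter_upwards [R.ξ_pos, hR.eventually_pow_le, hR.eventually_tilt_le K hτ,
    hR.tendsto_αξ.eventually (ge_mem_nhds one_pos), R.eventually_overlapThreshold_le_one,
    R.eventually_tilt_sq_le K, eventually_ge_atTop n₀, eventually_gt_atTop 0]
    with n h1 h2 h3 h4 h5 h6 h7 h8
  have hsq := sq_sum_exp_overlap_gt_le h8 (overlapThreshold_nonneg α n) h5 h6
  set Sg : ℝ := ∑ s ∈ Finset.univ.filter fun s : Fin n → ι → ℤˣ =>
    ¬∀ j k, j ≠ k → |overlap s j k| ≤ overlapThreshold α n,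
      Real.exp (α n ^ 2 / 2 * (meanSqColSum s - K)) with hSg
  have hS : Sg ≤ ((2 : ℝ) ^ K) ^ n * Real.sqrt (U n) := by
    have h9 := Real.le_sqrt_of_sq_le hsq
    rwa [Real.sqrt_mul (by positivity), Real.sqrt_sq (by positivity)] at h9
  have hle : ∑ s : Fin n → ι → ℤˣ,
      {s | IsBalanced δ s ∧ ¬∀ j k, j ≠ k → |overlap s j k| ≤ overlapThreshold α n}.indicator
        (fun s => (Measure.pi fun _ : Fin n => μ).real (boxEvent s (α n) (ξ n) c d)) s ≤
      B * W n * Sg := by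
    rw [hSg, Finset.mul_sum, Finset.sum_filter]
    refine Finset.sum_le_sum fun s _ => ?_
    by_cases hs : IsBalanced δ s ∧ ¬∀ j k, j ≠ k → |overlap s j k| ≤ overlapThreshold α n
    · rw [indicator_of_mem (by exact hs), if_pos hs.2]
      refine (hb n h7 (α n) (ξ n) s h2 h3 h1 h4 hs.1).trans (le_of_eq ?_)
      congr 2; ring
    · rw [indicator_of_notMem (by exact hs)]
      have : 0 ≤ W n := by simp only [hW]; positivity
      split_ifs <;> positivity
  refine hle.trans ?_
  have hW0 : 0 ≤ W n := by simp only [hW]; positivity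
  calc B * W n * Sg ≤ B * W n * (((2 : ℝ) ^ K) ^ n * Real.sqrt (U n)) := by gcongr
    _ = _ := by simp only [hW, Function.comp]; ring

/-- The sum over all arrays with distinct rows of the probability of the windows. -/
theorem tendsto_sum_injective {ρ : ℝ → ℝ} (hρ : Admissible ρ) (R : ScalingRegime α ξ) {c d : ι → ℝ}
    (hc : ∀ j, 0 ≤ c j) (hcd : ∀ j, c j < d j) :
    Tendsto (fun n : ℕ => ∑ s : Fin n → ι → ℤˣ,
      {s | Function.Injective fun j i => s i j}.indicator
        (fun s => (weightLaw ρ n).real (boxEvent s (α n) (ξ n) c d)) s)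
      atTop (𝓝 (∏ j, (d j - c j))) := by
  obtain ⟨M, C, Q, η, H⟩ := hρ.exists_laplaceBounds
  obtain ⟨C₀, β, hβ, hC₀, hμ⟩ := hρ.exists_measureReal_Icc_le
  have := hρ.isProbabilityMeasure
  have hintg : Integrable fun u : ℝ => ‖laplace (singleLaw ρ) (2 * Real.pi * u * Complex.I)‖ ^ M := by
    simpa using H.integrable_pow 0 (by simpa using H.η_pos.le)
  obtain ⟨δ, hδ, hδ', hunb⟩ := exists_tendsto_sum_unbalanced hintg hC₀ hβ hμ hc hcd
  -- For `n > 0`, arrays with distinct rows split into typical ones, balanced ones with a large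
  -- overlap, and unbalanced ones; balanced arrays have distinct rows automatically.
  have h1 := ((tendsto_sum_typical H R hδ hδ' hcd).add (tendsto_sum_overlap_gt H R hδ hcd)).add (hunb R)
  rw [add_zero, add_zero] at h1
  refine h1.congr' ?_
  filter_upwards [eventually_gt_atTop 0] with n hn
  rw [← Finset.sum_add_distrib, ← Finset.sum_add_distrib]
  refine Finset.sum_congr rfl fun s _ => ?_
  classical
  simp only [indicator_apply, mem_ofPred_eq, IsTypical, weightLaw_eq]
  by_cases hb : IsBalanced δ s
  · have hi := hb.injective hδ hn
    by_cases ho : ∀ j k, j ≠ k → |overlap s j k| ≤ overlapThreshold α n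
    · rw [if_pos ⟨hb, ho⟩, if_neg fun h => h.2 ho, if_neg fun h => h.2 hb, if_pos hi]; simp
    · rw [if_neg fun h => ho h.2, if_pos ⟨hb, ho⟩, if_neg fun h => h.2 hb, if_pos hi]; simp
  · by_cases hi : Function.Injective fun j i => s i j
    · simp [hb, hi]
    · simp [hb, hi]

/-! ### The continuous density of the energy and its asymptotics -/

section Inversion

variable {Ω : Type*} [MeasurableSpace Ω] {P : Measure Ω} [IsProbabilityMeasure P] {S : Ω → ℝ}
  {ψ : ℝ → ℂ}

/-- Fourier inversion of the test function and self-adjointness of the Fourier transform: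
integrating against the law amounts to integrating against `𝓕 ψ`. -/
theorem integral_schwartz_comp_eq (hS : Measurable S) (hψ : Integrable ψ)
    (h1 : ∀ f : ℝ, ∫ ω, Complex.exp (2 * Real.pi * (f * S ω) * Complex.I) ∂P = ψ f) (h : 𝓢(ℝ, ℂ)) :
    ∫ ω, h (S ω) ∂P = ∫ y, h y * 𝓕 ψ y := by
  have h2 : ∀ ω, h (S ω) = ∫ f : ℝ, 𝓕 h f * Complex.exp (2 * Real.pi * (f * S ω) * Complex.I) := by
    intro ω
    have := schwartz_eq_integral_fourier h one_pos (S ω)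
    simpa using this
  have h3 : ∫ ω, h (S ω) ∂P = ∫ f, 𝓕 h f * ψ f := by
    simp_rw [h2]
    rw [integral_integral_swap]
    · congr 1; ext f
      rw [integral_const_mul, h1]
    · have h4 : Integrable (fun p : Ω × ℝ => 𝓕 h p.2) (P.prod volume) :=
        (𝓕 h).integrable.comp_snd P
      refine h4.mul_bdd (c := 1) ?_ (Eventually.of_forall fun p => ?_)
      · refine Measurable.aestronglyMeasurable ?_
        fun_prop
      · rw [Complex.norm_exp]; simp
  rw [h3]
  have h5 := VectorFourier.integral_fourierIntegral_smul_eq_flip (L := innerₗ ℝ) (μ := volume)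
    (ν := volume) Real.continuous_fourierChar (by fun_prop) h.integrable hψ
  rw [flip_innerₗ] at h5
  rw [SchwartzMap.fourier_coe]
  simp only [smul_eq_mul] at h5
  exact h5

/-- Cutoffs with collars of width `1/(k+1)` decrease to the indicator of the closed interval;
dominated convergence applies on both sides. -/
theorem measureReal_Icc_eq_setIntegral_fourier (hS : Measurable S) (hψ : Integrable ψ)
    (h1 : ∀ f : ℝ, ∫ ω, Complex.exp (2 * Real.pi * (f * S ω) * Complex.I) ∂P = ψ f) {a b : ℝ}
    (hab : a < b) : (P.real (S ⁻¹' Icc a b) : ℂ) = ∫ y in Icc a b, 𝓕 ψ y := by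
  have hε : ∀ k : ℕ, (0 : ℝ) < 1 / ((k : ℝ) + 1) := fun k => by positivity
  choose h hh using fun k : ℕ => exists_isCutoff hab (hε k)
  have hle1 : ∀ k : ℕ, 1 / ((k : ℝ) + 1) ≤ 1 := fun k => by
    rw [div_le_one (by positivity)]
    have : (0 : ℝ) ≤ k := by positivity
    linarith
  have hpt : ∀ y, Tendsto (fun k => h k y) atTop (𝓝 ((Icc a b).indicator (fun _ => (1 : ℂ)) y)) := by
    intro y
    by_cases hy : y ∈ Icc a b
    · rw [indicator_of_mem hy]
      refine tendsto_const_nhds.congr fun k => ?_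
      rw [← (hh k).ofReal_re, (hh k).eq_one y hy, Complex.ofReal_one]
    · rw [indicator_of_notMem hy]
      refine tendsto_const_nhds.congr' ?_
      have h2 : ∀ᶠ k : ℕ in atTop, y ∉ Icc (a - 1 / ((k : ℝ) + 1)) (b + 1 / ((k : ℝ) + 1)) := by
        have h3 := tendsto_one_div_add_atTop_nhds_zero_nat (𝕜 := ℝ)
        rw [mem_Icc, not_and_or, not_le, not_le] at hy
        rcases hy with hy | hy
        · filter_upwards [h3.eventually (gt_mem_nhds (sub_pos.2 hy))] with k hk hmem
          linarith [hmem.1]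
        · filter_upwards [h3.eventually (gt_mem_nhds (sub_pos.2 hy))] with k hk hmem
          linarith [hmem.2]
      filter_upwards [h2] with k hk
      rw [← (hh k).ofReal_re, (hh k).eq_zero y hk, Complex.ofReal_zero]
  have hcont := continuous_fourier_of_integrable hψ
  have hL : Tendsto (fun k => ∫ ω, h k (S ω) ∂P) atTop
      (𝓝 (∫ ω, (Icc a b).indicator (fun _ => (1 : ℂ)) (S ω) ∂P)) := by
    refine tendsto_integral_of_dominated_convergence (fun _ => 1) (fun k => ?_) (integrable_const 1)
      (fun k => Eventually.of_forall fun ω => ?_) (Eventually.of_forall fun ω => hpt (S ω))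
    · exact ((h k).continuous.measurable.comp hS).aestronglyMeasurable
    · rw [(hh k).norm_eq]; exact (hh k).le_one _
  have hR : Tendsto (fun k => ∫ y, h k y * 𝓕 ψ y) atTop
      (𝓝 (∫ y, (Icc a b).indicator (fun _ => (1 : ℂ)) y * 𝓕 ψ y)) := by
    refine tendsto_integral_of_dominated_convergence
      ((Icc (a - 1) (b + 1)).indicator fun y => ‖𝓕 ψ y‖) (fun k => ?_) ?_
      (fun k => Eventually.of_forall fun y => ?_)
      (Eventually.of_forall fun y => (hpt y).mul_const _)
    · exact ((h k).continuous.mul hcont).aestronglyMeasurable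
    · exact (integrable_indicator_iff measurableSet_Icc).2 hcont.norm.continuousOn.integrableOn_Icc
    · rw [norm_mul, (hh k).norm_eq]
      by_cases hy : y ∈ Icc (a - 1) (b + 1)
      · rw [indicator_of_mem hy]
        exact mul_le_of_le_one_left (norm_nonneg _) ((hh k).le_one y)
      · rw [indicator_of_notMem hy, (hh k).eq_zero y, zero_mul]
        refine fun hmem => hy ⟨?_, ?_⟩
        · linarith [hmem.1, hle1 k]
        · linarith [hmem.2, hle1 k]
  have heq : ∫ ω, (Icc a b).indicator (fun _ => (1 : ℂ)) (S ω) ∂P =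
      ∫ y, (Icc a b).indicator (fun _ => (1 : ℂ)) y * 𝓕 ψ y :=
    tendsto_nhds_unique hL (hR.congr fun k => (integral_schwartz_comp_eq hS hψ h1 (h k)).symm)
  have e1 : ∫ ω, (Icc a b).indicator (fun _ => (1 : ℂ)) (S ω) ∂P = (P.real (S ⁻¹' Icc a b) : ℂ) := by
    have : ∀ ω, (Icc a b).indicator (fun _ => (1 : ℂ)) (S ω) =
        (S ⁻¹' Icc a b).indicator (fun _ => (1 : ℂ)) ω := fun ω => rfl
    simp_rw [this]
    rw [integral_indicator (hS measurableSet_Icc), setIntegral_const]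
    simp
  have e2 : ∫ y, (Icc a b).indicator (fun _ => (1 : ℂ)) y * 𝓕 ψ y = ∫ y in Icc a b, 𝓕 ψ y := by
    rw [← integral_indicator measurableSet_Icc]
    congr 1; ext y
    by_cases hy : y ∈ Icc a b <;> simp [hy]
  rw [← e1, heq, e2]

/-- A random variable with an integrable characteristic function has a continuous density. -/
theorem exists_continuous_density (hS : Measurable S) (hψ : Integrable ψ)
    (h1 : ∀ f : ℝ, ∫ ω, Complex.exp (2 * Real.pi * (f * S ω) * Complex.I) ∂P = ψ f) {a b : ℝ}
    (hab : a < b) : P.real (S ⁻¹' Icc a b) = ∫ y in Icc a b, (𝓕 ψ y).re := by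
  have h2 := measureReal_Icc_eq_setIntegral_fourier hS hψ h1 hab
  have hcont := continuous_fourier_of_integrable hψ
  have h3 : Integrable (𝓕 ψ) (volume.restrict (Icc a b)) := hcont.continuousOn.integrableOn_Icc
  have h4 := integral_re h3
  simp only [RCLike.re_to_complex] at h4
  rw [h4, ← h2, Complex.ofReal_re]

/-- A negative value would persist on a short interval by continuity and give it negative
probability. -/
theorem fourier_re_nonneg (hS : Measurable S) (hψ : Integrable ψ)
    (h1 : ∀ f : ℝ, ∫ ω, Complex.exp (2 * Real.pi * (f * S ω) * Complex.I) ∂P = ψ f) (y : ℝ) :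
    0 ≤ (𝓕 ψ y).re := by
  by_contra hy
  push Not at hy
  have hcont : Continuous fun y => (𝓕 ψ y).re :=
    Complex.continuous_re.comp (continuous_fourier_of_integrable hψ)
  obtain ⟨ε, hε, hball⟩ := Metric.eventually_nhds_iff.1
    (hcont.continuousAt.eventually (gt_mem_nhds (show (𝓕 ψ y).re < (𝓕 ψ y).re / 2 by linarith)))
  have h2 := exists_continuous_density hS hψ h1 (show y < y + ε / 2 by linarith)
  have h3 : ∫ z in Icc y (y + ε / 2), (𝓕 ψ z).re ≤ ∫ _z in Icc y (y + ε / 2), (𝓕 ψ y).re / 2 := by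
    refine setIntegral_mono_on hcont.continuousOn.integrableOn_Icc (by simp) measurableSet_Icc
      fun z hz => (hball ?_).le
    rw [Real.dist_eq, abs_of_nonneg (by linarith [hz.1])]
    linarith [hz.2]
  rw [setIntegral_const, Real.volume_real_Icc_of_le (by linarith), smul_eq_mul, ← h2] at h3
  have h4 : (0 : ℝ) ≤ P.real (S ⁻¹' Icc y (y + ε / 2)) := measureReal_nonneg
  nlinarith

end Inversion

/-- The normalized signed sum of a configuration. -/
noncomputable def signedSum {n : ℕ} (σ : Config n) (X : Fin n → ℝ) : ℝ :=
  (∑ i, ((σ i : ℤ) : ℝ) * X i) / Real.sqrt n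

theorem measurable_signedSum {n : ℕ} (σ : Config n) : Measurable (signedSum σ) := by
  unfold signedSum; fun_prop

theorem energy_eq_abs {n : ℕ} (X : Fin n → ℝ) (σ : Config n) : energy X σ = |signedSum σ X| := by
  rw [energy, signedSum, abs_div, abs_of_nonneg (Real.sqrt_nonneg _)]
  ring

theorem signedSum_neg {n : ℕ} (X : Fin n → ℝ) (σ : Config n) : signedSum (-σ) X = -signedSum σ X := by
  simp [signedSum, neg_div]

variable {ρ : ℝ → ℝ}

/-- Evenness of `ρ` removes the signs, which is why one density serves all configurations. -/
theorem Admissible.charFun_signedSum (hρ : Admissible ρ) {n : ℕ} (σ : Config n) (f : ℝ) :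
    ∫ X, Complex.exp (2 * Real.pi * (f * signedSum σ X) * Complex.I) ∂(weightLaw ρ n) =
      laplace (singleLaw ρ) (2 * Real.pi * ((f / Real.sqrt n : ℝ) : ℂ) * Complex.I) ^ n := by
  have := hρ.isProbabilityMeasure
  set z : ℂ := 2 * Real.pi * ((f / Real.sqrt n : ℝ) : ℂ) * Complex.I with hz
  have h1 : ∀ X : Fin n → ℝ, (2 * Real.pi * (f * signedSum σ X) * Complex.I : ℂ) =
      ∑ i, (((σ i : ℤ) : ℂ) * z) * X i := by
    intro X
    rw [signedSum, hz]
    push_cast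
    rw [Finset.sum_div, Finset.mul_sum, Finset.mul_sum, Finset.sum_mul]
    refine Finset.sum_congr rfl fun i _ => ?_
    ring
  simp_rw [h1]
  rw [weightLaw_eq, integral_prod_exp]
  have h2 : ∀ i, laplace (singleLaw ρ) (((σ i : ℤ) : ℂ) * z) = laplace (singleLaw ρ) z := by
    intro i
    rcases Int.units_eq_one_or (σ i) with h | h
    · simp [h]
    · simp [h, hρ.laplace_neg]
  simp_rw [h2]
  simp

/-- For large `n` the energy has a continuous density. -/
theorem Admissible.eventually_exists_density (hρ : Admissible ρ) :
    ∀ᶠ n in atTop, ∃ g, IsContinuousEnergyDensity ρ n g := by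
  obtain ⟨M, C, Q, η, H⟩ := hρ.exists_laplaceBounds
  have := hρ.isProbabilityMeasure
  filter_upwards [eventually_ge_atTop M, eventually_gt_atTop 0] with n hnM hn
  have hs0 : 0 < Real.sqrt n := Real.sqrt_pos.2 (by exact_mod_cast hn)
  set φ : ℝ → ℂ := fun u => laplace (singleLaw ρ) (2 * Real.pi * u * Complex.I) with hφ
  have hφc : Continuous φ := by
    simpa [hφ] using H.continuous 0 (by simpa using H.η_pos.le)
  have hφM : Integrable fun u => ‖φ u‖ ^ M := by
    simpa [hφ] using H.integrable_pow 0 (by simpa using H.η_pos.le)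
  have hφ1 : ∀ u, ‖φ u‖ ≤ 1 := fun u => norm_laplace_le_one _ (by simp)
  set ψ : ℝ → ℂ := fun f => φ (f / Real.sqrt n) ^ n with hψdef
  -- For `n ≥ M` the `n`-th power of a transform bounded by one is dominated by its integrable
  -- `M`-th power.
  have hψ : Integrable ψ := by
    have h1 : Integrable fun u => φ u ^ n := by
      refine hφM.mono' (hφc.pow n).aestronglyMeasurable (Eventually.of_forall fun u => ?_)
      rw [norm_pow]
      exact pow_le_pow_of_le_one (norm_nonneg _) (hφ1 u) hnM
    exact (integrable_comp_div_iff (fun u => φ u ^ n) hs0.ne').2 h1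
  have hprob : IsProbabilityMeasure (weightLaw ρ n) := by rw [weightLaw_eq]; infer_instance
  have hchar : ∀ (σ : Config n) (f : ℝ), ∫ X, Complex.exp
      (2 * Real.pi * (f * signedSum σ X) * Complex.I) ∂(weightLaw ρ n) = ψ f := fun σ f => by
    rw [hρ.charFun_signedSum]
  set p : ℝ → ℝ := fun y => (𝓕 ψ y).re with hp
  have hpc : Continuous p := Complex.continuous_re.comp (continuous_fourier_of_integrable hψ)
  have hp0 : ∀ y, 0 ≤ p y := fourier_re_nonneg (measurable_signedSum 1) hψ (hchar 1)
  have hgc : Continuous fun y => p y + p (-y) := hpc.add (hpc.comp continuous_neg)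
  refine ⟨fun y => p y + p (-y), fun y => add_nonneg (hp0 _) (hp0 _), hgc.continuousOn, fun σ => ?_⟩
  have hEm : Measurable fun X => energy X σ := by
    simp_rw [energy_eq_abs]
    exact continuous_abs.measurable.comp (measurable_signedSum σ)
  have : IsProbabilityMeasure ((weightLaw ρ n).map fun X => energy X σ) :=
    Measure.isProbabilityMeasure_map hEm.aemeasurable
  have hatom : ∀ t : ℝ, 0 < t → (weightLaw ρ n) {X | energy X σ ≤ t} =
      ENNReal.ofReal (∫ y in (-t)..t, p y) := by
    intro t ht
    have hset : {X | energy X σ ≤ t} = signedSum σ ⁻¹' Icc (-t) t := by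
      ext X; simp [energy_eq_abs, abs_le]
    rw [hset, ← ofReal_measureReal,
      exists_continuous_density (measurable_signedSum σ) hψ (hchar σ) (by linarith),
      intervalIntegral.integral_of_le (by linarith), integral_Icc_eq_integral_Ioc]
  have hsym : ∀ t : ℝ, ∫ y in (-t)..t, p y = ∫ y in (0 : ℝ)..t, (p y + p (-y)) := by
    intro t
    rw [intervalIntegral.integral_add (hpc.intervalIntegrable _ _)
      (show IntervalIntegrable (fun y => p (-y)) volume 0 t from
        (hpc.comp continuous_neg).intervalIntegrable _ _),
      intervalIntegral.integral_comp_neg (fun y => p y), neg_zero, add_comm,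
      intervalIntegral.integral_add_adjacent_intervals (hpc.intervalIntegrable _ _)
        (hpc.intervalIntegrable _ _)]
  refine Measure.ext_of_Iic _ _ fun t => ?_
  rw [Measure.map_apply hEm measurableSet_Iic, withDensity_apply _ measurableSet_Iic,
    Measure.restrict_restrict measurableSet_Iic]
  -- At `t = 0` one has to exclude an atom; its mass is bounded by that of `[0, t]` as `t` decreases
  -- to 0.
  rcases lt_trichotomy t 0 with ht | rfl | ht
  · have h1 : Iic t ∩ Ici (0 : ℝ) = ∅ := by
      ext y; simp only [mem_inter_iff, mem_Iic, mem_Ici, mem_empty_iff_false, iff_false, not_and]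
      intro hy; linarith
    have h2 : (fun X => energy X σ) ⁻¹' Iic t = ∅ := by
      ext X
      simp only [mem_preimage, mem_Iic, mem_empty_iff_false, iff_false, not_le, energy_eq_abs]
      exact ht.trans_le (abs_nonneg _)
    rw [h1, h2]; simp
  · have h1 : Iic (0 : ℝ) ∩ Ici 0 = {0} := by
      rw [inter_comm, Ici_inter_Iic, Icc_self]
    rw [h1]
    have h2 : ∫⁻ y in ({0} : Set ℝ), ENNReal.ofReal (p y + p (-y)) = 0 := by
      rw [Measure.restrict_singleton]; simp
    rw [h2]
    have h3 : Tendsto (fun t : ℝ => ENNReal.ofReal (∫ y in (-t)..t, p y)) (𝓝[>] 0) (𝓝 0) := by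
      have h4 : Continuous fun t : ℝ => ∫ y in (0 : ℝ)..t, (p y + p (-y)) :=
        intervalIntegral.continuous_primitive (fun a b => hgc.intervalIntegrable a b) 0
      have h5 := (h4.tendsto 0).mono_left (nhdsWithin_le_nhds (s := Ioi 0))
      rw [intervalIntegral.integral_same] at h5
      simp_rw [hsym]
      simpa using ENNReal.tendsto_ofReal h5
    refine le_antisymm (ge_of_tendsto h3 ?_) bot_le
    filter_upwards [self_mem_nhdsWithin] with t ht
    rw [← hatom t ht]
    exact measure_mono fun X (hX : energy X σ ≤ 0) => hX.trans (le_of_lt ht)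
  · have h1 : Iic t ∩ Ici (0 : ℝ) = Icc 0 t := by rw [inter_comm, Ici_inter_Iic]
    have h2 : (fun X => energy X σ) ⁻¹' Iic t = {X | energy X σ ≤ t} := rfl
    rw [h1, h2, hatom t ht, hsym, intervalIntegral.integral_of_le ht.le,
      ← integral_Icc_eq_integral_Ioc, ofReal_integral_eq_lintegral_ofReal
        hgc.continuousOn.integrableOn_Icc (Eventually.of_forall fun y => add_nonneg (hp0 _) (hp0 _))]

variable {ρ : ℝ → ℝ}

theorem isContinuousEnergyDensity_energyDensity {n : ℕ} (h : ∃ g, IsContinuousEnergyDensity ρ n g) :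
    IsContinuousEnergyDensity ρ n (energyDensity ρ n) := by
  rw [energyDensity, dif_pos h]
  exact h.choose_spec

/-- Unbalanced arrays are too few to exhaust all arrays. As the energy density is the same for every
configuration, one balanced sequence of single rows is enough to identify it through the local limit
theorem. -/
theorem exists_balanced_seq (ι : Type*) [Fintype ι] [DecidableEq ι] :
    ∃ (δ : ℝ) (s : ∀ n : ℕ, Fin n → ι → ℤˣ), 0 < δ ∧ ∀ᶠ n in atTop, IsBalanced δ (s n) := by
  obtain ⟨δ, r, hδ, hr0, hr1, hcount⟩ := exists_card_rare_le (V := ι → ℤˣ)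
  set N : ℝ := (Fintype.card (ι → ℤˣ) : ℝ) with hN
  have hN0 : 0 < N := by rw [hN]; exact_mod_cast Fintype.card_pos
  have hlim := (tendsto_pow_atTop_nhds_zero_of_lt_one hr0.le hr1).const_mul N
  rw [mul_zero] at hlim
  have hex : ∀ᶠ n : ℕ in atTop, ∃ s : Fin n → ι → ℤˣ, IsBalanced δ s := by
    filter_upwards [hlim.eventually (gt_mem_nhds one_pos)] with n hn
    by_contra hne
    push Not at hne
    have h1 : (Finset.univ.filter fun s : Fin n → ι → ℤˣ =>
        ∃ v, ((Finset.univ.filter fun i => s i = v).card : ℝ) < δ * n) = Finset.univ := by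
      refine Finset.filter_true_of_mem fun s _ => ?_
      simpa [IsBalanced, colCount] using hne s
    have h2 := hcount n
    rw [h1, Finset.card_univ, Fintype.card_fun, Fintype.card_fin, Nat.cast_pow, ← hN, mul_pow] at h2
    have h3 : 0 < N ^ n := by positivity
    nlinarith
  classical
  refine ⟨δ, fun n => if h : ∃ s : Fin n → ι → ℤˣ, IsBalanced δ s then h.choose else 1, hδ, ?_⟩
  filter_upwards [hex] with n hn
  rw [dif_pos hn]
  exact hn.choose_spec

theorem IsBalanced.neg {ι : Type*} [Fintype ι] {δ : ℝ} {n : ℕ} {s : Fin n → ι → ℤˣ}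
    (h : IsBalanced δ s) : IsBalanced δ (-s) := by
  intro v
  refine (h (-v)).trans (le_of_eq ?_)
  simp only [colCount]
  congr 2
  ext i
  simp [neg_eq_iff_eq_neg]

theorem IsContinuousEnergyDensity.measureReal_energy {n : ℕ} {g : ℝ → ℝ}
    (hg : IsContinuousEnergyDensity ρ n g) (σ : Config n) {a b : ℝ} (ha : 0 ≤ a) :
    (weightLaw ρ n).real {X | energy X σ ∈ Icc a b} = ∫ y in Icc a b, g y := by
  have hEm : Measurable fun X => energy X σ := by
    simp_rw [energy_eq_abs]
    exact continuous_abs.measurable.comp (measurable_signedSum σ)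
  have hsub : Icc a b ⊆ Ici 0 := fun y hy => ha.trans hy.1
  have h1 := congrArg (fun m => m (Icc a b)) (hg.law σ)
  rw [Measure.map_apply hEm measurableSet_Icc, withDensity_apply _ measurableSet_Icc,
    Measure.restrict_restrict measurableSet_Icc, inter_eq_left.2 hsub] at h1
  have hintg : IntegrableOn g (Icc a b) := (hg.continuousOn.mono hsub).integrableOn_Icc
  rw [← ofReal_integral_eq_lintegral_ofReal hintg (Eventually.of_forall fun y => hg.nonneg y)] at h1
  rw [measureReal_def]
  change (weightLaw ρ n ((fun X => energy X σ) ⁻¹' Icc a b)).toReal = _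
  rw [h1, ENNReal.toReal_ofReal (integral_nonneg fun y => hg.nonneg y)]

theorem boxEvent_unit {n : ℕ} (s : Fin n → Unit → ℤˣ) (α ζ : ℝ) :
    boxEvent s α ζ (fun _ => 0) (fun _ => 1) =
      {X | signedSum (fun i => s i ()) X ∈ Icc α (α + ζ)} := by
  ext X
  simp only [boxEvent, mem_ofPred_eq, zero_mul, one_mul, add_zero]
  exact ⟨fun h => h (), fun h _ => h⟩

theorem Admissible.measureReal_energy_eq_add (hρ : Admissible ρ) {n : ℕ} (s : Fin n → Unit → ℤˣ)
    {α ζ : ℝ} (hα : 0 < α) :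
    (weightLaw ρ n).real {X | energy X (fun i => s i ()) ∈ Icc α (α + ζ)} =
      (weightLaw ρ n).real (boxEvent s α ζ (fun _ => 0) (fun _ => 1)) +
      (weightLaw ρ n).real (boxEvent (-s) α ζ (fun _ => 0) (fun _ => 1)) := by
  have := hρ.isProbabilityMeasure
  have hprob : IsProbabilityMeasure (weightLaw ρ n) := by rw [weightLaw_eq]; infer_instance
  rw [← measureReal_union ?_ (measurableSet_boxEvent _ _ _ _ _)]
  · congr 1
    rw [boxEvent_unit, boxEvent_unit]
    ext X
    have h1 : signedSum (fun i => (-s) i ()) X = -signedSum (fun i => s i ()) X :=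
      signedSum_neg X (fun i => s i ())
    simp only [mem_ofPred_eq, mem_union, h1, energy_eq_abs, mem_Icc]
    set S := signedSum (fun i => s i ()) X
    rcases le_total 0 S with h | h
    · rw [abs_of_nonneg h]
      refine ⟨Or.inl, fun h' => h'.resolve_right fun h2 => ?_⟩
      linarith [h2.1]
    · rw [abs_of_nonpos h]
      refine ⟨Or.inr, fun h' => h'.resolve_left fun h2 => ?_⟩
      linarith [h2.1]
  · rw [boxEvent_unit, boxEvent_unit, Set.disjoint_left]
    intro X h2 h3
    have h1 : signedSum (fun i => (-s) i ()) X = -signedSum (fun i => s i ()) X :=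
      signedSum_neg X (fun i => s i ())
    simp only [mem_ofPred_eq, h1, mem_Icc] at h2 h3
    linarith [h2.1, h3.1]

/-- The density is read off as a window average. The energy lies in the window when the signed sum
of `σ` or that of `-σ` does, and each event contributes `1/√(2π)` by the local limit theorem with
one row. -/
theorem Admissible.tendsto_energyDensity (hρ : Admissible ρ) {α : ℕ → ℝ} (hα : ∀ n, 0 < α n)
    (hα4 : Tendsto (fun n => α n ^ 4 / n) atTop (𝓝 0)) :
    Tendsto (fun n => energyDensity ρ n (α n) * Real.exp (α n ^ 2 / 2)) atTop
      (𝓝 (2 * (Real.sqrt (2 * Real.pi))⁻¹)) := by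
  obtain ⟨M, C, Q, η, H⟩ := hρ.exists_laplaceBounds
  obtain ⟨δ, s, hδ, hs⟩ := exists_balanced_seq Unit
  obtain ⟨w, hw⟩ := exists_signMatrix_det_ne_zero (κ := Unit)
  set g : ℕ → ℝ → ℝ := fun n => energyDensity ρ n with hg
  -- The local limit theorem puts no lower bound on the window width, so `ζ` may be so small that `g
  -- n` is constant on the window up to `e^{-α²/2}/(n+1)`. The explicit bound also gives `ζ → 0` and
  -- `α ζ → 0`.
  have hζ : ∀ n : ℕ, ∃ ζ : ℝ, 0 < ζ ∧ ζ ≤ 1 / (((n : ℝ) + 1) * (1 + α n)) ∧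
      (IsContinuousEnergyDensity ρ n (g n) → ∀ y ∈ Icc (α n) (α n + ζ),
        |g n y - g n (α n)| ≤ Real.exp (-(α n ^ 2 / 2)) * (1 / ((n : ℝ) + 1))) := by
    intro n
    have hb : 0 < 1 / (((n : ℝ) + 1) * (1 + α n)) := by have := hα n; positivity
    by_cases hd : IsContinuousEnergyDensity ρ n (g n)
    · have hc : ContinuousAt (g n) (α n) := hd.continuousOn.continuousAt (Ici_mem_nhds (hα n))
      obtain ⟨ε, hε, hball⟩ := Metric.continuousAt_iff.1 hc
        (Real.exp (-(α n ^ 2 / 2)) * (1 / ((n : ℝ) + 1))) (by positivity)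
      refine ⟨min (ε / 2) (1 / (((n : ℝ) + 1) * (1 + α n))), lt_min (half_pos hε) hb,
        min_le_right _ _, fun _ y hy => (hball ?_).le⟩
      rw [Real.dist_eq, abs_of_nonneg (by linarith [hy.1])]
      have := min_le_left (ε / 2) (1 / (((n : ℝ) + 1) * (1 + α n)))
      linarith [hy.2]
    · exact ⟨_, hb, le_rfl, fun h => absurd h hd⟩
  choose ζ hζ0 hζ1 hζ2 using hζ
  have hone := tendsto_one_div_add_atTop_nhds_zero_nat (𝕜 := ℝ)
  have hR : LimitRegime atTop (id : ℕ → ℕ) α ζ := by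
    refine ⟨tendsto_id, hα4, Eventually.of_forall hζ0, ?_, ?_⟩
    · refine squeeze_zero (fun n => (hζ0 n).le) (fun n => (hζ1 n).trans ?_) hone
      have := hα n
      gcongr
      exact le_mul_of_one_le_right (by positivity) (by linarith)
    · refine squeeze_zero (fun n => by have := hζ0 n; positivity) (fun n => ?_) hone
      have h1 := hα n
      rw [abs_of_pos h1]
      calc α n * ζ n ≤ α n * (1 / (((n : ℝ) + 1) * (1 + α n))) := by gcongr; exact hζ1 n
        _ = 1 / ((n : ℝ) + 1) * (α n / (1 + α n)) := by field_simp
        _ ≤ 1 / ((n : ℝ) + 1) * 1 := by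
            gcongr
            rw [div_le_one (by linarith)]; linarith
        _ = _ := mul_one _
  have hθ : Tendsto (fun n => (1 + α n ^ 2) * (0 : ℝ)) atTop (𝓝 0) := by simp
  have hllt : ∀ s : ∀ n : ℕ, Fin n → Unit → ℤˣ, (∀ᶠ n in atTop, IsBalanced δ (s n)) →
      Tendsto (fun n => (weightLaw ρ n).real (boxEvent (s n) (α n) (ζ n) (fun _ => 0) (fun _ => 1)) /
        (ζ n * Real.exp (-(α n ^ 2 / 2)))) atTop (𝓝 ((Real.sqrt (2 * Real.pi))⁻¹)) := by
    intro s hs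
    have h := tendsto_measureReal_boxEvent (β := ℕ) (l := atTop) (N := id) (s := s) (θ := fun _ => 0)
      H hR hw hδ (fun _ => le_rfl) hθ
      (Eventually.of_forall fun n j k hjk => absurd (Subsingleton.elim j k) hjk) hs
      (c := fun _ => 0) (d := fun _ => 1) (fun _ => one_pos)
    simpa [weightLaw_eq] using h
  have hsum := (hllt s hs).add (hllt (fun n => -s n) (hs.mono fun n h => h.neg))
  rw [← two_mul] at hsum
  have hdiff : Tendsto (fun n => g n (α n) * Real.exp (α n ^ 2 / 2) -
      ((weightLaw ρ n).real (boxEvent (s n) (α n) (ζ n) (fun _ => 0) (fun _ => 1)) /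
        (ζ n * Real.exp (-(α n ^ 2 / 2))) +
      (weightLaw ρ n).real (boxEvent (-s n) (α n) (ζ n) (fun _ => 0) (fun _ => 1)) /
        (ζ n * Real.exp (-(α n ^ 2 / 2))))) atTop (𝓝 0) := by
    refine squeeze_zero_norm' ?_ hone
    filter_upwards [hρ.eventually_exists_density] with n hn
    have hd := isContinuousEnergyDensity_energyDensity hn
    have hz := hζ0 n
    rw [← add_div, ← hρ.measureReal_energy_eq_add (s n) (hα n), hd.measureReal_energy _ (hα n).le]
    set E := Real.exp (-(α n ^ 2 / 2)) with hE
    have hE0 : 0 < E := Real.exp_pos _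
    have hEinv : Real.exp (α n ^ 2 / 2) = E⁻¹ := by rw [hE, Real.exp_neg, inv_inv]
    have hconst : ∫ _y in Icc (α n) (α n + ζ n), g n (α n) = ζ n * g n (α n) := by
      rw [setIntegral_const, Real.volume_real_Icc_of_le (by linarith), smul_eq_mul]
      ring
    have hintg : IntegrableOn (g n) (Icc (α n) (α n + ζ n)) :=
      (hd.continuousOn.mono fun y hy => (hα n).le.trans hy.1).integrableOn_Icc
    have h1 : ‖∫ y in Icc (α n) (α n + ζ n), (g n (α n) - g n y)‖ ≤
        E * (1 / ((n : ℝ) + 1)) * ζ n := by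
      have := norm_setIntegral_le_of_norm_le_const (μ := volume) (s := Icc (α n) (α n + ζ n))
        (f := fun y => g n (α n) - g n y) (C := E * (1 / ((n : ℝ) + 1))) (by simp) (fun y hy => by
          rw [Real.norm_eq_abs, abs_sub_comm]; exact hζ2 n hd y hy)
      rw [Real.volume_real_Icc_of_le (by linarith)] at this
      simpa using this
    rw [integral_sub (by simp) hintg, hconst] at h1
    have h2 : g n (α n) * Real.exp (α n ^ 2 / 2) -
        (∫ y in Icc (α n) (α n + ζ n), energyDensity ρ n y) / (ζ n * E) =
        (ζ n * g n (α n) - ∫ y in Icc (α n) (α n + ζ n), g n y) / (ζ n * E) := by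
      rw [hEinv]
      field_simp
      rfl
    rw [h2, norm_div, Real.norm_of_nonneg (by positivity : 0 ≤ ζ n * E), div_le_iff₀ (by positivity)]
    refine h1.trans (le_of_eq ?_)
    ring
  have h := hdiff.add hsum
  rw [zero_add] at h
  refine h.congr fun n => ?_
  simp [hg]

theorem Admissible.scalingRegime (hρ : Admissible ρ) {α : ℕ → ℝ} (hα : ∀ n, 0 < α n)
    (hα' : Asymptotics.IsLittleO atTop α fun n : ℕ => (n : ℝ) ^ (1 / 4 : ℝ)) :
    ScalingRegime α (scaling ρ α) := by
  have hα4 : Tendsto (fun n => α n ^ 4 / n) atTop (𝓝 0) := by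
    have h1 := (hα'.pow (n := 4) (by norm_num)).tendsto_div_nhds_zero
    refine h1.congr fun n => ?_
    rw [← Real.rpow_natCast ((n : ℝ) ^ (1 / 4 : ℝ)), ← Real.rpow_mul (by positivity)]
    norm_num
  have h1 := hρ.tendsto_energyDensity hα hα4
  have hpos : 0 < 2 * (Real.sqrt (2 * Real.pi))⁻¹ := by positivity
  have h2 : ∀ᶠ n in atTop, 0 < energyDensity ρ n (α n) := by
    filter_upwards [h1.eventually (lt_mem_nhds hpos)] with n hn
    exact pos_of_mul_pos_left hn (Real.exp_pos _).le
  refine ⟨hα, hα4, ?_, ?_⟩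
  · filter_upwards [h2] with n hn
    rw [scaling]; positivity
  -- The factor 2 from `2^n = 2 * 2^(n-1)` cancels the 2 in the density limit, which comes from
  -- folding the signed sum to its absolute value.
  · have h3 := (h1.inv₀ hpos.ne').const_mul 2
    have h4 : 2 * (2 * (Real.sqrt (2 * Real.pi))⁻¹)⁻¹ = Real.sqrt (2 * Real.pi) := by
      rw [mul_inv, inv_inv]; ring
    rw [h4] at h3
    refine h3.congr' ?_
    filter_upwards [h2, eventually_ge_atTop 1] with n hn hn1
    have h5 : (2 : ℝ) ^ n = 2 * 2 ^ (n - 1) := by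
      rw [← pow_succ']; congr 1; omega
    rw [scaling, h5, Real.exp_neg]
    field_simp

/-! ### Factorial moments as sums over sign arrays -/

variable {ρ : ℝ → ℝ} {n : ℕ}

/-- Each partition with positive energy has exactly one representative with positive signed sum. -/
theorem Z_eq_card (X : Fin n → ℝ) {a : ℝ} (ha : 0 < a) (b : ℝ) :
    Z X a b = Nat.card {σ : Config n // signedSum σ X ∈ Icc a b} := by
  symm
  have hmem : ∀ σ : Config n, signedSum σ X ∈ Icc a b → energy X σ ∈ Icc a b := fun σ h => by
    rw [energy_eq_abs, abs_of_pos (ha.trans_le h.1)]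
    exact h
  refine Nat.card_eq_of_bijective
    (fun σ => (⟨Quotient.mk (partitionSetoid n) σ.1, hmem σ.1 σ.2⟩ :
      {p : Partition n // partitionEnergy X p ∈ Icc a b})) ⟨?_, ?_⟩
  · rintro ⟨σ, hσ⟩ ⟨τ, hτ⟩ h
    have h1 : σ = τ ∨ σ = -τ := Quotient.exact (Subtype.mk.inj h)
    rcases h1 with rfl | rfl
    · rfl
    · rw [signedSum_neg] at hσ
      linarith [hσ.1, hτ.1]
  · rintro ⟨p, hp⟩
    induction p using Quotient.inductionOn with
    | h σ =>
      have h1 : energy X σ ∈ Icc a b := hp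
      rw [energy_eq_abs] at h1
      rcases le_total 0 (signedSum σ X) with h | h
      · rw [abs_of_nonneg h] at h1
        exact ⟨⟨σ, h1⟩, rfl⟩
      · rw [abs_of_nonpos h, ← signedSum_neg] at h1
        refine ⟨⟨-σ, h1⟩, Subtype.ext (Quotient.sound ?_)⟩
        exact Or.inr rfl

section Blocks

variable {m : ℕ} {k : Fin m → ℕ}

/-- The rows of the array are distinct within each block. -/
def BlockInjective (s : Fin n → (Σ l, Fin (k l)) → ℤˣ) : Prop :=
  ∀ l, Function.Injective fun (r : Fin (k l)) i => s i ⟨l, r⟩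

/-- Families of injections into the sets of configurations are arrays of signs with rows in these
sets that are distinct within each block. -/
def embeddingsEquiv (A : Fin m → Config n → Prop) :
    (∀ l, Fin (k l) ↪ {σ : Config n // A l σ}) ≃
      {s : Fin n → (Σ l, Fin (k l)) → ℤˣ // BlockInjective s ∧ ∀ j, A j.1 fun i => s i j} where
  toFun e := ⟨fun i j => (e j.1 j.2).1 i, fun l _ _ h => (e l).injective (Subtype.ext h),
    fun j => (e j.1 j.2).2⟩
  invFun t l := ⟨fun r => ⟨fun i => t.1 i ⟨l, r⟩, t.2.2 ⟨l, r⟩⟩,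
    fun _ _ h => t.2.1 l (Subtype.mk.inj h)⟩
  left_inv _ := rfl
  right_inv _ := rfl

/-- A falling factorial `(Z)_k` counts injections of `Fin k` into the counted set, so the product
counts families of configurations distinct within each block. Positivity of the lower endpoints
permits replacing partitions by configurations with a positive signed sum. -/
theorem prod_descFactorial_eq (X : Fin n → ℝ) {α ξ : ℝ} {c d : Fin m → ℝ}
    (hα : ∀ l, 0 < α + c l * ξ) :
    ∏ l, ((Z X (α + c l * ξ) (α + d l * ξ)).descFactorial (k l) : ℝ) =
      ∑ s : Fin n → (Σ l, Fin (k l)) → ℤˣ, {s | BlockInjective s}.indicator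
        (fun s => (boxEvent s α ξ (fun j => c j.1) (fun j => d j.1)).indicator (fun _ => (1 : ℝ)) X) s := by
  classical
  have h1 : ∀ l, (Z X (α + c l * ξ) (α + d l * ξ)).descFactorial (k l) =
      Fintype.card (Fin (k l) ↪ {σ : Config n // signedSum σ X ∈ Icc (α + c l * ξ) (α + d l * ξ)}) := by
    intro l
    rw [Z_eq_card X (hα l), Nat.card_eq_fintype_card, Fintype.card_embedding_eq, Fintype.card_fin]
  simp_rw [h1]
  rw [← Nat.cast_prod, ← Fintype.card_pi,
    Fintype.card_congr (embeddingsEquiv fun l σ => signedSum σ X ∈ Icc (α + c l * ξ) (α + d l * ξ)),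
    Fintype.card_subtype, Finset.card_filter]
  push_cast
  refine Finset.sum_congr rfl fun s _ => ?_
  by_cases hb : BlockInjective s
  · rw [indicator_of_mem (by exact hb)]
    simp only [hb, true_and, indicator_apply]
    exact if_congr Iff.rfl rfl rfl
  · rw [indicator_of_notMem (by exact hb)]
    simp [hb]

theorem Admissible.integral_prod_descFactorial (hρ : Admissible ρ) {α ξ : ℝ} {c d : Fin m → ℝ}
    (hα : ∀ l, 0 < α + c l * ξ) :
    ∫ X, ∏ l, ((Z X (α + c l * ξ) (α + d l * ξ)).descFactorial (k l) : ℝ) ∂(weightLaw ρ n) =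
      ∑ s : Fin n → (Σ l, Fin (k l)) → ℤˣ, {s | BlockInjective s}.indicator
        (fun s => (weightLaw ρ n).real (boxEvent s α ξ (fun j => c j.1) (fun j => d j.1))) s := by
  have := hρ.isProbabilityMeasure
  have hprob : IsProbabilityMeasure (weightLaw ρ n) := by rw [weightLaw_eq]; infer_instance
  simp_rw [fun X : Fin n → ℝ => prod_descFactorial_eq (k := k) (d := d) X hα]
  have hintg : ∀ s : Fin n → (Σ l, Fin (k l)) → ℤˣ, Integrable (fun X => {s | BlockInjective s}.indicator
      (fun s => (boxEvent s α ξ (fun j => c j.1) (fun j => d j.1)).indicator (fun _ => (1 : ℝ)) X) s)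
      (weightLaw ρ n) := by
    intro s
    by_cases hb : BlockInjective s
    · simp only [indicator_of_mem (show s ∈ {s | BlockInjective s} from hb)]
      exact (integrable_const _).indicator (measurableSet_boxEvent _ _ _ _ _)
    · simp only [indicator_of_notMem (show s ∉ {s | BlockInjective s} from hb)]
      exact integrable_zero _ _ _
  rw [integral_finsetSum _ fun s _ => hintg s]
  refine Finset.sum_congr rfl fun s _ => ?_
  by_cases hb : BlockInjective s
  · simp only [indicator_of_mem (show s ∈ {s | BlockInjective s} from hb)]
    rw [integral_indicator (measurableSet_boxEvent _ _ _ _ _), setIntegral_const, smul_eq_mul, mul_one]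
  · simp only [indicator_of_notMem (show s ∉ {s | BlockInjective s} from hb)]
    exact integral_zero _ _

/-- Two equal rows in different blocks force the signed sum to hit a common endpoint. -/
theorem Admissible.measureReal_boxEvent_eq_zero (hρ : Admissible ρ)
    (hg : ∃ g, IsContinuousEnergyDensity ρ n g) {α ξ : ℝ} (hα : 0 < α)
    (hξ : 0 < ξ) {c d : Fin m → ℝ} (hc : ∀ l, 0 ≤ c l) (hcd : ∀ l, c l < d l)
    (hdisj : Pairwise fun l l' => Disjoint (Ioo (c l) (d l)) (Ioo (c l') (d l')))
    {s : Fin n → (Σ l, Fin (k l)) → ℤˣ} (hb : BlockInjective s)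
    (hs : ¬Function.Injective fun j i => s i j) :
    (weightLaw ρ n).real (boxEvent s α ξ (fun j => c j.1) (fun j => d j.1)) = 0 := by
  have := hρ.isProbabilityMeasure
  have hprob : IsProbabilityMeasure (weightLaw ρ n) := by rw [weightLaw_eq]; infer_instance
  obtain ⟨g, hg⟩ := hg
  have hpoint : ∀ (σ : Config n) (y : ℝ), 0 ≤ y →
      (weightLaw ρ n).real {X | signedSum σ X = y} = 0 := by
    intro σ y hy
    refine le_antisymm ?_ measureReal_nonneg
    calc _ ≤ (weightLaw ρ n).real {X | energy X σ ∈ Icc y y} := by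
          refine measureReal_mono fun X hX => ?_
          have hX' : signedSum σ X = y := hX
          rw [mem_ofPred_eq, energy_eq_abs, hX', abs_of_nonneg hy]
          simp
      _ = 0 := by
          rw [hg.measureReal_energy σ hy]
          simp
  simp only [Function.Injective, not_forall] at hs
  obtain ⟨⟨l, r⟩, ⟨l', r'⟩, hrow, hne⟩ := hs
  have hll : l ≠ l' := by
    rintro rfl
    exact hne (congrArg (Sigma.mk l) (hb l hrow))
  have hends : d l ≤ c l' ∨ d l' ≤ c l := by
    have h1 := Ioo_disjoint_Ioo.1 (hdisj hll)
    have h2 := hcd l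
    have h3 := hcd l'
    rcases min_le_iff.1 h1 with h | h <;> rcases le_max_iff.1 h with h' | h'
    · linarith
    · exact Or.inl h'
    · exact Or.inr h'
    · linarith
  set σ : Config n := fun i => s i ⟨l, r⟩ with hσ
  have hrow' : ∀ X, normRowSum s ⟨l', r'⟩ X = signedSum σ X := fun X => by
    have : σ = fun i => s i ⟨l', r'⟩ := hrow
    rw [this]; rfl
  obtain ⟨y, hy, hsub⟩ : ∃ y : ℝ, 0 ≤ y ∧
      boxEvent s α ξ (fun j => c j.1) (fun j => d j.1) ⊆ {X | signedSum σ X = y} := by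
    rcases hends with h | h
    · refine ⟨α + d l * ξ, by have := (hc l).trans (hcd l).le; positivity, fun X hX => ?_⟩
      have h1 : signedSum σ X ≤ α + d l * ξ := (hX ⟨l, r⟩).2
      have h2 := (hX ⟨l', r'⟩).1
      rw [hrow'] at h2
      have h3 : d l * ξ ≤ c l' * ξ := by gcongr
      exact le_antisymm h1 (by simp only at h2; linarith)
    · refine ⟨α + c l * ξ, by have := hc l; positivity, fun X hX => ?_⟩
      have h1 : α + c l * ξ ≤ signedSum σ X := (hX ⟨l, r⟩).1
      have h2 := (hX ⟨l', r'⟩).2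
      rw [hrow'] at h2
      have h3 : d l' * ξ ≤ c l * ξ := by gcongr
      exact le_antisymm (by simp only at h2; linarith) h1
  exact le_antisymm ((measureReal_mono hsub).trans (hpoint σ y hy).le) measureReal_nonneg

end Blocks

end NumberPartition

theorem theorem3p1 (ρ : ℝ → ℝ) (hρ : NumberPartition.Admissible ρ)
    (α : ℕ → ℝ) (hα_pos : ∀ n, 0 < α n)
    (hα : Asymptotics.IsLittleO Filter.atTop α fun n : ℕ => (n : ℝ) ^ (1 / 4 : ℝ))
    (m : ℕ) (hm : 0 < m) (c d : Fin m → ℝ) (hc : ∀ l, 0 ≤ c l) (hcd : ∀ l, c l < d l)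
    (hdisj : Pairwise fun l l' => Disjoint (Set.Ioo (c l) (d l)) (Set.Ioo (c l') (d l')))
    (k : Fin m → ℕ) (hk : ∀ l, 0 < k l) :
    Filter.Tendsto
      (fun n : ℕ => ∫ X, ∏ l,
        ((NumberPartition.Z X
          (α n + c l * NumberPartition.scaling ρ α n)
          (α n + d l * NumberPartition.scaling ρ α n)).descFactorial (k l) : ℝ)
        ∂(NumberPartition.weightLaw ρ n))
      Filter.atTop (nhds (∏ l, (d l - c l) ^ k l)) := by
  have R := hρ.scalingRegime hα_pos hα
  have h := NumberPartition.tendsto_sum_injective (ι := Σ l, Fin (k l)) hρ R (c := fun j => c j.1)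
    (d := fun j => d j.1) (fun j => hc j.1) fun j => hcd j.1
  have hprod : ∏ j : Σ l, Fin (k l), (d j.1 - c j.1) = ∏ l, (d l - c l) ^ k l := by
    rw [Fintype.prod_sigma]
    simp
  rw [hprod] at h
  refine h.congr' ?_
  filter_upwards [R.ξ_pos, hρ.eventually_exists_density] with n hξ hg
  have hpos : ∀ l, 0 < α n + c l * NumberPartition.scaling ρ α n := fun l => by
    have h1 := hα_pos n
    have h2 := hc l
    positivity
  rw [hρ.integral_prod_descFactorial hpos]
  refine Finset.sum_congr rfl fun s _ => ?_
  -- Distinctness within blocks and distinctness of all rows differ only by arrays repeating a row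
  -- across blocks, and their windows have probability zero.
  by_cases hs : Function.Injective fun j i => s i j
  · have hb : NumberPartition.BlockInjective s := fun l r r' hrr => by
      have := hs (a₁ := ⟨l, r⟩) (a₂ := ⟨l, r'⟩) hrr
      simpa using this
    rw [indicator_of_mem (by exact hs), indicator_of_mem (by exact hb)]
  · rw [indicator_of_notMem (by exact hs)]
    by_cases hb : NumberPartition.BlockInjective s
    · rw [indicator_of_mem (by exact hb),
        hρ.measureReal_boxEvent_eq_zero hg (hα_pos n) hξ hc hcd hdisj hb hs]
    · rw [indicator_of_notMem (by exact hb)]
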